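/- Fix $\varepsilon\in(0,1)$, $b\in(0,1)$, an integer $k\ge 3$ and $j\in\{1,2\}$. Let $\mathbb T$ be the unit circle, $\Delta_\varepsilon=\{z\in\mathbb C:\ |z|>\varepsilon\}$ and $C_\varepsilon=\{z\in\mathbb C:\ \varepsilon<|z|<1/\varepsilon\}$. Let $X^{k+\log}$ be the real vector space of holomorphic functions $h$ on $\Delta_\varepsilon$ of the form $h(z)=\sum_{n\ge1}h_nz^{-n}$ with $h_n\in\mathbb R$, such that $$\|h\|_{X^{k+\log}}=\|h(\varepsilon\,\cdot)\|_{L^2(\mathbb T)}+\|(\partial_z^kh)(\varepsilon\,\cdot)\|_{L^2(\mathbb T)}+\Big\|\int_{\mathbb T}\frac{(\partial_z^kh)(\varepsilon\tau)-(\partial_z^kh)(\varepsilon\,\cdot)}{|\tau-\cdot|}\frac{d\tau}{\tau}\Big\|_{L^2(\mathbb T)}<\infty .$$ Let $Y^{k-1}$ be the real vector space of holomorphic functions $h$ on $C_\varepsilon$ of the form $h(z)=i\sum_{n\ge1}h_n(z^n-z^{-n})$ with $h_n\in\mathbb R$, such that $$\|h\|_{Y^{k-1}}=\|h(\varepsilon\,\cdot)\|_{L^2(\mathbb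 T)}+\|(\partial_z^{k-1}h)(\varepsilon\,\cdot)\|_{L^2(\mathbb T)}<\infty .$$ Here $L^2(\mathbb T)$ carries the measure $d\theta$ on $\{e^{i\theta}:0\le\theta\le2\pi\}$, and each quantity on the circle $|z|=\varepsilon$ is the limit, as $\rho\downarrow\varepsilon$, of the same quantity with $\varepsilon$ replaced by $\rho$. (These quantities are nonincreasing in $\rho$, on $(\varepsilon,\infty)$ for $X^{k+\log}$ and on $(\varepsilon,1]$ for $Y^{k-1}$, so the limits are suprema in $[0,\infty]$.) For $r>0$ put $V_r=\{f\in X^{k+\log}:\ \|f\|_{X^{k+\log}}\le r\}$. For $f_1,f_2\in X^{k+\log}$ let $\Phi_1(z)=z+f_1(z)$ and $\Phi_2(z)=bz+f_2(z)$, and for $\Omega\in\mathbb R$ and $\omega\in\mathbb T$ let $$G_j(\Omega,f_1,f_2)(\omega)=\operatorname{Im}\Big\{\big(\Omega\,\Phi_j(\omega)-S(\Phi_1,\Phi_j)(\omega)+S(\Phi_2,\Phi_j)(\omega)\big)\,\overline{\Phi_j'(\omega)}\,\overline\omega\Big\},$$ $$S(\Phi_i,\Phi_j)(\omega)=\frac1{2i\pi}\int_{\mathbb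 T}\frac{\tau\Phi_i'(\tau)-\omega\Phi_j'(\omega)}{|\Phi_i(\tau)-\Phi_j(\omega)|}\,\frac{d\tau}{\tau}.$$ **Proposition.** There is $r\in(0,1)$ such that the following holds. For all $f_1,f_2\in V_r$, $i\in\{1,2\}$ and $\tau,\omega\in\mathbb T$, the number $\Phi_i(\tau)-\Phi_j(\omega)$ vanishes only if $i=j$ and $\tau=\omega$, and the integrals $S(\Phi_i,\Phi_j)(\omega)$ converge absolutely. For all $(\Omega,f_1,f_2)\in\mathbb R\times V_r\times V_r$ the function $G_j(\Omega,f_1,f_2)$ on $\mathbb T$ is the restriction of an element of $Y^{k-1}$, with which it is identified (an element of $Y^{k-1}$ is determined by its values on $\mathbb T$ by the identity theorem). The resulting map $$G_j:\ \mathbb R\times V_r\times V_r\longrightarrow Y^{k-1}$$ is of class $C^1$ (on this subset of the normed space $\mathbb R\times X^{k+\log}\times X^{k+\log}$). -/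

import Mathlib

open Set MeasureTheory
open scoped ENNReal Real

noncomputable section

namespace VStates

/-! ### Domains and `L²` quantities on circles -/

/-- The exterior domain `Δ_ε = {ε < |z|}`. -/
def exterior (ε : ℝ) : Set ℂ := {z | ε < ‖z‖}

/-- The annulus `C_ε = {ε < |z| < 1/ε}`. -/
def annulus (ε : ℝ) : Set ℂ := {z | ε < ‖z‖ ∧ ‖z‖ < 1 / ε}

/-- `(∫_0^{2π} |v(e^{iθ})|² dθ)^{1/2}`, as an extended nonnegative real. -/
def L2T (v : ℂ → ℂ) : ℝ≥0∞ :=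
  eLpNorm (fun θ : ℝ => v (circleMap 0 1 θ)) 2 (volume.restrict (Ioc 0 (2 * π)))

/-- The singular integral `ω ↦ ∫_𝕋 (v(τ) - v(ω)) / |τ - ω| dτ/τ`. -/
def logIntegral (v : ℂ → ℂ) (ω : ℂ) : ℂ :=
  ∮ τ in C(0, 1), (v τ - v ω) / (‖τ - ω‖ : ℂ) / τ

/-- The supremum over the radii `ρ ∈ I` of the `L²` norms of `u(ρ ·)` on the unit circle. -/
def supL2 (I : Set ℝ) (u : ℂ → ℂ) : ℝ≥0∞ :=
  ⨆ ρ ∈ I, L2T (fun ω => u ((ρ : ℂ) * ω))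

/-- The supremum over the radii `ρ ∈ I` of the `L²` norms on the unit circle of
`ω ↦ ∫_𝕋 (u(ρτ) - u(ρω)) / |τ - ω| dτ/τ`. -/
def supLogL2 (I : Set ℝ) (u : ℂ → ℂ) : ℝ≥0∞ :=
  ⨆ ρ ∈ I, L2T (logIntegral (fun ω => u ((ρ : ℂ) * ω)))

/-- `v` is complex differentiable at every point of the unit circle. -/
def DiffOnT (v : ℂ → ℂ) : Prop := ∀ ω : ℂ, ‖ω‖ = 1 → DifferentiableAt ℂ v ω

lemma norm_circleMap_one (θ : ℝ) : ‖circleMap 0 1 θ‖ = 1 := by simp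

lemma DiffOnT.continuous {v : ℂ → ℂ} (hv : DiffOnT v) :
    Continuous (fun θ : ℝ => v (circleMap 0 1 θ)) := by
  rw [continuous_iff_continuousAt]
  intro θ
  exact ContinuousAt.comp (f := fun θ : ℝ => circleMap 0 1 θ) (g := v)
    (hv _ (norm_circleMap_one θ)).continuousAt (continuous_circleMap 0 1).continuousAt

lemma L2T_add_le {v w : ℂ → ℂ}
    (hv : AEStronglyMeasurable (fun θ : ℝ => v (circleMap 0 1 θ))
      (volume.restrict (Ioc 0 (2 * π))))
    (hw : AEStronglyMeasurable (fun θ : ℝ => w (circleMap 0 1 θ))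
      (volume.restrict (Ioc 0 (2 * π)))) :
    L2T (fun ω => v ω + w ω) ≤ L2T v + L2T w :=
  eLpNorm_add_le hv hw (by norm_num)

lemma L2T_congr {v w : ℂ → ℂ} (h : ∀ ω : ℂ, ‖ω‖ = 1 → v ω = w ω) : L2T v = L2T w := by
  unfold L2T
  congr 1
  funext θ
  exact h _ (norm_circleMap_one θ)

lemma L2T_smul (c : ℝ) (v : ℂ → ℂ) : L2T (fun ω => (c : ℂ) * v ω) = ‖c‖ₑ * L2T v := by
  have := eLpNorm_const_smul (c : ℂ) (fun θ : ℝ => v (circleMap 0 1 θ)) 2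
    (volume.restrict (Ioc 0 (2 * π)))
  unfold L2T
  have e : ‖(c : ℂ)‖ₑ = ‖c‖ₑ := by
    rw [← ofReal_norm, ← ofReal_norm, Complex.norm_real]
  rw [e] at this
  exact this

lemma L2T_eq_zero {v : ℂ → ℂ} (hv : DiffOnT v) (h : L2T v = 0) (ω : ℂ) (hω : ‖ω‖ = 1) :
    v ω = 0 := by
  have hc := hv.continuous
  unfold L2T at h
  rw [eLpNorm_eq_zero_iff hc.aestronglyMeasurable (by norm_num)] at h
  have h2 : ∀ θ ∈ Ioc (0 : ℝ) (2 * π), v (circleMap 0 1 θ) = 0 := by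
    have h3 : EqOn (fun θ : ℝ => v (circleMap 0 1 θ)) 0 (Ioc (0 : ℝ) (2 * π)) := by
      refine Measure.eqOn_Ioc_of_ae_eq volume h hc.continuousOn continuousOn_const
    exact h3
  have hmem : ω ∈ circleMap 0 1 '' Ioc (0 : ℝ) (2 * π) := by
    have : ω ∈ Metric.sphere (0 : ℂ) |1| := by simpa using hω
    rw [← image_circleMap_Ioc] at this
    exact this
  obtain ⟨θ, hθ, rfl⟩ := hmem
  exact h2 θ hθ

lemma DiffOnT.circleIntegrable_log {v : ℂ → ℂ} (hv : DiffOnT v) {ω : ℂ} (hω : ‖ω‖ = 1) :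
    CircleIntegrable (fun τ => (v τ - v ω) / (‖τ - ω‖ : ℂ) / τ) 0 1 := by
  have hd : Continuous (fun θ : ℝ => dslope v ω (circleMap 0 1 θ) / circleMap 0 1 θ) := by
    rw [continuous_iff_continuousAt]
    intro θ
    refine ContinuousAt.div ?_ (continuous_circleMap 0 1).continuousAt (by simp)
    refine ContinuousAt.comp (f := fun θ : ℝ => circleMap 0 1 θ) (g := dslope v ω) ?_
      (continuous_circleMap 0 1).continuousAt
    by_cases h : circleMap 0 1 θ = ω
    · rw [h]
      exact continuousAt_dslope_same.2 (hv ω hω)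
    · exact (continuousAt_dslope_of_ne h).2 (hv _ (norm_circleMap_one θ)).continuousAt
  have hm : Measurable (fun θ : ℝ => (circleMap 0 1 θ - ω) / (‖circleMap 0 1 θ - ω‖ : ℂ)) := by
    have := (continuous_circleMap 0 1).measurable
    fun_prop
  unfold CircleIntegrable
  have h1 : IntervalIntegrable
      (fun θ : ℝ => (dslope v ω (circleMap 0 1 θ) / circleMap 0 1 θ) *
        ((circleMap 0 1 θ - ω) / (‖circleMap 0 1 θ - ω‖ : ℂ))) volume 0 (2 * π) := by
    have h0 := hd.intervalIntegrable (μ := volume) 0 (2 * π)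
    rw [intervalIntegrable_iff] at h0 ⊢
    refine h0.mul_bdd (c := 1) hm.aestronglyMeasurable (Filter.Eventually.of_forall ?_)
    intro θ
    rw [norm_div, Complex.norm_real, norm_norm]
    exact div_self_le_one _
  refine h1.congr ?_
  intro θ _
  by_cases h : circleMap 0 1 θ = ω
  · simp [h]
  · simp only [dslope_of_ne v h, slope_def_field]
    have : circleMap 0 1 θ - ω ≠ 0 := sub_ne_zero.2 h
    field_simp

lemma DiffOnT.logIntegral_add {v w : ℂ → ℂ} (hv : DiffOnT v) (hw : DiffOnT w) {ω : ℂ}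
    (hω : ‖ω‖ = 1) :
    logIntegral (fun z => v z + w z) ω = logIntegral v ω + logIntegral w ω := by
  unfold logIntegral
  rw [← circleIntegral.integral_add (hv.circleIntegrable_log hω) (hw.circleIntegrable_log hω)]
  congr 1
  funext τ
  ring

lemma logIntegral_smul (c : ℝ) (v : ℂ → ℂ) (ω : ℂ) :
    logIntegral (fun z => (c : ℂ) * v z) ω = (c : ℂ) * logIntegral v ω := by
  unfold logIntegral
  rw [← circleIntegral.integral_const_mul]
  congr 1
  funext τ
  ring

lemma DiffOnT.aestronglyMeasurable_log {v : ℂ → ℂ} (hv : DiffOnT v) :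
    AEStronglyMeasurable (fun θ : ℝ => logIntegral v (circleMap 0 1 θ))
      (volume.restrict (Ioc 0 (2 * π))) := by
  have hc := (continuous_circleMap 0 1).measurable
  have hvm := hv.continuous.measurable
  unfold logIntegral circleIntegral
  simp only [intervalIntegral.integral_of_le Real.two_pi_pos.le]
  refine StronglyMeasurable.aestronglyMeasurable ?_
  refine StronglyMeasurable.integral_prod_right (f := fun (x : ℝ) (θ : ℝ) =>
    deriv (circleMap 0 1) θ • ((v (circleMap 0 1 θ) - v (circleMap 0 1 x)) /
      (‖circleMap 0 1 θ - circleMap 0 1 x‖ : ℂ) / circleMap 0 1 θ)) ?_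
  refine Measurable.stronglyMeasurable ?_
  simp only [deriv_circleMap, Function.uncurry_def, smul_eq_mul]
  have a1 : Measurable (fun p : ℝ × ℝ => v (circleMap 0 1 p.1)) := hvm.comp measurable_fst
  have a2 : Measurable (fun p : ℝ × ℝ => v (circleMap 0 1 p.2)) := hvm.comp measurable_snd
  have b1 : Measurable (fun p : ℝ × ℝ => circleMap 0 1 p.1) := hc.comp measurable_fst
  have b2 : Measurable (fun p : ℝ × ℝ => circleMap 0 1 p.2) := hc.comp measurable_snd
  have c1 : Measurable (fun p : ℝ × ℝ => (‖circleMap 0 1 p.2 - circleMap 0 1 p.1‖ : ℂ)) :=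
    Complex.measurable_ofReal.comp (b2.sub b1).norm
  exact (b2.mul_const _).mul (((a2.sub a1).div c1).div b2)

/-- All the slices `u(ρ ·)`, `ρ ∈ I`, are complex differentiable along the unit circle. -/
def SliceDiff (I : Set ℝ) (u : ℂ → ℂ) : Prop :=
  ∀ ρ ∈ I, DiffOnT (fun ω => u ((ρ : ℂ) * ω))

lemma supL2_congr {I : Set ℝ} {u v : ℂ → ℂ}
    (h : ∀ ρ ∈ I, ∀ ω : ℂ, ‖ω‖ = 1 → u (ρ * ω) = v (ρ * ω)) : supL2 I u = supL2 I v := by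
  unfold supL2
  exact iSup_congr fun ρ => iSup_congr fun hρ => L2T_congr (h ρ hρ)

lemma supLogL2_congr {I : Set ℝ} {u v : ℂ → ℂ}
    (h : ∀ ρ ∈ I, ∀ ω : ℂ, ‖ω‖ = 1 → u (ρ * ω) = v (ρ * ω)) :
    supLogL2 I u = supLogL2 I v := by
  unfold supLogL2
  refine iSup_congr fun ρ => iSup_congr fun hρ => L2T_congr fun ω hω => ?_
  unfold logIntegral
  refine circleIntegral.integral_congr zero_le_one fun τ hτ => ?_
  have hτ' : ‖τ‖ = 1 := by simpa using hτ
  simp only [h ρ hρ ω hω, h ρ hρ τ hτ']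

lemma supL2_add_le {I : Set ℝ} {u v : ℂ → ℂ} (hu : SliceDiff I u) (hv : SliceDiff I v) :
    supL2 I (fun z => u z + v z) ≤ supL2 I u + supL2 I v := by
  refine iSup₂_le fun ρ hρ => ?_
  refine (L2T_add_le (hu ρ hρ).continuous.aestronglyMeasurable
    (hv ρ hρ).continuous.aestronglyMeasurable).trans ?_
  exact add_le_add (le_iSup₂ (f := fun (ρ : ℝ) (_ : ρ ∈ I) => L2T (fun ω => u ((ρ : ℂ) * ω))) ρ hρ)
    (le_iSup₂ (f := fun (ρ : ℝ) (_ : ρ ∈ I) => L2T (fun ω => v ((ρ : ℂ) * ω))) ρ hρ)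

lemma supLogL2_add_le {I : Set ℝ} {u v : ℂ → ℂ} (hu : SliceDiff I u) (hv : SliceDiff I v) :
    supLogL2 I (fun z => u z + v z) ≤ supLogL2 I u + supLogL2 I v := by
  refine iSup₂_le fun ρ hρ => ?_
  rw [L2T_congr (fun ω hω => (hu ρ hρ).logIntegral_add (hv ρ hρ) hω)]
  refine (L2T_add_le (hu ρ hρ).aestronglyMeasurable_log
    (hv ρ hρ).aestronglyMeasurable_log).trans ?_
  exact add_le_add
    (le_iSup₂ (f := fun (ρ : ℝ) (_ : ρ ∈ I) =>
      L2T (logIntegral (fun ω => u ((ρ : ℂ) * ω)))) ρ hρ)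
    (le_iSup₂ (f := fun (ρ : ℝ) (_ : ρ ∈ I) =>
      L2T (logIntegral (fun ω => v ((ρ : ℂ) * ω)))) ρ hρ)

lemma supL2_smul (I : Set ℝ) (c : ℝ) (u : ℂ → ℂ) :
    supL2 I (fun z => (c : ℂ) * u z) = ‖c‖ₑ * supL2 I u := by
  unfold supL2
  simp only [L2T_smul c, ENNReal.mul_iSup]

lemma supLogL2_smul (I : Set ℝ) (c : ℝ) (u : ℂ → ℂ) :
    supLogL2 I (fun z => (c : ℂ) * u z) = ‖c‖ₑ * supLogL2 I u := by
  unfold supLogL2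
  simp only [ENNReal.mul_iSup]
  refine iSup_congr fun ρ => iSup_congr fun hρ => ?_
  rw [← L2T_smul]
  exact L2T_congr fun ω _ => logIntegral_smul c _ ω

lemma supL2_zero (I : Set ℝ) : supL2 I (fun _ => 0) = 0 := by
  simpa using supL2_smul I 0 (fun _ => 0)

lemma supLogL2_zero (I : Set ℝ) : supLogL2 I (fun _ => 0) = 0 := by
  simpa using supLogL2_smul I 0 (fun _ => 0)

lemma eq_zero_of_supL2 {I : Set ℝ} {u : ℂ → ℂ} (hu : SliceDiff I u) (h : supL2 I u = 0)
    (z : ℂ) (hz : ‖z‖ ∈ I) (hz0 : z ≠ 0) : u z = 0 := by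
  have h1 : L2T (fun ω => u ((‖z‖ : ℂ) * ω)) = 0 := by
    refine le_antisymm ?_ bot_le
    rw [← h]
    exact le_iSup₂ (f := fun (ρ : ℝ) (_ : ρ ∈ I) => L2T (fun ω => u ((ρ : ℂ) * ω))) ‖z‖ hz
  have hn : (‖z‖ : ℂ) ≠ 0 := by simpa using hz0
  have h2 := L2T_eq_zero (hu _ hz) h1 (z / ‖z‖) (by simp [hz0])
  rwa [mul_div_cancel₀ _ hn] at h2

lemma isOpen_exterior (ε : ℝ) : IsOpen (exterior ε) := isOpen_lt continuous_const continuous_norm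

lemma isOpen_annulus (ε : ℝ) : IsOpen (annulus ε) :=
  (isOpen_lt continuous_const continuous_norm).inter (isOpen_lt continuous_norm continuous_const)

lemma differentiableOn_iteratedDeriv {U : Set ℂ} (hU : IsOpen U) {h : ℂ → ℂ}
    (hh : DifferentiableOn ℂ h U) (n : ℕ) : DifferentiableOn ℂ (iteratedDeriv n h) U := by
  induction n with
  | zero => simpa using hh
  | succ n ih =>
    rw [iteratedDeriv_succ]
    exact ih.deriv hU

lemma iteratedDeriv_add_of_mem {U : Set ℂ} (hU : IsOpen U) {h g : ℂ → ℂ}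
    (hh : DifferentiableOn ℂ h U) (hg : DifferentiableOn ℂ g U) (n : ℕ) {z : ℂ} (hz : z ∈ U) :
    iteratedDeriv n (h + g) z = iteratedDeriv n h z + iteratedDeriv n g z :=
  iteratedDeriv_add ((hh.contDiffOn hU).contDiffAt (hU.mem_nhds hz))
    ((hg.contDiffOn hU).contDiffAt (hU.mem_nhds hz))

lemma iteratedDeriv_real_smul (n : ℕ) (c : ℝ) (h : ℂ → ℂ) :
    iteratedDeriv n (c • h) = fun z => (c : ℂ) * iteratedDeriv n h z := by
  have e : c • h = fun z => (c : ℂ) * h z := by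
    funext z
    simp
  funext z
  rw [e, iteratedDeriv_const_mul_field]

lemma sliceDiff_of_differentiableOn {U : Set ℂ} (hU : IsOpen U) {I : Set ℝ} {u : ℂ → ℂ}
    (hu : DifferentiableOn ℂ u U) (hI : ∀ ρ ∈ I, ∀ ω : ℂ, ‖ω‖ = 1 → (ρ : ℂ) * ω ∈ U) :
    SliceDiff I u := by
  intro ρ hρ ω hω
  exact DifferentiableAt.comp ω (hu.differentiableAt (hU.mem_nhds (hI ρ hρ ω hω)))
    ((differentiableAt_id).const_mul _)

/-! ### The spaces `𝒜_ε` and `X^{k+log}` -/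

/-- The real vector space `𝒜_ε` of holomorphic functions `h` on `Δ_ε` of the form
`h(z) = ∑_{n ≥ 1} h_n z^{-n}` with real `h_n`. A function on `Δ_ε` is represented by its
extension by zero to `ℂ`. -/
def spaceA (ε : ℝ) : Submodule ℝ (ℂ → ℂ) where
  carrier := {h | (∀ z, z ∉ exterior ε → h z = 0) ∧ DifferentiableOn ℂ h (exterior ε) ∧
    ∃ a : ℕ → ℝ, ∀ z ∈ exterior ε, HasSum (fun n : ℕ => (a n : ℂ) * (z ^ (n + 1))⁻¹) (h z)}
  zero_mem' := ⟨fun _ _ => rfl, differentiableOn_const 0, 0, fun z _ => by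
    simp⟩
  add_mem' := by
    rintro h g ⟨h0, hd, a, ha⟩ ⟨g0, gd, b, hb⟩
    refine ⟨fun z hz => by simp [h0 z hz, g0 z hz], hd.add gd, a + b, fun z hz => ?_⟩
    simpa [add_mul] using (ha z hz).add (hb z hz)
  smul_mem' := by
    rintro c h ⟨h0, hd, a, ha⟩
    refine ⟨fun z hz => by simp [h0 z hz], hd.const_smul c, c • a, fun z hz => ?_⟩
    simpa [mul_assoc] using (ha z hz).mul_left (c : ℂ)

lemma ext_mem {ε ρ : ℝ} (hρ : ρ ∈ Ioi ε) {ω : ℂ} (hω : ‖ω‖ = 1) :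
    (ρ : ℂ) * ω ∈ exterior ε := by
  simp only [exterior, mem_ofPred_eq, norm_mul, hω, mul_one, Complex.norm_real, Real.norm_eq_abs]
  exact lt_of_lt_of_le hρ (le_abs_self ρ)

lemma spaceA_sliceDiff {ε : ℝ} {h : ℂ → ℂ} (hh : h ∈ spaceA ε) (n : ℕ) :
    SliceDiff (Ioi ε) (iteratedDeriv n h) :=
  sliceDiff_of_differentiableOn (isOpen_exterior ε)
    (differentiableOn_iteratedDeriv (isOpen_exterior ε) hh.2.1 n) fun _ hρ _ hω => ext_mem hρ hω

/-- The `X^{k+log}` norm with values in `[0,∞]`,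
`‖h‖_{L²(ε𝕋)} + ‖∂^k h‖_{L²(ε𝕋)} + ‖∫_𝕋 (∂^k h(ετ) - ∂^k h(ε·)) / |τ - ·| dτ/τ‖_{L²(𝕋)}`.
As `h` is only given on `ε < |z|`, the three quantities on the circle `ε𝕋` are the limits of the
same quantities on the circles `ρ𝕋` as `ρ` decreases to `ε`. For `h ∈ 𝒜_ε` the latter are
nonincreasing functions of `ρ > ε`, so the limit is the supremum over `ρ > ε`. -/
def enormX (ε : ℝ) (k : ℕ) (h : ℂ → ℂ) : ℝ≥0∞ :=
  supL2 (Ioi ε) h + supL2 (Ioi ε) (iteratedDeriv k h) + supLogL2 (Ioi ε) (iteratedDeriv k h)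

lemma enormX_zero (ε : ℝ) (k : ℕ) : enormX ε k 0 = 0 := by
  have e : iteratedDeriv k (0 : ℂ → ℂ) = fun _ => 0 := by
    simpa using iteratedDeriv_real_smul k 0 (0 : ℂ → ℂ)
  have e0 : supL2 (Ioi ε) (0 : ℂ → ℂ) = 0 := supL2_zero _
  simp [enormX, e, e0, supL2_zero, supLogL2_zero]

lemma enormX_smul (ε : ℝ) (k : ℕ) (c : ℝ) (h : ℂ → ℂ) :
    enormX ε k (c • h) = ‖c‖ₑ * enormX ε k h := by
  have e : c • h = fun z => (c : ℂ) * h z := by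
    funext z
    simp
  unfold enormX
  rw [iteratedDeriv_real_smul, supL2_smul, supLogL2_smul, e, supL2_smul]
  ring

lemma enormX_add_le {ε : ℝ} {k : ℕ} {h g : ℂ → ℂ} (hh : h ∈ spaceA ε) (hg : g ∈ spaceA ε) :
    enormX ε k (h + g) ≤ enormX ε k h + enormX ε k g := by
  have e : ∀ ρ ∈ Ioi ε, ∀ ω : ℂ, ‖ω‖ = 1 → iteratedDeriv k (h + g) ((ρ : ℂ) * ω) =
      (fun z => iteratedDeriv k h z + iteratedDeriv k g z) ((ρ : ℂ) * ω) := fun ρ hρ ω hω =>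
    iteratedDeriv_add_of_mem (isOpen_exterior ε) hh.2.1 hg.2.1 k (ext_mem hρ hω)
  have h0 : supL2 (Ioi ε) (h + g) ≤ supL2 (Ioi ε) h + supL2 (Ioi ε) g :=
    supL2_add_le (by simpa using spaceA_sliceDiff hh 0) (by simpa using spaceA_sliceDiff hg 0)
  have h1 := supL2_add_le (spaceA_sliceDiff hh k) (spaceA_sliceDiff hg k)
  have h2 := supLogL2_add_le (spaceA_sliceDiff hh k) (spaceA_sliceDiff hg k)
  unfold enormX
  rw [supL2_congr (u := iteratedDeriv k (h + g))
    (v := fun z => iteratedDeriv k h z + iteratedDeriv k g z) e,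
    supLogL2_congr (u := iteratedDeriv k (h + g))
    (v := fun z => iteratedDeriv k h z + iteratedDeriv k g z) e]
  refine (add_le_add (add_le_add h0 h1) h2).trans (le_of_eq ?_)
  ring

/-- The functions of `𝒜_ε` whose `X^{k+log}` norm is finite. -/
def subX (ε : ℝ) (k : ℕ) : Submodule ℝ (ℂ → ℂ) where
  carrier := {h | h ∈ spaceA ε ∧ enormX ε k h < ∞}
  zero_mem' := ⟨zero_mem _, by simp [enormX_zero]⟩
  add_mem' := fun hh hg => ⟨add_mem hh.1 hg.1,
    (enormX_add_le hh.1 hg.1).trans_lt (ENNReal.add_lt_top.2 ⟨hh.2, hg.2⟩)⟩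
  smul_mem' := fun c _ hh => ⟨Submodule.smul_mem _ c hh.1, by
    rw [enormX_smul]
    exact ENNReal.mul_lt_top enorm_lt_top hh.2⟩

/-- The space `X^{k+log}` (which depends on `ε`). -/
def X (ε : ℝ) (k : ℕ) : Type := subX ε k

namespace X

instance (ε : ℝ) (k : ℕ) : AddCommGroup (X ε k) := inferInstanceAs (AddCommGroup (subX ε k))

instance (ε : ℝ) (k : ℕ) : Module ℝ (X ε k) := inferInstanceAs (Module ℝ (subX ε k))

instance (ε : ℝ) (k : ℕ) : CoeFun (X ε k) (fun _ => ℂ → ℂ) := ⟨fun f => f.1⟩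

instance (ε : ℝ) (k : ℕ) : Norm (X ε k) := ⟨fun f => (enormX ε k f).toReal⟩

lemma normCore (ε : ℝ) (k : ℕ) : NormedSpace.Core ℝ (X ε k) where
  norm_nonneg f := ENNReal.toReal_nonneg
  norm_smul c f := by
    change (enormX ε k (c • f.1)).toReal = ‖c‖ * (enormX ε k f.1).toReal
    rw [enormX_smul, ENNReal.toReal_mul, toReal_enorm]
  norm_triangle f g := by
    change (enormX ε k (f.1 + g.1)).toReal ≤ (enormX ε k f.1).toReal + (enormX ε k g.1).toReal
    rw [← ENNReal.toReal_add f.2.2.ne g.2.2.ne]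
    exact ENNReal.toReal_mono (ENNReal.add_lt_top.2 ⟨f.2.2, g.2.2⟩).ne
      (enormX_add_le f.2.1 g.2.1)
  norm_eq_zero_iff f := by
    constructor
    · intro h
      have h1 : enormX ε k f.1 = 0 := by
        rcases (ENNReal.toReal_eq_zero_iff _).1 h with h | h
        · exact h
        · exact absurd h f.2.2.ne
      have h2 : supL2 (Ioi ε) f.1 = 0 := by
        unfold enormX at h1
        simp only [add_eq_zero] at h1
        exact h1.1.1
      refine Subtype.ext (funext fun z => ?_)
      change f.1 z = 0
      by_cases hz : z ∈ exterior ε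
      · by_cases hz0 : z = 0
        · obtain ⟨a, ha⟩ := f.2.1.2.2
          have := ha z hz
          rw [hz0] at this ⊢
          refine this.unique ?_
          simp
        · exact eq_zero_of_supL2 (by simpa using spaceA_sliceDiff f.2.1 0) h2 z hz hz0
      · exact f.2.1.1 z hz
    · rintro rfl
      change (enormX ε k 0).toReal = 0
      simp [enormX_zero]

instance (ε : ℝ) (k : ℕ) : NormedAddCommGroup (X ε k) := NormedAddCommGroup.ofCore (normCore ε k)

instance (ε : ℝ) (k : ℕ) : NormedSpace ℝ (X ε k) := NormedSpace.ofCore (normCore ε k)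

end X

/-! ### The spaces `Â_ε` and `Y^m` -/

/-- The real vector space `Â_ε` of holomorphic functions `h` on the annulus `C_ε` of the form
`h(z) = i ∑_{n ≥ 1} h_n (z^n - z^{-n})` with real `h_n`. A function on `C_ε` is represented by its
extension by zero to `ℂ`. -/
def spaceAhat (ε : ℝ) : Submodule ℝ (ℂ → ℂ) where
  carrier := {h | (∀ z, z ∉ annulus ε → h z = 0) ∧ DifferentiableOn ℂ h (annulus ε) ∧
    ∃ a : ℕ → ℝ, ∀ z ∈ annulus ε,
      HasSum (fun n : ℕ => Complex.I * ((a n : ℂ) * (z ^ (n + 1) - (z ^ (n + 1))⁻¹))) (h z)}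
  zero_mem' := ⟨fun _ _ => rfl, differentiableOn_const 0, 0, fun z _ => by
    simp⟩
  add_mem' := by
    rintro h g ⟨h0, hd, a, ha⟩ ⟨g0, gd, b, hb⟩
    refine ⟨fun z hz => by simp [h0 z hz, g0 z hz], hd.add gd, a + b, fun z hz => ?_⟩
    simpa [add_mul, mul_add] using (ha z hz).add (hb z hz)
  smul_mem' := by
    rintro c h ⟨h0, hd, a, ha⟩
    refine ⟨fun z hz => by simp [h0 z hz], hd.const_smul c, c • a, fun z hz => ?_⟩
    simpa [mul_assoc, mul_left_comm] using (ha z hz).mul_left (c : ℂ)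

lemma ann_mem {ε ρ : ℝ} (hε : 0 < ε) (hρ : ρ ∈ Ioc ε 1) {ω : ℂ} (hω : ‖ω‖ = 1) :
    (ρ : ℂ) * ω ∈ annulus ε := by
  have hρ0 : 0 < ρ := hε.trans hρ.1
  simp only [annulus, mem_ofPred_eq, norm_mul, hω, mul_one, Complex.norm_real, Real.norm_eq_abs,
    abs_of_pos hρ0]
  exact ⟨hρ.1, hρ.2.trans_lt (one_lt_one_div hε (hρ.1.trans_le hρ.2))⟩

lemma spaceAhat_eq_zero {ε : ℝ} (hε : ε ≤ 0) {h : ℂ → ℂ} (hh : h ∈ spaceAhat ε) : h = 0 := by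
  funext z
  refine hh.1 z fun hz => ?_
  have h1 : 1 / ε ≤ 0 := one_div_nonpos.2 hε
  exact absurd (hz.2.trans_le h1) (not_lt.2 (norm_nonneg z))

lemma iteratedDeriv_zero_fun (n : ℕ) : iteratedDeriv n (0 : ℂ → ℂ) = fun _ => 0 := by
  simpa using iteratedDeriv_real_smul n 0 (0 : ℂ → ℂ)

lemma spaceAhat_sliceDiff {ε : ℝ} {h : ℂ → ℂ} (hh : h ∈ spaceAhat ε) (n : ℕ) :
    SliceDiff (Ioc ε 1) (iteratedDeriv n h) := by
  rcases le_or_gt ε 0 with hε | hε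
  · rw [spaceAhat_eq_zero hε hh, iteratedDeriv_zero_fun]
    intro ρ _ ω _
    exact differentiableAt_const _
  · exact sliceDiff_of_differentiableOn (isOpen_annulus ε)
      (differentiableOn_iteratedDeriv (isOpen_annulus ε) hh.2.1 n)
      fun _ hρ _ hω => ann_mem hε hρ hω

/-- The `Y^m` norm with values in `[0,∞]`, `‖h‖_{L²(ε𝕋)} + ‖∂^m h‖_{L²(ε𝕋)}`.
As `h` is only given on `C_ε`, the two quantities on the circle `ε𝕋` are the limits of the
same quantities on the circles `ρ𝕋` as `ρ` decreases to `ε`. For `h ∈ Â_ε` the latter are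
nonincreasing functions of `ρ ∈ (ε, 1]`, so the limit is the supremum over `ρ ∈ (ε, 1]`. -/
def enormY (ε : ℝ) (m : ℕ) (h : ℂ → ℂ) : ℝ≥0∞ :=
  supL2 (Ioc ε 1) h + supL2 (Ioc ε 1) (iteratedDeriv m h)

lemma enormY_zero (ε : ℝ) (m : ℕ) : enormY ε m 0 = 0 := by
  have e0 : supL2 (Ioc ε 1) (0 : ℂ → ℂ) = 0 := supL2_zero _
  simp [enormY, iteratedDeriv_zero_fun, e0, supL2_zero]

lemma enormY_smul (ε : ℝ) (m : ℕ) (c : ℝ) (h : ℂ → ℂ) :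
    enormY ε m (c • h) = ‖c‖ₑ * enormY ε m h := by
  have e : c • h = fun z => (c : ℂ) * h z := by
    funext z
    simp
  unfold enormY
  rw [iteratedDeriv_real_smul, supL2_smul, e, supL2_smul]
  ring

lemma enormY_add_le {ε : ℝ} {m : ℕ} {h g : ℂ → ℂ} (hh : h ∈ spaceAhat ε)
    (hg : g ∈ spaceAhat ε) : enormY ε m (h + g) ≤ enormY ε m h + enormY ε m g := by
  rcases le_or_gt ε 0 with hε | hε
  · rw [spaceAhat_eq_zero hε hh, spaceAhat_eq_zero hε hg]
    simp [enormY_zero]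
  have e : ∀ ρ ∈ Ioc ε 1, ∀ ω : ℂ, ‖ω‖ = 1 → iteratedDeriv m (h + g) ((ρ : ℂ) * ω) =
      (fun z => iteratedDeriv m h z + iteratedDeriv m g z) ((ρ : ℂ) * ω) := fun ρ hρ ω hω =>
    iteratedDeriv_add_of_mem (isOpen_annulus ε) hh.2.1 hg.2.1 m (ann_mem hε hρ hω)
  have h0 : supL2 (Ioc ε 1) (h + g) ≤ supL2 (Ioc ε 1) h + supL2 (Ioc ε 1) g :=
    supL2_add_le (by simpa using spaceAhat_sliceDiff hh 0)
      (by simpa using spaceAhat_sliceDiff hg 0)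
  have h1 := supL2_add_le (spaceAhat_sliceDiff hh m) (spaceAhat_sliceDiff hg m)
  unfold enormY
  rw [supL2_congr (u := iteratedDeriv m (h + g))
    (v := fun z => iteratedDeriv m h z + iteratedDeriv m g z) e]
  refine (add_le_add h0 h1).trans (le_of_eq ?_)
  ring

/-- The functions of `Â_ε` whose `Y^m` norm is finite. -/
def subY (ε : ℝ) (m : ℕ) : Submodule ℝ (ℂ → ℂ) where
  carrier := {h | h ∈ spaceAhat ε ∧ enormY ε m h < ∞}
  zero_mem' := ⟨zero_mem _, by simp [enormY_zero]⟩
  add_mem' := fun hh hg => ⟨add_mem hh.1 hg.1,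
    (enormY_add_le hh.1 hg.1).trans_lt (ENNReal.add_lt_top.2 ⟨hh.2, hg.2⟩)⟩
  smul_mem' := fun c _ hh => ⟨Submodule.smul_mem _ c hh.1, by
    rw [enormY_smul]
    exact ENNReal.mul_lt_top enorm_lt_top hh.2⟩

/-- The space `Y^m` (which depends on `ε`). -/
def Y (ε : ℝ) (m : ℕ) : Type := subY ε m

namespace Y

instance (ε : ℝ) (m : ℕ) : AddCommGroup (Y ε m) := inferInstanceAs (AddCommGroup (subY ε m))

instance (ε : ℝ) (m : ℕ) : Module ℝ (Y ε m) := inferInstanceAs (Module ℝ (subY ε m))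

instance (ε : ℝ) (m : ℕ) : CoeFun (Y ε m) (fun _ => ℂ → ℂ) := ⟨fun f => f.1⟩

instance (ε : ℝ) (m : ℕ) : Norm (Y ε m) := ⟨fun f => (enormY ε m f).toReal⟩

lemma normCore (ε : ℝ) (m : ℕ) : NormedSpace.Core ℝ (Y ε m) where
  norm_nonneg f := ENNReal.toReal_nonneg
  norm_smul c f := by
    change (enormY ε m (c • f.1)).toReal = ‖c‖ * (enormY ε m f.1).toReal
    rw [enormY_smul, ENNReal.toReal_mul, toReal_enorm]
  norm_triangle f g := by
    change (enormY ε m (f.1 + g.1)).toReal ≤ (enormY ε m f.1).toReal + (enormY ε m g.1).toReal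
    rw [← ENNReal.toReal_add f.2.2.ne g.2.2.ne]
    exact ENNReal.toReal_mono (ENNReal.add_lt_top.2 ⟨f.2.2, g.2.2⟩).ne
      (enormY_add_le f.2.1 g.2.1)
  norm_eq_zero_iff f := by
    constructor
    · intro h
      have h1 : enormY ε m f.1 = 0 := by
        rcases (ENNReal.toReal_eq_zero_iff _).1 h with h | h
        · exact h
        · exact absurd h f.2.2.ne
      have h2 : supL2 (Ioc ε 1) f.1 = 0 := by
        unfold enormY at h1
        simp only [add_eq_zero] at h1
        exact h1.1
      refine Subtype.ext (funext fun z => ?_)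
      change f.1 z = 0
      rcases le_or_gt ε 0 with hε | hε
      · rw [spaceAhat_eq_zero hε f.2.1]
        rfl
      have key : ∀ w ∈ annulus ε, ‖w‖ ≤ 1 → f.1 w = 0 := fun w hw hw1 =>
        eq_zero_of_supL2 (by simpa using spaceAhat_sliceDiff f.2.1 0) h2 w ⟨hw.1, hw1⟩
          (norm_pos_iff.1 (hε.trans hw.1))
      by_cases hz : z ∈ annulus ε
      · rcases le_total ‖z‖ 1 with h1 | h1
        · exact key z hz h1
        · have hz0 : 0 < ‖z‖ := one_pos.trans_le h1
          have hi : z⁻¹ ∈ annulus ε := by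
            refine ⟨?_, ?_⟩
            · rw [norm_inv, lt_inv_comm₀ hε hz0, ← one_div]
              exact hz.2
            · rw [norm_inv, one_div]
              exact (inv_lt_inv₀ hz0 hε).2 hz.1
          have h3 := key _ hi (by rw [norm_inv]; exact inv_le_one_of_one_le₀ h1)
          obtain ⟨a, ha⟩ := f.2.1.2.2
          have h4 := (ha _ hi).neg
          rw [h3, neg_zero] at h4
          refine (ha z hz).unique (h4.congr_fun ?_)
          intro n
          rw [inv_pow, inv_inv]
          ring
      · exact f.2.1.1 z hz
    · rintro rfl
      change (enormY ε m 0).toReal = 0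
      simp [enormY_zero]

instance (ε : ℝ) (m : ℕ) : NormedAddCommGroup (Y ε m) := NormedAddCommGroup.ofCore (normCore ε m)

instance (ε : ℝ) (m : ℕ) : NormedSpace ℝ (Y ε m) := NormedSpace.ofCore (normCore ε m)

end Y

/-! ### The nonlinear functionals -/

/-- `Φ_j(z) = b^{j-1} z + f_j(z)`, where `j = 1, 2` corresponds to the index `0, 1` of `Fin 2`
and `f = (f_1, f_2)`. -/
def Phi (b : ℝ) (f : Fin 2 → ℂ → ℂ) (j : Fin 2) (z : ℂ) : ℂ :=
  (b : ℂ) ^ (j : ℕ) * z + f j z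

/-- The integrand `(τ P'(τ) - ω Q'(ω)) / |P(τ) - Q(ω)| · 1/τ` of `S(P, Q)(ω)`. -/
def SIntegrand (P Q : ℂ → ℂ) (ω τ : ℂ) : ℂ :=
  (τ * deriv P τ - ω * deriv Q ω) / (‖P τ - Q ω‖ : ℂ) / τ

/-- `S(P, Q)(ω) = (1/2πi) ∫_𝕋 (τ P'(τ) - ω Q'(ω)) / |P(τ) - Q(ω)| dτ/τ`. -/
def S (P Q : ℂ → ℂ) (ω : ℂ) : ℂ :=
  (2 * π * Complex.I)⁻¹ * ∮ τ in C(0, 1), SIntegrand P Q ω τ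

/-- `G_j(Ω, f_1, f_2)(ω) =
Im {(Ω Φ_j(ω) - S(Φ_1, Φ_j)(ω) + S(Φ_2, Φ_j)(ω)) conj(Φ_j'(ω)) conj(ω)}`. -/
def G (b : ℝ) (j : Fin 2) (Ω : ℝ) (f : Fin 2 → ℂ → ℂ) (ω : ℂ) : ℝ :=
  ((Ω * Phi b f j ω - S (Phi b f 0) (Phi b f j) ω + S (Phi b f 1) (Phi b f j) ω) *
    (starRingEnd ℂ) (deriv (Phi b f j) ω) * (starRingEnd ℂ) ω).im

end VStates

end

/-!
In terms of Laurent coefficients, `G_j` is an analytic map near `f_1 = f_2 = 0`; only the final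
passage to coefficients is real linear instead of complex linear.

**Coefficients.** By Parseval's identity on the circles of radius `ρ`, as `ρ` decreases to `ε`, the
norm of `X` controls the `ℓ²` norm of the coefficients of `f` with the weights
`n^k ε^{-n} (1 + |λ_{-n}|)`, where `λ` is the Fourier multiplier of the singular integral
(`sum_coefX_le`, `toLL`). The values of the functional are computed in the space `HH` of Laurent
series with weights `ε^{-|n|} (1 + |n|)^{k-1}`. It is an algebra (`mulH`), contained in the algebra
`WW` with `ℓ¹` norm: a product of two series is split into the parts in which one or the other index
is the larger one, and that factor is measured in `HH`, the other one in `WW`. On the unit circle,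
the imaginary part of an element of `HH` extends to an element of `Y` if it is odd under
conjugation (`toY`), and so are the values of `G_j`, since all coefficients are real.

**The singular integral on the diagonal.** Put `σ = e^{iθ}` and substitute `τ = ω σ`. Then
`Φ(ωσ) - Φ(ω) = b ω (σ - 1) (1 + q)`, where `q` is a difference quotient of `f`, which is small, and
`|1 + q|⁻¹ = (1 + q)^{-1/2} (1 + q̄)^{-1/2}`. As the coefficients are real, `q̄` is again a Laurent
series in `ω` on the unit circle. It remains to apply the two operators `(1 + T)^{-1/2}`, with `T`
the multiplication by `q` or `q̄`, to the numerator, which vanishes at `σ = 1`, and to integrate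
against `1 / |σ - 1|`. Division of the numerator by `σ - 1` costs a derivative and leads out of `HH`.
Therefore a family `n₀(θ)` of series in `HH` is taken together with `n₁ = n₀ / (σ - 1)` in `WW` and
with the integral `n₂` of `n₀ / |σ - 1|`, which is required to lie in `HH` (`Triple`, `consistent`).
For the increments of `z f'` this holds by the logarithmic term of the norm of `X`. Multiplication
by `q` acts on such triples (`tripleMul`, `tripleMul_mem`): with `q = q(0) + (σ - 1) q₁`, the
constant `q(0)` commutes with the integral, and the remaining integrand `q₁ n₀ = (σ - 1) q₁ n₁` is a
sum of two partial products, in each of which the factor of larger index lies in `HH`.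
The operators `(1 + T)^{-1/2}` are analytic in `T` by the binomial series, they preserve the closed
invariant subspace of consistent triples (`invSqrt_mem`), and evaluations turn them into
multiplications (`map_invSqrt`). This gives `exists_contDiffOn_diagonal`.

**Off the diagonal** the denominator `b_i σ - b_j` of the difference quotient is bounded from below,
and the same argument works in `HH` itself (`exists_contDiffOn_offDiagonal`).

The non-vanishing of `Φ_i(τ) - Φ_j(ω)` and the absolute convergence of the integrals are read off
from the same factorizations.
-/

noncomputable section

open scoped BoundedContinuousFunction

namespace VStates

/-! ### Operators on sequence spaces -/

section SequenceSpaces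

variable {α β : Type*} {F G H : Type*} [NormedAddCommGroup F] [NormedSpace ℂ F]
  [NormedAddCommGroup G] [NormedSpace ℂ G] [NormedAddCommGroup H] [NormedSpace ℂ H]

/-- The space `ℓ^p` of complex sequences indexed by `α`. -/
abbrev seq (α : Type*) (p : ℝ≥0∞) : Type _ := lp (fun _ : α => ℂ) p

lemma hasSum_extend {e : α → β} (he : Function.Injective e) {f : α → ℝ} {s : ℝ}
    (h : HasSum f s) (g : β → ℝ) (hg : ∀ x, g (e x) = f x) (hg' : ∀ y, y ∉ range e → g y = 0) :
    HasSum g s := by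
  refine (he.hasSum_iff hg').1 ?_
  convert h using 1
  funext x
  exact hg x

/-- Relabelling the indices of a sequence along an injective map, with the value `0` outside of
its range. -/
def reindex (p : ℝ≥0∞) [Fact (1 ≤ p)] (hp : p ≠ ∞) {e : α → β} (he : Function.Injective e) :
    seq α p →L[ℂ] seq β p :=
  have hp0 : 0 < p.toReal :=
    ENNReal.toReal_pos (zero_lt_one.trans_le Fact.out).ne' hp
  have key (a : seq α p) : HasSum (fun l => ‖Function.extend e a 0 l‖ ^ p.toReal)
      (‖a‖ ^ p.toReal) := by
    refine hasSum_extend he (lp.hasSum_norm hp0 a) _ (fun x => ?_) (fun y hy => ?_)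
    · rw [he.extend_apply]
    · rw [Function.extend_apply' _ _ _ (by simpa using hy)]
      simp [Real.zero_rpow hp0.ne']
  LinearMap.mkContinuous
    { toFun a := ⟨Function.extend e a 0, memℓp_gen (key a).summable⟩
      map_add' a b := by
        ext l
        change Function.extend e (⇑a + ⇑b) 0 l =
          Function.extend e (⇑a) 0 l + Function.extend e (⇑b) 0 l
        by_cases h : ∃ x, e x = l
        · obtain ⟨x, rfl⟩ := h
          simp only [he.extend_apply]
          rfl
        · simp [Function.extend_apply' _ _ _ h]
      map_smul' c b := by
        ext l
        by_cases h : ∃ x, e x = l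
        · obtain ⟨x, rfl⟩ := h
          simp [he.extend_apply]
        · simp [Function.extend_apply' _ _ _ h] }
    1 fun a => by
      rw [one_mul]
      refine lp.norm_le_of_tsum_le hp0 (norm_nonneg _) (key a).tsum_eq.le

variable {p : ℝ≥0∞} [Fact (1 ≤ p)]

lemma norm_reindex_le (hp : p ≠ ∞) {e : α → β} (he : Function.Injective e) :
    ‖reindex p hp he‖ ≤ 1 := by
  unfold reindex
  exact LinearMap.mkContinuous_norm_le _ zero_le_one _

lemma reindex_apply (hp : p ≠ ∞) {e : α → β} (he : Function.Injective e) (a : seq α p) (x : α) :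
    reindex p hp he a (e x) = a x := he.extend_apply _ _ _

lemma reindex_apply_of_notMem (hp : p ≠ ∞) {e : α → β} (he : Function.Injective e)
    (a : seq α p) {y : β} (hy : ¬ ∃ x, e x = y) : reindex p hp he a y = 0 :=
  Function.extend_apply' _ _ _ hy

lemma reindex_single [DecidableEq α] [DecidableEq β] (hp : p ≠ ∞) {e : α → β}
    (he : Function.Injective e) (x : α) (c : ℂ) :
    reindex p hp he (lp.single p x c) = lp.single p (e x) c := by
  ext y
  by_cases h : ∃ x, e x = y
  · obtain ⟨z, rfl⟩ := h
    rw [reindex_apply]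
    by_cases hz : z = x
    · subst hz
      simp
    · rw [lp.single_apply_ne _ _ _ hz, lp.single_apply_ne _ _ _ (fun h => hz (he h))]
  · rw [reindex_apply_of_notMem hp he _ h, lp.single_apply_ne]
    exact fun hy => h ⟨x, hy.symm⟩

/-- Multiplication of a sequence by a bounded sequence. -/
def diag (p : ℝ≥0∞) [Fact (1 ≤ p)] (K : α → ℂ) {C : ℝ} (hC : 0 ≤ C) (hK : ∀ x, ‖K x‖ ≤ C) :
    seq α p →L[ℂ] seq α p :=
  lp.mapCLM p (fun x => (ContinuousLinearMap.toSpanSingleton ℂ (K x))) hC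
    (fun x => by simpa using hK x)

lemma norm_diag_le (K : α → ℂ) {C : ℝ} (hC : 0 ≤ C) (hK : ∀ x, ‖K x‖ ≤ C) :
    ‖diag p K hC hK‖ ≤ C := lp.norm_mapCLM_le _ _ _ _

lemma diag_apply (K : α → ℂ) {C : ℝ} (hC : 0 ≤ C) (hK : ∀ x, ‖K x‖ ≤ C) (a : seq α p) (x : α) :
    diag p K hC hK a x = K x * a x := by
  simp [diag, mul_comm]

lemma diag_single [DecidableEq α] (K : α → ℂ) {C : ℝ} (hC : 0 ≤ C) (hK : ∀ x, ‖K x‖ ≤ C) (x : α)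
    (c : ℂ) : diag p K hC hK (lp.single p x c) = lp.single p x (K x * c) := by
  ext y
  rw [diag_apply]
  by_cases h : y = x
  · subst h
    simp
  · rw [lp.single_apply_ne _ _ _ h, lp.single_apply_ne _ _ _ h, mul_zero]

lemma seq_ext_single [DecidableEq α] (hp : p ≠ ∞) {f g : seq α p →L[ℂ] F}
    (h : ∀ x, f (lp.single p x 1) = g (lp.single p x 1)) : f = g := by
  refine lp.ext_continuousLinearMap hp fun x => ?_
  ext
  simpa using h x

/-- The universal property of `ℓ¹`: the operator `b ↦ ∑ b_x v_x` given by a bounded family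
of vectors `v_x`. -/
def lift1 [CompleteSpace F] (v : α → F) {C : ℝ} (hC : 0 ≤ C) (hv : ∀ x, ‖v x‖ ≤ C) :
    seq α 1 →L[ℂ] F :=
  (lp.tsumCLM ℂ α F).comp (lp.mapCLM 1 (fun x => ContinuousLinearMap.toSpanSingleton ℂ (v x)) hC
    (fun x => by simpa using hv x))

lemma lift1_apply [CompleteSpace F] (v : α → F) {C : ℝ} (hC : 0 ≤ C) (hv : ∀ x, ‖v x‖ ≤ C)
    (b : seq α 1) : lift1 v hC hv b = ∑' x, b x • v x := by
  simp [lift1]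

lemma lift1_single [CompleteSpace F] [DecidableEq α] (v : α → F) {C : ℝ} (hC : 0 ≤ C)
    (hv : ∀ x, ‖v x‖ ≤ C) (x : α) (c : ℂ) :
    lift1 v hC hv (lp.single 1 x c) = c • v x := by
  rw [lift1_apply, tsum_eq_single x]
  · simp
  · intro y hy
    rw [lp.single_apply_ne _ _ _ hy, zero_smul]

lemma seq_one_summable (b : seq α 1) : Summable fun x => ‖b x‖ := by
  simpa using (lp.memℓp b).summable (by simp)

/-- Multiplication by a square summable sequence, from `ℓ²` to `ℓ¹`. -/
def mul21 (u : seq α 2) : seq α 2 →L[ℂ] seq α 1 :=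
  lp.holderL 1 (fun _ => ContinuousLinearMap.mul ℂ ℂ) (K := 1) (fun _ => by simp) u

lemma mul21_apply (u a : seq α 2) (x : α) : mul21 u a x = u x * a x := rfl

lemma mul21_single [DecidableEq α] (u : seq α 2) (x : α) (c : ℂ) :
    mul21 u (lp.single 2 x c) = lp.single 1 x (u x * c) := by
  ext y
  rw [mul21_apply]
  by_cases h : y = x
  · subst h
    simp
  · rw [lp.single_apply_ne _ _ _ h, lp.single_apply_ne _ _ _ h, mul_zero]

/-! ### Weighted convolutions -/

/-- The weighted convolution `(b, a) ↦ (∑_{n + m = l} K(n, m) a_n b_m)_l` with a bounded kernel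
`K`, as a bounded bilinear map `ℓ¹ × ℓ^p → ℓ^p`. -/
def conv (p : ℝ≥0∞) [Fact (1 ≤ p)] (hp : p ≠ ∞) (K : ℤ → ℤ → ℂ) {C : ℝ} (hC : 0 ≤ C)
    (hK : ∀ n m, ‖K n m‖ ≤ C) : seq ℤ 1 →L[ℂ] seq ℤ p →L[ℂ] seq ℤ p :=
  lift1 (fun m => (reindex p hp (add_left_injective m)).comp
    (diag p (fun n => K n m) hC (fun n => hK n m))) hC fun m =>
      (ContinuousLinearMap.opNorm_comp_le _ _).trans <| by
        have h1 := norm_reindex_le (p := p) hp (add_left_injective m)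
        have h2 := norm_diag_le (p := p) (fun n => K n m) hC (fun n => hK n m)
        nlinarith [norm_nonneg (diag p (fun n => K n m) hC (fun n => hK n m))]

lemma conv_single (hp : p ≠ ∞) (K : ℤ → ℤ → ℂ) {C : ℝ} (hC : 0 ≤ C)
    (hK : ∀ n m, ‖K n m‖ ≤ C) (n m : ℤ) (a b : ℂ) :
    conv p hp K hC hK (lp.single 1 m b) (lp.single p n a) =
      lp.single p (n + m) (b * (K n m * a)) := by
  rw [conv, lift1_single]
  simp only [smul_apply, ContinuousLinearMap.comp_apply]
  rw [diag_single, reindex_single, ← lp.single_smul, smul_eq_mul]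

/-! ### Spaces of bounded continuous functions of the angle -/

lemma continuous_diag (hp : p ≠ ∞) (K : α → ℝ →ᵇ ℂ) {C : ℝ} (hC : 0 ≤ C)
    (hK : ∀ x, ‖K x‖ ≤ C) (a : seq α p) :
    Continuous fun θ => diag p (fun x => K x θ) hC
      (fun x => ((K x).norm_coe_le_norm θ).trans (hK x)) a := by
  classical
  have h1 := lp.hasSum_single hp a
  rw [HasSum, SummationFilter.unconditional_filter] at h1
  have h2 : TendstoUniformly (fun (s : Finset α) θ => diag p (fun x => K x θ) hC
      (fun x => ((K x).norm_coe_le_norm θ).trans (hK x)) (∑ x ∈ s, lp.single p x (a x)))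
      (fun θ => diag p (fun x => K x θ) hC
        (fun x => ((K x).norm_coe_le_norm θ).trans (hK x)) a) Filter.atTop := by
    rw [Metric.tendstoUniformly_iff]
    intro δ hδ
    have h3 := (Metric.tendsto_nhds.1 h1) (δ / (C + 1)) (by positivity)
    filter_upwards [h3] with s hs θ
    rw [dist_eq_norm, ← map_sub]
    rw [dist_comm, dist_eq_norm] at hs
    refine (ContinuousLinearMap.le_of_opNorm_le _ (norm_diag_le _ _ _) _).trans_lt ?_
    rw [lt_div_iff₀ (by positivity)] at hs
    nlinarith [norm_nonneg (a - ∑ x ∈ s, lp.single p x (a x))]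
  refine h2.continuous (Filter.Eventually.frequently (Filter.Eventually.of_forall fun s => ?_))
  simp only [map_sum, diag_single]
  refine continuous_finsetSum _ fun x _ => ?_
  exact (lp.singleContinuousLinearMap ℂ (fun _ : α => ℂ) p x).continuous.comp
    ((K x).continuous.mul continuous_const)

/-- Multiplication of a sequence by a bounded family of functions of the angle. -/
def diagC (p : ℝ≥0∞) [Fact (1 ≤ p)] (hp : p ≠ ∞) (K : α → ℝ →ᵇ ℂ) {C : ℝ} (hC : 0 ≤ C)
    (hK : ∀ x, ‖K x‖ ≤ C) : seq α p →L[ℂ] (ℝ →ᵇ seq α p) :=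
  LinearMap.mkContinuous
    { toFun a := BoundedContinuousFunction.ofNormedAddCommGroup
        (fun θ => diag p (fun x => K x θ) hC
          (fun x => ((K x).norm_coe_le_norm θ).trans (hK x)) a)
        (continuous_diag hp K hC hK a) (C * ‖a‖)
        (fun θ => ContinuousLinearMap.le_of_opNorm_le _ (norm_diag_le _ _ _) _)
      map_add' a b := by ext θ : 1; simp
      map_smul' c b := by ext θ : 1; simp }
    C fun a => BoundedContinuousFunction.norm_ofNormedAddCommGroup_le _ (by positivity)
      fun _ => ContinuousLinearMap.le_of_opNorm_le _ (norm_diag_le _ _ _) _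

/-- The pointwise application of a bounded bilinear map to bounded continuous functions. -/
def pointwise (B : F →L[ℂ] G →L[ℂ] H) : (ℝ →ᵇ F) →L[ℂ] (ℝ →ᵇ G) →L[ℂ] (ℝ →ᵇ H) :=
  have key (f : ℝ →ᵇ F) (g : ℝ →ᵇ G) (θ : ℝ) : ‖B (f θ) (g θ)‖ ≤ ‖B‖ * ‖f‖ * ‖g‖ :=
    (B.le_opNorm₂ _ _).trans (by
      gcongr
      · exact f.norm_coe_le_norm θ
      · exact g.norm_coe_le_norm θ)
  LinearMap.mkContinuous₂
    (LinearMap.mk₂ ℂ (fun f g => BoundedContinuousFunction.ofNormedAddCommGroup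
      (fun θ => B (f θ) (g θ)) ((B.continuous.comp f.continuous).clm_apply g.continuous) _
        (key f g))
      (fun _ _ _ => by ext θ : 1; simp) (fun _ _ _ => by ext θ : 1; simp)
      (fun _ _ _ => by ext θ : 1; simp) (fun _ _ _ => by ext θ : 1; simp))
    ‖B‖ fun f g => BoundedContinuousFunction.norm_ofNormedAddCommGroup_le _ (by positivity)
      (key f g)

lemma pointwise_apply (B : F →L[ℂ] G →L[ℂ] H) (f : ℝ →ᵇ F) (g : ℝ →ᵇ G) (θ : ℝ) :
    pointwise B f g θ = B (f θ) (g θ) := rfl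

lemma integrable_smul_bcf {κ : ℝ → ℂ} (hκ : Measurable κ) {C : ℝ} (hC : ∀ θ, ‖κ θ‖ ≤ C)
    (f : ℝ →ᵇ F) : IntervalIntegrable (fun θ => κ θ • f θ) volume 0 (2 * π) := by
  have h1 : IntervalIntegrable (fun θ => f θ) volume 0 (2 * π) :=
    f.continuous.intervalIntegrable _ _
  rw [intervalIntegrable_iff] at h1 ⊢
  exact h1.bdd_smul C hκ.aestronglyMeasurable (Filter.Eventually.of_forall hC)

/-- The integral `f ↦ ∫_0^{2π} κ(θ) f(θ) dθ` against a bounded measurable weight `κ`. -/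
def integralC (κ : ℝ → ℂ) (hκ : Measurable κ) {C : ℝ} (hC : ∀ θ, ‖κ θ‖ ≤ C) :
    (ℝ →ᵇ F) →L[ℂ] F :=
  LinearMap.mkContinuous
    { toFun f := ∫ θ in (0 : ℝ)..(2 * π), κ θ • f θ
      map_add' f g := by
        simp only [BoundedContinuousFunction.coe_add, Pi.add_apply, smul_add]
        exact intervalIntegral.integral_add (integrable_smul_bcf hκ hC f)
          (integrable_smul_bcf hκ hC g)
      map_smul' c f := by
        simp only [BoundedContinuousFunction.coe_smul, RingHom.id_apply, smul_comm _ c]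
        exact intervalIntegral.integral_smul _ _ }
    (C * (2 * π)) fun f => by
      have h := intervalIntegral.norm_integral_le_of_norm_le_const (a := 0) (b := 2 * π)
        (f := fun θ => κ θ • f θ) (C := C * ‖f‖) (fun θ _ => by
          rw [norm_smul]
          have := (norm_nonneg _).trans (hC θ)
          gcongr
          · exact hC θ
          · exact f.norm_coe_le_norm θ)
      rw [sub_zero, abs_of_pos Real.two_pi_pos] at h
      refine h.trans (le_of_eq ?_)
      ring

lemma integralC_apply (κ : ℝ → ℂ) (hκ : Measurable κ) {C : ℝ} (hC : ∀ θ, ‖κ θ‖ ≤ C)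
    (f : ℝ →ᵇ F) : integralC κ hκ hC f = ∫ θ in (0 : ℝ)..(2 * π), κ θ • f θ := rfl

lemma map_integralC [CompleteSpace F] [CompleteSpace G] (T : F →L[ℂ] G) (κ : ℝ → ℂ)
    (hκ : Measurable κ) {C : ℝ}
    (hC : ∀ θ, ‖κ θ‖ ≤ C) (f : ℝ →ᵇ F) :
    T (integralC κ hκ hC f) = ∫ θ in (0 : ℝ)..(2 * π), κ θ • T (f θ) := by
  rw [integralC_apply, ← T.intervalIntegral_comp_comm (integrable_smul_bcf hκ hC f)]
  simp

end SequenceSpaces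

/-! ### Two algebras of Laurent series -/

/-- The weight `ε^{-|n|}`. -/
def wW (ε : ℝ) (n : ℤ) : ℝ := ε⁻¹ ^ n.natAbs

/-- The weight `ε^{-|n|} (1 + |n|)^s`. -/
def wH (ε : ℝ) (s : ℕ) (n : ℤ) : ℝ := ε⁻¹ ^ n.natAbs * (1 + (n.natAbs : ℝ)) ^ s

lemma wW_pos {ε : ℝ} (hε : ε ∈ Ioo (0 : ℝ) 1) (n : ℤ) : 0 < wW ε n := by
  have := inv_pos.2 hε.1
  unfold wW
  positivity

lemma wH_pos {ε : ℝ} (hε : ε ∈ Ioo (0 : ℝ) 1) (s : ℕ) (n : ℤ) : 0 < wH ε s n := by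
  have := inv_pos.2 hε.1
  unfold wH
  positivity

lemma one_le_inv_of_mem {ε : ℝ} (hε : ε ∈ Ioo (0 : ℝ) 1) : 1 ≤ ε⁻¹ :=
  (one_le_inv₀ hε.1).2 hε.2.le

lemma one_le_wW {ε : ℝ} (hε : ε ∈ Ioo (0 : ℝ) 1) (n : ℤ) : 1 ≤ wW ε n :=
  one_le_pow₀ (one_le_inv_of_mem hε)

lemma wW_add_le {ε : ℝ} (hε : ε ∈ Ioo (0 : ℝ) 1) (n m : ℤ) :
    wW ε (n + m) ≤ wW ε n * wW ε m := by
  unfold wW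
  rw [← pow_add]
  exact pow_le_pow_right₀ (one_le_inv_of_mem hε) (Int.natAbs_add_le n m)

/-- The weight of `HH` is submultiplicative, up to a constant, if the factor of higher index carries
the power `(1 + |n|)^s`. -/
lemma wH_add_le {ε : ℝ} (hε : ε ∈ Ioo (0 : ℝ) 1) (s : ℕ) {n m : ℤ} (h : m.natAbs ≤ n.natAbs) :
    wH ε s (n + m) ≤ 2 ^ s * (wH ε s n * wW ε m) := by
  have h1 := wW_add_le hε n m
  have h2 : (1 + ((n + m).natAbs : ℝ)) ^ s ≤ 2 ^ s * (1 + (n.natAbs : ℝ)) ^ s := by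
    rw [← mul_pow]
    refine pow_le_pow_left₀ (by positivity) ?_ s
    have : (n + m).natAbs ≤ 2 * n.natAbs := by omega
    have : ((n + m).natAbs : ℝ) ≤ 2 * n.natAbs := by exact_mod_cast this
    linarith
  have h3 := wW_pos hε n
  have h4 := wW_pos hε m
  calc wH ε s (n + m) = wW ε (n + m) * (1 + ((n + m).natAbs : ℝ)) ^ s := rfl
    _ ≤ (wW ε n * wW ε m) * (2 ^ s * (1 + (n.natAbs : ℝ)) ^ s) := by gcongr
    _ = 2 ^ s * (wH ε s n * wW ε m) := by
      unfold wH wW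
      ring

/-- The ratio of weights by which the partial product of an element of `ℓ²`, of index `n`, with an
element of `ℓ¹`, of index `m`, is multiplied; only the indices with `R n m` are taken into
account. -/
def kerH (ε : ℝ) (s : ℕ) (R : ℤ → ℤ → Prop) [∀ n m, Decidable (R n m)] (n m : ℤ) : ℂ :=
  if R n m then ((wH ε s (n + m) / (wH ε s n * wW ε m) : ℝ) : ℂ) else 0

/-- The analogue of `kerH` for two elements of `ℓ¹`. -/
def kerW (ε : ℝ) (R : ℤ → ℤ → Prop) [∀ n m, Decidable (R n m)] (n m : ℤ) : ℂ :=
  if R n m then ((wW ε (n + m) / (wW ε n * wW ε m) : ℝ) : ℂ) else 0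

lemma norm_kerH_le {ε : ℝ} (hε : ε ∈ Ioo (0 : ℝ) 1) (s : ℕ) (R : ℤ → ℤ → Prop)
    [∀ n m, Decidable (R n m)] (hR : ∀ n m, R n m → m.natAbs ≤ n.natAbs) (n m : ℤ) :
    ‖kerH ε s R n m‖ ≤ 2 ^ s := by
  have h1 := wH_pos hε s n
  have h2 := wW_pos hε m
  have h3 := wH_pos hε s (n + m)
  unfold kerH
  split_ifs with h
  · rw [Complex.norm_real, Real.norm_of_nonneg (by positivity), div_le_iff₀ (by positivity)]
    exact wH_add_le hε s (hR n m h)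
  · simp

lemma norm_kerW_le {ε : ℝ} (hε : ε ∈ Ioo (0 : ℝ) 1) (R : ℤ → ℤ → Prop)
    [∀ n m, Decidable (R n m)] (n m : ℤ) : ‖kerW ε R n m‖ ≤ 1 := by
  have h1 := wW_pos hε n
  have h2 := wW_pos hε m
  have h3 := wW_pos hε (n + m)
  unfold kerW
  split_ifs with h
  · rw [Complex.norm_real, Real.norm_of_nonneg (by positivity), div_le_iff₀ (by positivity),
      one_mul]
    exact wW_add_le hε n m
  · simp

/-- The space of Laurent series `∑ c_n z^n` whose coefficients satisfy
`∑ |ε^{-|n|} (1 + |n|)^s c_n|² < ∞`. The series is encoded by the sequence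
`ε^{-|n|} (1 + |n|)^s c_n`. -/
abbrev HH : Type := seq ℤ 2

/-- The space of Laurent series `∑ c_n z^n` whose coefficients satisfy `∑ |ε^{-|n|} c_n| < ∞`.
The series is encoded by the sequence `ε^{-|n|} c_n`. -/
abbrev WW : Type := seq ℤ 1

/-- The part of the product of a series of `WW`, of index `m`, and of a series of `HH`, of index
`n`, in which `R n m`. It lies in `HH` if `R` forces `|m| ≤ |n|`. -/
def convH {ε : ℝ} (hε : ε ∈ Ioo (0 : ℝ) 1) (s : ℕ) (R : ℤ → ℤ → Prop) [∀ n m, Decidable (R n m)]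
    (hR : ∀ n m, R n m → m.natAbs ≤ n.natAbs) : WW →L[ℂ] HH →L[ℂ] HH :=
  conv 2 (by simp) (kerH ε s R) (by positivity) (norm_kerH_le hε s R hR)

/-- The part of the product of two series of `WW`, of indices `m` and `n`, in which `R n m`. -/
def convW {ε : ℝ} (hε : ε ∈ Ioo (0 : ℝ) 1) (R : ℤ → ℤ → Prop) [∀ n m, Decidable (R n m)] :
    WW →L[ℂ] WW →L[ℂ] WW :=
  conv 1 (by simp) (kerW ε R) zero_le_one (norm_kerW_le hε R)

lemma summable_inv_one_add_natAbs_sq :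
    Summable fun n : ℤ => ((1 + (n.natAbs : ℝ)) ^ 2)⁻¹ := by
  have h : Summable fun n : ℕ => ((1 + (n : ℝ)) ^ 2)⁻¹ := by
    have := (summable_nat_add_iff 1).2 (Real.summable_nat_pow_inv (p := 2).2 (by norm_num))
    refine this.congr fun n => ?_
    push_cast
    rw [add_comm]
  refine Summable.of_nat_of_neg ?_ ?_
  · simpa using h
  · simpa using h

/-- The sequence `(1 + |n|)^{-s}`, which is square summable if `s ≥ 1`. -/
def invWeight {s : ℕ} (hs : 1 ≤ s) : seq ℤ 2 :=
  ⟨fun n => ((((1 + (n.natAbs : ℝ)) ^ s)⁻¹ : ℝ) : ℂ), memℓp_gen (by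
    refine summable_inv_one_add_natAbs_sq.of_nonneg_of_le (fun n => by positivity) fun n => ?_
    have h1 : (1 : ℝ) ≤ 1 + (n.natAbs : ℝ) := by simp
    rw [Complex.norm_real, Real.norm_of_nonneg (by positivity), ENNReal.toReal_ofNat,
      Real.rpow_two, inv_pow, ← pow_mul]
    refine inv_anti₀ (by positivity) (pow_le_pow_right₀ h1 (by omega)))⟩

lemma invWeight_apply {s : ℕ} (hs : 1 ≤ s) (n : ℤ) :
    invWeight hs n = ((((1 + (n.natAbs : ℝ)) ^ s)⁻¹ : ℝ) : ℂ) := rfl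

/-- The embedding of `HH` into `WW`. -/
def iota {s : ℕ} (hs : 1 ≤ s) : HH →L[ℂ] WW := mul21 (invWeight hs)

lemma seq_ext_single₂ {α β : Type*} {F : Type*} [NormedAddCommGroup F] [NormedSpace ℂ F]
    {p q : ℝ≥0∞} [Fact (1 ≤ p)] [Fact (1 ≤ q)] [DecidableEq α] [DecidableEq β]
    (hp : p ≠ ∞) (hq : q ≠ ∞) {f g : seq α p →L[ℂ] seq β q →L[ℂ] F}
    (h : ∀ x y, f (lp.single p x 1) (lp.single q y 1) = g (lp.single p x 1) (lp.single q y 1)) :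
    f = g :=
  seq_ext_single hp fun x => seq_ext_single hq fun y => h x y

section Products

variable {ε : ℝ} (hε : ε ∈ Ioo (0 : ℝ) 1) {s : ℕ} (hs : 1 ≤ s)

lemma iota_convH (R : ℤ → ℤ → Prop) [∀ n m, Decidable (R n m)]
    (hR : ∀ n m, R n m → m.natAbs ≤ n.natAbs) (b : WW) (a : HH) :
    iota hs (convH hε s R hR b a) = convW hε R b (iota hs a) := by
  have key : (ContinuousLinearMap.compL ℂ HH HH WW (iota hs)).comp (convH hε s R hR) =
      (convW hε R).bilinearComp (ContinuousLinearMap.id ℂ WW) (iota hs) := by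
    refine seq_ext_single₂ (by simp) (by simp) fun m n => ?_
    simp only [ContinuousLinearMap.comp_apply, ContinuousLinearMap.compL_apply,
      ContinuousLinearMap.bilinearComp_apply, ContinuousLinearMap.id_apply, iota, mul21_single,
      convH, convW, conv_single, invWeight_apply, one_mul, mul_one, kerH, kerW]
    congr 1
    split_ifs with h
    · have h1 := (wH_pos hε s n).ne'
      have h2 := (wW_pos hε m).ne'
      have h3 := (wW_pos hε n).ne'
      rw [← Complex.ofReal_mul, ← Complex.ofReal_mul]
      congr 1
      change _ * (wW ε (n + m) * (1 + ((n + m).natAbs : ℝ)) ^ s /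
        (wW ε n * (1 + (n.natAbs : ℝ)) ^ s * wW ε m)) = _
      field_simp
    · simp
  exact congrArg (fun T => T b a) key

/-- The product of two series of `WW`. -/
def mulW : WW →L[ℂ] WW →L[ℂ] WW := (convW hε fun _ _ => True).flip

/-- The part `|m| ≤ |n|` of the product of a series of `WW`, of index `m`, and of a series of `HH`,
of index `n`. -/
def convGe (s : ℕ) : WW →L[ℂ] HH →L[ℂ] HH :=
  convH hε s (fun n m => m.natAbs ≤ n.natAbs) fun _ _ h => h

/-- The part `|m| < |n|` of the product of a series of `WW`, of index `m`, and of a series of `HH`,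
of index `n`. -/
def convGt (s : ℕ) : WW →L[ℂ] HH →L[ℂ] HH :=
  convH hε s (fun n m => m.natAbs < n.natAbs) fun _ _ h => h.le

/-- The product of two series of `HH`. -/
def mulH : HH →L[ℂ] HH →L[ℂ] HH :=
  ((convGe hε s).comp (iota hs)).flip + (convGt hε s).comp (iota hs)

lemma mulH_apply (a b : HH) :
    mulH hε hs a b = convGe hε s (iota hs b) a + convGt hε s (iota hs a) b := rfl

lemma convW_ge_add_gt (a b : WW) : convW hε (fun n m => m.natAbs ≤ n.natAbs) b a +
    convW hε (fun n m => m.natAbs < n.natAbs) a b = mulW hε a b := by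
  have key : (convW hε (fun n m => m.natAbs ≤ n.natAbs)).flip +
      convW hε (fun n m => m.natAbs < n.natAbs) = mulW hε := by
    refine seq_ext_single₂ (by simp) (by simp) fun n m => ?_
    simp only [add_apply, ContinuousLinearMap.flip_apply, mulW, convW, conv_single, kerW, if_true,
      one_mul, mul_one, add_comm m n, mul_comm (wW ε m)]
    rw [← lp.single_add]
    congr 1
    split_ifs <;> first | omega | simp
  exact congrArg (fun T => T a b) key

lemma iota_mulH (a b : HH) : iota hs (mulH hε hs a b) = mulW hε (iota hs a) (iota hs b) := by
  rw [mulH_apply, map_add, convGe, convGt, iota_convH, iota_convH, convW_ge_add_gt]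

/-- If `n₀ = c n₁` and `q₀ = c q₁` in `WW`, the product `q₁ n₀ = q₀ n₁` lies in `HH`: it is a sum of
two partial products, each with the factor of higher index in `HH`. -/
lemma iota_convGe_add_convGt {n₀ q₀ : HH} {n₁ q₁ : WW} {c : ℂ} (hn : iota hs n₀ = c • n₁)
    (hq : iota hs q₀ = c • q₁) :
    iota hs (convGe hε s q₁ n₀ + convGt hε s n₁ q₀) = mulW hε (iota hs q₀) n₁ := by
  have hc : mulW hε q₁ n₁ = mulW hε n₁ q₁ := by
    have key : (mulW hε).flip = mulW hε := by
      refine seq_ext_single₂ (by simp) (by simp) fun n m => ?_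
      simp only [ContinuousLinearMap.flip_apply, mulW, convW, conv_single, kerW, if_true,
        one_mul, mul_one, add_comm m n, mul_comm (wW ε m)]
    exact congrArg (fun T => T n₁ q₁) key
  rw [map_add, convGe, convGt, iota_convH, iota_convH, hn, hq, map_smul, map_smul, ← smul_add,
    convW_ge_add_gt, map_smul, smul_apply, hc]

/-- The evaluation of a series of `WW` at a point of the unit circle. -/
def evW {ω : ℂ} (hω : ‖ω‖ = 1) : WW →L[ℂ] ℂ :=
  lift1 (fun n => ω ^ n / (wW ε n : ℂ)) zero_le_one fun n => by
    have := one_le_wW hε n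
    rw [norm_div, norm_zpow, hω, one_zpow, Complex.norm_real,
      Real.norm_of_nonneg (wW_pos hε n).le]
    exact (div_le_one (wW_pos hε n)).2 this

lemma evW_single {ω : ℂ} (hω : ‖ω‖ = 1) (n : ℤ) (c : ℂ) :
    evW hε hω (lp.single 1 n c) = c * (ω ^ n / (wW ε n : ℂ)) := by
  rw [evW, lift1_single, smul_eq_mul]

lemma evW_mulW {ω : ℂ} (hω : ‖ω‖ = 1) (a b : WW) :
    evW hε hω (mulW hε a b) = evW hε hω a * evW hε hω b := by
  have key : (ContinuousLinearMap.compL ℂ WW WW ℂ (evW hε hω)).comp (mulW hε) =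
      (ContinuousLinearMap.mul ℂ ℂ).bilinearComp (evW hε hω) (evW hε hω) := by
    refine seq_ext_single₂ (by simp) (by simp) fun n m => ?_
    have h1 := (wW_pos hε n).ne'
    have h2 := (wW_pos hε m).ne'
    have h3 := (wW_pos hε (n + m)).ne'
    have hω0 : ω ≠ 0 := norm_ne_zero_iff.1 (by rw [hω]; exact one_ne_zero)
    simp only [ContinuousLinearMap.comp_apply, ContinuousLinearMap.compL_apply,
      ContinuousLinearMap.bilinearComp_apply, ContinuousLinearMap.mul_apply',
      ContinuousLinearMap.flip_apply, mulW, convW, conv_single, evW_single, kerW, if_true, one_mul,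
      mul_one]
    rw [zpow_add₀ hω0]
    push_cast
    have h1 : (wW ε n : ℂ) ≠ 0 := by exact_mod_cast h1
    have h2 : (wW ε m : ℂ) ≠ 0 := by exact_mod_cast h2
    have h3 : (wW ε (n + m) : ℂ) ≠ 0 := by exact_mod_cast h3
    field_simp
  exact congrArg (fun T => T a b) key

/-- The evaluation of a series of `HH` at a point of the unit circle. -/
def evH {ω : ℂ} (hω : ‖ω‖ = 1) : HH →L[ℂ] ℂ := (evW hε hω).comp (iota hs)

lemma evH_apply {ω : ℂ} (hω : ‖ω‖ = 1) (a : HH) : evH hε hs hω a = evW hε hω (iota hs a) := rfl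

lemma evH_mulH {ω : ℂ} (hω : ‖ω‖ = 1) (a b : HH) :
    evH hε hs hω (mulH hε hs a b) = evH hε hs hω a * evH hε hs hω b := by
  simp only [evH_apply, iota_mulH, evW_mulW]

lemma hasSum_evW {ω : ℂ} (hω : ‖ω‖ = 1) (a : WW) :
    HasSum (fun n : ℤ => a n / (wW ε n : ℂ) * ω ^ n) (evW hε hω a) := by
  have h := (lp.hasSum_single (p := 1) (by simp) a).mapL (evW hε hω)
  refine h.congr_fun fun n => ?_
  rw [evW_single]
  ring

lemma hasSum_evH {ω : ℂ} (hω : ‖ω‖ = 1) (a : HH) :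
    HasSum (fun n : ℤ => a n / (wH ε s n : ℂ) * ω ^ n) (evH hε hs hω a) := by
  refine (hasSum_evW hε hω (iota hs a)).congr_fun fun n => ?_
  rw [iota, mul21_apply, invWeight_apply, wH, wW]
  push_cast
  simp only [div_eq_mul_inv, mul_inv]
  ring

end Products

/-! ### The inverse square root of an operator -/

section InvSqrt

variable {E : Type*} [NormedAddCommGroup E] [NormedSpace ℂ E]

/-- The scalar binomial series bounds the one with values in the algebra of operators. -/
lemma one_le_radius_binomialSeries_clm :
    1 ≤ (binomialSeries (E →L[ℂ] E) (-1 / 2 : ℂ)).radius := by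
  have h : (1 : ℝ≥0∞) ≤ (binomialSeries ℂ (-1 / 2 : ℂ)).radius := binomialSeries_radius_ge_one
  refine ENNReal.le_of_forall_nnreal_lt fun r hr => ?_
  have h1 := (binomialSeries ℂ (-1 / 2 : ℂ)).norm_mul_pow_le_of_lt_radius (hr.trans_le h)
  obtain ⟨C, hC, h2⟩ := h1
  refine FormalMultilinearSeries.le_radius_of_bound _ (max C ‖binomialSeries (E →L[ℂ] E)
    (-1 / 2 : ℂ) 0‖) fun n => ?_
  rcases Nat.eq_zero_or_pos n with rfl | hn
  · simp
  · refine le_trans ?_ (le_max_left _ _)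
    refine le_trans ?_ (h2 n)
    gcongr
    unfold binomialSeries
    rw [FormalMultilinearSeries.ofScalars_norm (E := ℂ)]
    exact FormalMultilinearSeries.ofScalars_norm_le (E →L[ℂ] E) _ _ hn

variable [CompleteSpace E]

/-- The operator `(1 + T)^{-1/2}`, given by the binomial series if `‖T‖ < 1`. -/
def invSqrt (T : E →L[ℂ] E) : E →L[ℂ] E := (binomialSeries (E →L[ℂ] E) (-1 / 2 : ℂ)).sum T

lemma contDiffOn_invSqrt :
    ContDiffOn ℂ 1 (invSqrt : (E →L[ℂ] E) → (E →L[ℂ] E)) (Metric.ball 0 1) := by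
  have h := (binomialSeries (E →L[ℂ] E) (-1 / 2 : ℂ)).hasFPowerSeriesOnBall
    (zero_lt_one.trans_le one_le_radius_binomialSeries_clm)
  have h1 := (h.mono zero_lt_one one_le_radius_binomialSeries_clm).analyticOnNhd
  have h2 : Metric.eball (0 : E →L[ℂ] E) 1 = Metric.ball 0 1 := by
    rw [← ENNReal.ofReal_one, Metric.eball_ofReal]
  rw [h2] at h1
  exact h1.contDiffOn (Metric.isOpen_ball.uniqueDiffOn)

lemma hasSum_invSqrt {T : E →L[ℂ] E} (hT : ‖T‖ < 1) (x : E) :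
    HasSum (fun n : ℕ => Ring.choose (-1 / 2 : ℂ) n • (T ^ n) x) (invSqrt T x) := by
  have h := (binomialSeries (E →L[ℂ] E) (-1 / 2 : ℂ)).hasSum (x := T) (by
    have h2 : Metric.eball (0 : E →L[ℂ] E) 1 = Metric.ball 0 1 := by
      rw [← ENNReal.ofReal_one, Metric.eball_ofReal]
    refine Metric.eball_subset_eball one_le_radius_binomialSeries_clm ?_
    rw [h2]
    simpa using hT)
  have h1 := h.mapL (ContinuousLinearMap.apply ℂ E x)
  refine h1.congr_fun fun n => ?_
  simp [List.ofFn_const]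

/-- A closed subspace which is invariant under `T` is invariant under `(1 + T)^{-1/2}`. -/
lemma invSqrt_mem {T : E →L[ℂ] E} (hT : ‖T‖ < 1) (V : Submodule ℂ E) (hV : IsClosed (V : Set E))
    (hTV : ∀ x ∈ V, T x ∈ V) {x : E} (hx : x ∈ V) : invSqrt T x ∈ V := by
  have hp : ∀ n : ℕ, (T ^ n) x ∈ V := by
    intro n
    induction n with
    | zero => simpa using hx
    | succ n ih =>
      rw [pow_succ']
      exact hTV _ ih
  exact hV.mem_of_tendsto (hasSum_invSqrt hT x)
    (Filter.Eventually.of_forall fun t => V.sum_mem fun n _ => V.smul_mem _ (hp n))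

/-- If a functional `φ` turns `T` into the multiplication by `c` on an invariant subspace,
it turns `(1 + T)^{-1/2}` into the multiplication by `(1 + c)^{-1/2}`. -/
lemma map_invSqrt {T : E →L[ℂ] E} (hT : ‖T‖ < 1) (φ : E →L[ℂ] ℂ) {c : ℂ} (hc : ‖c‖ < 1)
    (hφ : ∀ x, φ (T x) = c * φ x) (x : E) :
    φ (invSqrt T x) = (1 + c) ^ (-1 / 2 : ℂ) * φ x := by
  have h1 := (hasSum_invSqrt hT x).mapL φ
  have h2 := (Complex.one_add_cpow_hasFPowerSeriesOnBall_zero (a := -1 / 2)).hasSum (y := c) (by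
    rw [← ENNReal.ofReal_one, Metric.eball_ofReal]
    simpa using hc)
  rw [zero_add] at h2
  refine h1.unique ((h2.mul_right (φ x)).congr_fun fun n => ?_)
  have hp : ∀ n : ℕ, φ ((T ^ n) x) = c ^ n * φ x := by
    intro n
    induction n with
    | zero => simp
    | succ n ih =>
      rw [pow_succ', pow_succ', mul_apply_eq_comp, hφ, ih, mul_assoc]
  rw [map_smul, hp, binomialSeries_apply, List.ofFn_const, List.prod_replicate, smul_eq_mul,
    smul_eq_mul, mul_assoc]

end InvSqrt

/-! ### Families of Laurent series with a singular weight -/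

section Singular

/-- The triples `(n₀, n₁, n₂)` of two families of Laurent series which depend on the angle and of
one Laurent series. A family `n₀` with values in `HH` which vanishes at the angle `0` is represented by
the triple in which `n₁(θ) = n₀(θ) / (e^{iθ} - 1)`, with values in `WW`, and
`n₂ = ∫ n₀(θ) / |e^{iθ} - 1| dθ`, assumed to lie in `HH`. -/
abbrev Triple : Type := (ℝ →ᵇ HH) × (ℝ →ᵇ WW) × HH

/-- The phase `(e^{iθ} - 1) / |e^{iθ} - 1|`. -/
def phase (θ : ℝ) : ℂ := (circleMap 0 1 θ - 1) / (‖circleMap 0 1 θ - 1‖ : ℂ)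

lemma measurable_phase : Measurable phase := by
  have := (continuous_circleMap 0 1).measurable
  unfold phase
  fun_prop

lemma norm_phase_le (θ : ℝ) : ‖phase θ‖ ≤ 1 := by
  rw [phase, norm_div, Complex.norm_real, norm_norm]
  exact div_self_le_one _

variable {ε : ℝ} (hε : ε ∈ Ioo (0 : ℝ) 1) {s : ℕ} (hs : 1 ≤ s)

/-- The integral against the phase. -/
def phaseIntegral {F : Type*} [NormedAddCommGroup F] [NormedSpace ℂ F] : (ℝ →ᵇ F) →L[ℂ] F :=
  integralC phase measurable_phase norm_phase_le

/-- The embedding of constants into the functions of the angle. -/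
def constC (F : Type*) [NormedAddCommGroup F] [NormedSpace ℂ F] : F →L[ℂ] (ℝ →ᵇ F) :=
  LinearMap.mkContinuous
    { toFun x := BoundedContinuousFunction.const ℝ x
      map_add' _ _ := rfl
      map_smul' _ _ := rfl }
    1 fun x => by
      rw [one_mul]
      exact BoundedContinuousFunction.norm_const_le x

/-- The product of a family of Laurent series `q` and of a family `n` which vanishes at
the angle `0`. Here `q` is given by `(q₀, q₁, q₂)` with `q₂ = q₀(0)` and
`q₁(θ) = (q₀(θ) - q₀(0)) / (e^{iθ} - 1)`. The last component is
`q₂ n₂ + ∫ (q₀(θ) - q₂) n₁(θ) (e^{iθ} - 1) / |e^{iθ} - 1| dθ`, in which the integrand is split into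
two partial products with values in `HH`. -/
def tripleMul : Triple →L[ℂ] Triple →L[ℂ] Triple :=
  let p₀ : Triple →L[ℂ] (ℝ →ᵇ HH) := ContinuousLinearMap.fst ℂ _ _
  let p₁ : Triple →L[ℂ] (ℝ →ᵇ WW) :=
    (ContinuousLinearMap.fst ℂ _ _).comp (ContinuousLinearMap.snd ℂ _ _)
  let p₂ : Triple →L[ℂ] HH := (ContinuousLinearMap.snd ℂ _ _).comp (ContinuousLinearMap.snd ℂ _ _)
  let i₀ : (ℝ →ᵇ HH) →L[ℂ] Triple := ContinuousLinearMap.inl ℂ _ _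
  let i₁ : (ℝ →ᵇ WW) →L[ℂ] Triple :=
    (ContinuousLinearMap.inr ℂ _ _).comp (ContinuousLinearMap.inl ℂ _ _)
  let i₂ : HH →L[ℂ] Triple := (ContinuousLinearMap.inr ℂ _ _).comp (ContinuousLinearMap.inr ℂ _ _)
  (ContinuousLinearMap.compL ℂ _ _ _ i₀).comp ((pointwise (mulH hε hs)).bilinearComp p₀ p₀) +
  (ContinuousLinearMap.compL ℂ _ _ _ i₁).comp
    ((pointwise ((mulW hε).comp (iota hs))).bilinearComp p₀ p₁) +
  (ContinuousLinearMap.compL ℂ _ _ _ i₂).comp ((mulH hε hs).bilinearComp p₂ p₂ +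
    (ContinuousLinearMap.compL ℂ _ _ _ phaseIntegral).comp
      ((pointwise (convGe hε s)).bilinearComp p₁ p₀ +
        (pointwise (convGt hε s)).flip.bilinearComp (p₀ - (constC HH).comp p₂) p₁))

lemma tripleMul_apply (q n : Triple) : tripleMul hε hs q n =
    (pointwise (mulH hε hs) q.1 n.1, pointwise ((mulW hε).comp (iota hs)) q.1 n.2.1,
      mulH hε hs q.2.2 n.2.2 + phaseIntegral (pointwise (convGe hε s) q.2.1 n.1 +
        pointwise (convGt hε s) n.2.1 (q.1 - constC HH q.2.2))) := by
  simp [tripleMul]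

/-- The triples in which `n₁` and `n₂` are derived from `n₀`. -/
def consistent : Submodule ℂ Triple where
  carrier := {n | (∀ θ, iota hs (n.1 θ) = (circleMap 0 1 θ - 1) • n.2.1 θ) ∧
    iota hs n.2.2 = phaseIntegral n.2.1}
  zero_mem' := by simp
  add_mem' := fun ha hb => ⟨fun θ => by simp [ha.1 θ, hb.1 θ], by simp [ha.2, hb.2]⟩
  smul_mem' := fun c a ha => ⟨fun θ => by simp [ha.1 θ, smul_comm c], by simp [ha.2]⟩

lemma isClosed_consistent : IsClosed (consistent hs : Set Triple) := by
  have h : (consistent hs : Set Triple) =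
      (⋂ θ, {n | iota hs (n.1 θ) = (circleMap 0 1 θ - 1) • n.2.1 θ}) ∩
        {n | iota hs n.2.2 = phaseIntegral n.2.1} := by
    ext n
    simp [consistent]
  rw [h]
  refine IsClosed.inter (isClosed_iInter fun θ => isClosed_eq ?_ ?_) (isClosed_eq ?_ ?_)
  · exact (iota hs).continuous.comp
      ((BoundedContinuousFunction.evalCLM ℂ θ).continuous.comp continuous_fst)
  · refine Continuous.const_smul (M := ℂ) ?_ (circleMap 0 1 θ - 1)
    exact (BoundedContinuousFunction.evalCLM ℂ θ : (ℝ →ᵇ WW) →L[ℂ] WW).continuous.comp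
      (continuous_fst.comp continuous_snd : Continuous fun n : Triple => n.2.1)
  · exact (iota hs).continuous.comp (continuous_snd.comp continuous_snd)
  · exact phaseIntegral.continuous.comp (continuous_fst.comp continuous_snd)

/-- The product is consistent: in `∫ (q₀ - q₂) n₁ phase` the factor `e^{iθ} - 1` of `q₀ - q₂` is
moved to `n₁`, so that the integrand is represented in `HH`. -/
lemma tripleMul_mem {q n : Triple}
    (hq : ∀ θ, iota hs (q.1 θ - q.2.2) = (circleMap 0 1 θ - 1) • q.2.1 θ)
    (hn : n ∈ consistent hs) : tripleMul hε hs q n ∈ consistent hs := by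
  rw [tripleMul_apply]
  refine ⟨fun θ => ?_, ?_⟩
  · simp only [pointwise_apply, iota_mulH, hn.1 θ, map_smul, ContinuousLinearMap.comp_apply]
  · have h1 : ∀ θ, iota hs ((pointwise (convGe hε s) q.2.1 n.1 +
        pointwise (convGt hε s) n.2.1 (q.1 - constC HH q.2.2)) θ) =
        mulW hε (iota hs (q.1 θ - q.2.2)) (n.2.1 θ) := fun θ =>
      iota_convGe_add_convGt hε hs (hn.1 θ) (hq θ)
    have h2 := map_integralC (iota hs) phase measurable_phase norm_phase_le
      (pointwise (convGe hε s) q.2.1 n.1 +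
        pointwise (convGt hε s) n.2.1 (q.1 - constC HH q.2.2))
    have h3 := map_integralC (mulW hε (iota hs q.2.2)) phase measurable_phase norm_phase_le n.2.1
    change iota hs (_ + _) = _
    rw [map_add, iota_mulH, hn.2]
    simp only [phaseIntegral]
    rw [h2, h3, integralC_apply, ← intervalIntegral.integral_add]
    · refine intervalIntegral.integral_congr fun θ _ => ?_
      rw [h1 θ, map_sub, map_sub, sub_apply, ← smul_add, add_sub_cancel]
      rfl
    · exact integrable_smul_bcf measurable_phase norm_phase_le
        ((mulW hε (iota hs q.2.2)).compLeftContinuousBounded ℝ n.2.1)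
    · exact integrable_smul_bcf measurable_phase norm_phase_le
        ((iota hs).compLeftContinuousBounded ℝ (pointwise (convGe hε s) q.2.1 n.1 +
        pointwise (convGt hε s) n.2.1 (q.1 - constC HH q.2.2)))

lemma evH_of_consistent {ω : ℂ} (hω : ‖ω‖ = 1) {n : Triple} (hn : n ∈ consistent hs) :
    evH hε hs hω n.2.2 = ∫ θ in (0 : ℝ)..(2 * π), phase θ * evW hε hω (n.2.1 θ) := by
  rw [evH_apply, hn.2]
  exact map_integralC (evW hε hω) phase measurable_phase norm_phase_le n.2.1

/-- The evaluation of `n₁` at an angle and at a point of the unit circle. -/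
def tripleEval {ω : ℂ} (hω : ‖ω‖ = 1) (θ : ℝ) : Triple →L[ℂ] ℂ :=
  ((evW hε hω).comp (BoundedContinuousFunction.evalCLM ℂ θ)).comp
    ((ContinuousLinearMap.fst ℂ _ _).comp (ContinuousLinearMap.snd ℂ _ _))

lemma tripleEval_apply {ω : ℂ} (hω : ‖ω‖ = 1) (θ : ℝ) (n : Triple) :
    tripleEval hε hω θ n = evW hε hω (n.2.1 θ) := rfl

lemma tripleEval_mul {ω : ℂ} (hω : ‖ω‖ = 1) (θ : ℝ) (q n : Triple) :
    tripleEval hε hω θ (tripleMul hε hs q n) =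
      evH hε hs hω (q.1 θ) * tripleEval hε hω θ n := by
  rw [tripleEval_apply, tripleEval_apply, tripleMul_apply]
  exact evW_mulW hε hω _ _

end Singular

/-! ### Multipliers -/

section Multipliers

/-- The Fourier multiplier `∫_0^{2π} (e^{imθ} - 1) / |e^{iθ} - 1| dθ` of the singular integral. -/
def lam (m : ℤ) : ℂ :=
  ∫ θ in (0 : ℝ)..(2 * π), (circleMap 0 1 θ ^ m - 1) / (‖circleMap 0 1 θ - 1‖ : ℂ)

/-- The weight `(n + 1)^{s+1} ε^{-(n+1)} (1 + |λ_{-(n+1)}|)` of the coefficient of `z^{-(n+1)}`. -/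
def wL (ε : ℝ) (s : ℕ) (n : ℕ) : ℝ :=
  ((n : ℝ) + 1) ^ (s + 1) * ε⁻¹ ^ (n + 1) * (1 + ‖lam (-((n : ℤ) + 1))‖)

/-- The space of the series `∑ a_n z^{-(n+1)}` whose coefficients, multiplied by the weights
`wL ε s n`, are square summable. The series is encoded by the sequence of these products. -/
abbrev LL : Type := seq ℕ 2

variable {ε : ℝ} (hε : ε ∈ Ioo (0 : ℝ) 1) {s : ℕ} (hs : 2 ≤ s)

lemma wL_pos (hε : ε ∈ Ioo (0 : ℝ) 1) (s n : ℕ) : 0 < wL ε s n := by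
  have := inv_pos.2 hε.1
  unfold wL
  positivity

lemma wH_div_wL_le (hε : ε ∈ Ioo (0 : ℝ) 1) (s n : ℕ) {m : ℤ} (hm : m.natAbs ≤ n + 2) :
    wH ε s m / wL ε s n * (((n : ℝ) + 1) * (1 + ‖lam (-((n : ℤ) + 1))‖)) ≤ ε⁻¹ * 3 ^ s := by
  have h1 := inv_pos.2 hε.1
  have h2 : ε⁻¹ ^ m.natAbs ≤ ε⁻¹ ^ (n + 2) := pow_le_pow_right₀ (one_le_inv_of_mem hε) hm
  have h3 : (1 + (m.natAbs : ℝ)) ^ s ≤ (3 * ((n : ℝ) + 1)) ^ s := by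
    refine pow_le_pow_left₀ (by positivity) ?_ s
    have : (m.natAbs : ℝ) ≤ n + 2 := by exact_mod_cast hm
    have h0 : (0 : ℝ) ≤ n := n.cast_nonneg
    linarith
  rw [div_mul_eq_mul_div, div_le_iff₀ (wL_pos hε s n)]
  unfold wH wL
  calc ε⁻¹ ^ m.natAbs * (1 + (m.natAbs : ℝ)) ^ s *
        (((n : ℝ) + 1) * (1 + ‖lam (-((n : ℤ) + 1))‖))
      ≤ ε⁻¹ ^ (n + 2) * (3 * ((n : ℝ) + 1)) ^ s *
        (((n : ℝ) + 1) * (1 + ‖lam (-((n : ℤ) + 1))‖)) := by gcongr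
    _ = _ := by
      rw [mul_pow]
      ring

lemma wW_div_wL_le (hε : ε ∈ Ioo (0 : ℝ) 1) (hs : 2 ≤ s) (n : ℕ) {m : ℤ}
    (hm : m.natAbs ≤ n + 2) :
    wW ε m / wL ε s n * ((n : ℝ) + 1) ^ 3 ≤ ε⁻¹ := by
  have h1 := inv_pos.2 hε.1
  have h2 : ε⁻¹ ^ m.natAbs ≤ ε⁻¹ ^ (n + 2) := pow_le_pow_right₀ (one_le_inv_of_mem hε) hm
  have h4 : (1 : ℝ) ≤ (n : ℝ) + 1 := by simp
  have h3 : ((n : ℝ) + 1) ^ 3 ≤ ((n : ℝ) + 1) ^ (s + 1) := pow_le_pow_right₀ h4 (by omega)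
  rw [div_mul_eq_mul_div, div_le_iff₀ (wL_pos hε s n)]
  unfold wW wL
  calc ε⁻¹ ^ m.natAbs * ((n : ℝ) + 1) ^ 3
      ≤ ε⁻¹ ^ (n + 2) * ((n : ℝ) + 1) ^ (s + 1) * 1 := by
        rw [mul_one]
        gcongr
    _ ≤ ε⁻¹ ^ (n + 2) * ((n : ℝ) + 1) ^ (s + 1) * (1 + ‖lam (-((n : ℤ) + 1))‖) := by
        gcongr
        simp
    _ = _ := by ring

/-- The injective assignments of an exponent `e n` to the term of index `n`, whose own exponent is
`-(n + 1)`, which increase the absolute value of the exponent by at most one. -/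
structure Relabel (e : ℕ → ℤ) : Prop where
  inj : Function.Injective e
  le : ∀ n, (e n).natAbs ≤ n + 2

variable {e : ℕ → ℤ} (he : Relabel e)

/-- The family of series `∑ K_n(θ) a_n z^{e(n)}`, in `HH`, for multipliers of order one. -/
def toH (s : ℕ) (K : ℕ → ℝ →ᵇ ℂ) {C : ℝ} (hC : 0 ≤ C) (hK : ∀ n, ‖K n‖ ≤ C * ((n : ℝ) + 1)) :
    LL →L[ℂ] (ℝ →ᵇ HH) :=
  ((reindex 2 (by simp) he.inj).compLeftContinuousBounded ℝ).comp
    (diagC 2 (by simp) (fun n => ((wH ε s (e n) / wL ε s n : ℝ) : ℂ) • K n)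
      (C := C * (ε⁻¹ * 3 ^ s)) (by have := inv_pos.2 hε.1; positivity) fun n => by
        have h1 := wH_div_wL_le hε s n (he.le n)
        have h2 : 0 ≤ wH ε s (e n) / wL ε s n := (div_pos (wH_pos hε s _) (wL_pos hε s n)).le
        have h3 := norm_nonneg (lam (-((n : ℤ) + 1)))
        rw [norm_smul, Complex.norm_real, Real.norm_of_nonneg h2]
        calc wH ε s (e n) / wL ε s n * ‖K n‖
            ≤ wH ε s (e n) / wL ε s n * (C * ((n : ℝ) + 1)) := by
              gcongr
              exact hK n
          _ = C * (wH ε s (e n) / wL ε s n * (((n : ℝ) + 1) * 1)) := by ring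
          _ ≤ C * (wH ε s (e n) / wL ε s n *
              (((n : ℝ) + 1) * (1 + ‖lam (-((n : ℤ) + 1))‖))) := by
            gcongr
            linarith
          _ ≤ C * (ε⁻¹ * 3 ^ s) := by gcongr)

/-- The series `∑ K_n a_n z^{e(n)}`, in `HH`, for multipliers of order one and a logarithm. -/
def toHConst (s : ℕ) (K : ℕ → ℂ) {C : ℝ} (hC : 0 ≤ C)
    (hK : ∀ n, ‖K n‖ ≤ C * (((n : ℝ) + 1) * (1 + ‖lam (-((n : ℤ) + 1))‖))) : LL →L[ℂ] HH :=
  (reindex 2 (by simp) he.inj).comp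
    (diag 2 (fun n => ((wH ε s (e n) / wL ε s n : ℝ) : ℂ) * K n)
      (C := C * (ε⁻¹ * 3 ^ s)) (by have := inv_pos.2 hε.1; positivity) fun n => by
        have h1 := wH_div_wL_le hε s n (he.le n)
        have h2 : 0 ≤ wH ε s (e n) / wL ε s n := (div_pos (wH_pos hε s _) (wL_pos hε s n)).le
        rw [norm_mul, Complex.norm_real, Real.norm_of_nonneg h2]
        calc wH ε s (e n) / wL ε s n * ‖K n‖
            ≤ wH ε s (e n) / wL ε s n *
              (C * (((n : ℝ) + 1) * (1 + ‖lam (-((n : ℤ) + 1))‖))) := by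
              gcongr
              exact hK n
          _ = C * (wH ε s (e n) / wL ε s n *
              (((n : ℝ) + 1) * (1 + ‖lam (-((n : ℤ) + 1))‖))) := by ring
          _ ≤ C * (ε⁻¹ * 3 ^ s) := by gcongr)

/-- The sequence `1 / (n + 1)` of `ℓ²`. -/
def harmonic : seq ℕ 2 :=
  ⟨fun n => ((((n : ℝ) + 1)⁻¹ : ℝ) : ℂ), memℓp_gen (by
    have := (summable_nat_add_iff 1).2 (Real.summable_nat_pow_inv (p := 2).2 (by norm_num))
    refine this.congr fun n => ?_
    rw [Complex.norm_real, Real.norm_of_nonneg (by positivity), ENNReal.toReal_ofNat,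
      Real.rpow_two, inv_pow]
    push_cast
    rfl)⟩

lemma harmonic_apply (n : ℕ) : harmonic n = ((((n : ℝ) + 1)⁻¹ : ℝ) : ℂ) := rfl

/-- The family of series `∑ K_n(θ) a_n z^{e(n)}`, in `WW`, for multipliers of order two. -/
def toW (K : ℕ → ℝ →ᵇ ℂ) {C : ℝ} (hC : 0 ≤ C) (hK : ∀ n, ‖K n‖ ≤ C * ((n : ℝ) + 1) ^ 2) :
    LL →L[ℂ] (ℝ →ᵇ WW) :=
  ((reindex 1 (by simp) he.inj).compLeftContinuousBounded ℝ).comp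
    ((diagC 1 (by simp) (fun n : ℕ => ((((n : ℝ) + 1) * (wW ε (e n) / wL ε s n) : ℝ) : ℂ) • K n)
      (C := C * ε⁻¹) (by have := inv_pos.2 hε.1; positivity) fun n => by
        have h1 := wW_div_wL_le hε hs n (he.le n)
        have h2 : 0 ≤ wW ε (e n) / wL ε s n := (div_pos (wW_pos hε _) (wL_pos hε s n)).le
        rw [norm_smul, Complex.norm_real, Real.norm_of_nonneg (by positivity)]
        calc ((n : ℝ) + 1) * (wW ε (e n) / wL ε s n) * ‖K n‖
            ≤ ((n : ℝ) + 1) * (wW ε (e n) / wL ε s n) * (C * ((n : ℝ) + 1) ^ 2) := by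
              gcongr
              exact hK n
          _ = C * (wW ε (e n) / wL ε s n * ((n : ℝ) + 1) ^ 3) := by ring
          _ ≤ C * ε⁻¹ := by gcongr).comp (mul21 harmonic))

lemma iota_single (hs : 1 ≤ s) (n : ℕ) (c : ℂ) :
    iota hs (lp.single 2 (e n) ((wH ε s (e n) / wL ε s n : ℝ) * c)) =
      lp.single 1 (e n) ((wW ε (e n) / wL ε s n : ℝ) * c) := by
  rw [iota, mul21_single, invWeight_apply]
  congr 1
  rw [← mul_assoc, ← Complex.ofReal_mul]
  congr 2
  unfold wH wW
  have : (1 + ((e n).natAbs : ℝ)) ^ s ≠ 0 := by positivity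
  field_simp

lemma iota_toH_single (hs' : 1 ≤ s) (K : ℕ → ℝ →ᵇ ℂ) {C : ℝ} (hC : 0 ≤ C)
    (hK : ∀ n, ‖K n‖ ≤ C * ((n : ℝ) + 1)) (n : ℕ) (c : ℂ) (θ : ℝ) :
    iota hs' (toH hε he s K hC hK (lp.single 2 n c) θ) =
      lp.single 1 (e n) ((wW ε (e n) / wL ε s n : ℝ) * (K n θ * c)) := by
  rw [← iota_single (e := e) hs']
  congr 1
  change reindex 2 _ he.inj (diag 2 _ _ _ _) = _
  rw [diag_single, reindex_single]
  simp [mul_assoc]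

lemma iota_toHConst_single (hs' : 1 ≤ s) (K : ℕ → ℂ) {C : ℝ} (hC : 0 ≤ C)
    (hK : ∀ n, ‖K n‖ ≤ C * (((n : ℝ) + 1) * (1 + ‖lam (-((n : ℤ) + 1))‖))) (n : ℕ) (c : ℂ) :
    iota hs' (toHConst hε he s K hC hK (lp.single 2 n c)) =
      lp.single 1 (e n) ((wW ε (e n) / wL ε s n : ℝ) * (K n * c)) := by
  rw [← iota_single (e := e) hs']
  congr 1
  rw [toHConst, ContinuousLinearMap.comp_apply, diag_single, reindex_single]
  simp [mul_assoc]

lemma toW_single (K : ℕ → ℝ →ᵇ ℂ) {C : ℝ} (hC : 0 ≤ C)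
    (hK : ∀ n, ‖K n‖ ≤ C * ((n : ℝ) + 1) ^ 2) (n : ℕ) (c : ℂ) (θ : ℝ) :
    toW hε hs he K hC hK (lp.single 2 n c) θ =
      lp.single 1 (e n) ((wW ε (e n) / wL ε s n : ℝ) * (K n θ * c)) := by
  change reindex 1 _ he.inj (diag 1 _ _ _ (mul21 harmonic _)) = _
  rw [mul21_single, diag_single, reindex_single, harmonic_apply]
  congr 1
  have : (((n : ℝ) + 1 : ℝ) : ℂ) ≠ 0 := by
    rw [Complex.ofReal_ne_zero]
    positivity
  simp only [BoundedContinuousFunction.coe_smul, smul_eq_mul, Complex.ofReal_mul,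
    Complex.ofReal_inv]
  field_simp

lemma hasSum_map_seq {F : Type*} [NormedAddCommGroup F] [NormedSpace ℂ F] (T : LL →L[ℂ] F)
    (x : LL) : HasSum (fun n => T (lp.single 2 n (x n))) (T x) :=
  (lp.hasSum_single (by simp) x).mapL T

lemma evW_single_weight {ω : ℂ} (hω : ‖ω‖ = 1) (n : ℕ) (c : ℂ) :
    evW hε hω (lp.single 1 (e n) ((wW ε (e n) / wL ε s n : ℝ) * c)) =
      c / (wL ε s n : ℂ) * ω ^ e n := by
  rw [evW_single]
  have h1 : (wW ε (e n) : ℂ) ≠ 0 := by exact_mod_cast (wW_pos hε (e n)).ne'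
  push_cast
  field_simp

lemma hasSum_evH_toH (hs' : 1 ≤ s) (K : ℕ → ℝ →ᵇ ℂ) {C : ℝ} (hC : 0 ≤ C)
    (hK : ∀ n, ‖K n‖ ≤ C * ((n : ℝ) + 1)) (x : LL) (θ : ℝ) {ω : ℂ} (hω : ‖ω‖ = 1) :
    HasSum (fun n => K n θ * (x n / (wL ε s n : ℂ)) * ω ^ e n)
      (evH hε hs' hω (toH hε he s K hC hK x θ)) := by
  refine (hasSum_map_seq ((evH hε hs' hω).comp ((BoundedContinuousFunction.evalCLM ℂ θ).comp
    (toH hε he s K hC hK))) x).congr_fun fun n => ?_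
  change _ = evW hε hω (iota hs' (toH hε he s K hC hK (lp.single 2 n (x n)) θ))
  rw [iota_toH_single, evW_single_weight]
  ring

lemma hasSum_evH_toHConst (hs' : 1 ≤ s) (K : ℕ → ℂ) {C : ℝ} (hC : 0 ≤ C)
    (hK : ∀ n, ‖K n‖ ≤ C * (((n : ℝ) + 1) * (1 + ‖lam (-((n : ℤ) + 1))‖))) (x : LL)
    {ω : ℂ} (hω : ‖ω‖ = 1) :
    HasSum (fun n => K n * (x n / (wL ε s n : ℂ)) * ω ^ e n)
      (evH hε hs' hω (toHConst hε he s K hC hK x)) := by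
  refine (hasSum_map_seq ((evH hε hs' hω).comp (toHConst hε he s K hC hK)) x).congr_fun
    fun n => ?_
  change _ = evW hε hω (iota hs' (toHConst hε he s K hC hK (lp.single 2 n (x n))))
  rw [iota_toHConst_single, evW_single_weight]
  ring

lemma hasSum_evW_toW (K : ℕ → ℝ →ᵇ ℂ) {C : ℝ} (hC : 0 ≤ C)
    (hK : ∀ n, ‖K n‖ ≤ C * ((n : ℝ) + 1) ^ 2) (x : LL) (θ : ℝ) {ω : ℂ} (hω : ‖ω‖ = 1) :
    HasSum (fun n => K n θ * (x n / (wL ε s n : ℂ)) * ω ^ e n)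
      (evW hε hω (toW hε hs he K hC hK x θ)) := by
  refine (hasSum_map_seq ((evW hε hω).comp ((BoundedContinuousFunction.evalCLM ℂ θ).comp
    (toW hε hs he K hC hK))) x).congr_fun fun n => ?_
  change _ = evW hε hω (toW hε hs he K hC hK (lp.single 2 n (x n)) θ)
  rw [toW_single, evW_single_weight]
  ring

/-- A triple of multipliers in which `K₁ = (K₀ - K₂) / (e^{iθ} - 1)`. -/
lemma iota_toH_sub (hs' : 1 ≤ s) (K₀ K₁ : ℕ → ℝ →ᵇ ℂ) (K₂ : ℕ → ℂ) {C₀ C₁ C₂ : ℝ}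
    (hC₀ : 0 ≤ C₀) (hK₀ : ∀ n, ‖K₀ n‖ ≤ C₀ * ((n : ℝ) + 1))
    (hC₁ : 0 ≤ C₁) (hK₁ : ∀ n, ‖K₁ n‖ ≤ C₁ * ((n : ℝ) + 1) ^ 2) (hC₂ : 0 ≤ C₂)
    (hK₂ : ∀ n, ‖K₂ n‖ ≤ C₂ * (((n : ℝ) + 1) * (1 + ‖lam (-((n : ℤ) + 1))‖)))
    (h : ∀ n θ, K₀ n θ - K₂ n = (circleMap 0 1 θ - 1) * K₁ n θ) (x : LL) (θ : ℝ) :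
    iota hs' (toH hε he s K₀ hC₀ hK₀ x θ - toHConst hε he s K₂ hC₂ hK₂ x) =
      (circleMap 0 1 θ - 1) • toW hε hs he K₁ hC₁ hK₁ x θ := by
  have key : (iota hs').comp ((BoundedContinuousFunction.evalCLM ℂ θ).comp
      (toH hε he s K₀ hC₀ hK₀) - toHConst hε he s K₂ hC₂ hK₂) =
      (circleMap 0 1 θ - 1) • ((BoundedContinuousFunction.evalCLM ℂ θ).comp
        (toW hε hs he K₁ hC₁ hK₁)) := by
    refine seq_ext_single (by simp) fun n => ?_
    change iota hs' (toH hε he s K₀ hC₀ hK₀ _ θ - toHConst hε he s K₂ hC₂ hK₂ _) =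
      (circleMap 0 1 θ - 1) • toW hε hs he K₁ hC₁ hK₁ _ θ
    rw [map_sub, iota_toH_single, iota_toHConst_single, toW_single, ← lp.single_sub,
      ← lp.single_smul]
    congr 1
    simp only [mul_one, smul_eq_mul]
    linear_combination ((wW ε (e n) / wL ε s n : ℝ) : ℂ) * h n θ
  exact congrArg (fun T => T x) key

lemma iota_toH (hs' : 1 ≤ s) (K₀ K₁ : ℕ → ℝ →ᵇ ℂ) {C₀ C₁ : ℝ}
    (hC₀ : 0 ≤ C₀) (hK₀ : ∀ n, ‖K₀ n‖ ≤ C₀ * ((n : ℝ) + 1))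
    (hC₁ : 0 ≤ C₁) (hK₁ : ∀ n, ‖K₁ n‖ ≤ C₁ * ((n : ℝ) + 1) ^ 2)
    (h : ∀ n θ, K₀ n θ = (circleMap 0 1 θ - 1) * K₁ n θ) (x : LL) (θ : ℝ) :
    iota hs' (toH hε he s K₀ hC₀ hK₀ x θ) =
      (circleMap 0 1 θ - 1) • toW hε hs he K₁ hC₁ hK₁ x θ := by
  have h0 : ∀ n : ℕ, ‖(0 : ℂ)‖ ≤ 0 * (((n : ℝ) + 1) * (1 + ‖lam (-((n : ℤ) + 1))‖)) := by simp
  have h1 := iota_toH_sub hε hs he hs' K₀ K₁ (fun _ => 0) hC₀ hK₀ hC₁ hK₁ le_rfl h0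
    (by simpa using h) x θ
  have h2 : toHConst hε he s (fun _ => 0) le_rfl h0 = 0 := by
    ext x l
    by_cases hl : ∃ n, e n = l
    · obtain ⟨n, rfl⟩ := hl
      simp [toHConst, reindex_apply, diag_apply]
    · simp [toHConst, reindex_apply_of_notMem _ _ _ hl]
  simpa [h2] using h1

lemma iota_toHConst (hs' : 1 ≤ s) (K₁ : ℕ → ℝ →ᵇ ℂ) (K₂ : ℕ → ℂ) {C₁ C₂ : ℝ}
    (hC₁ : 0 ≤ C₁) (hK₁ : ∀ n, ‖K₁ n‖ ≤ C₁ * ((n : ℝ) + 1) ^ 2) (hC₂ : 0 ≤ C₂)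
    (hK₂ : ∀ n, ‖K₂ n‖ ≤ C₂ * (((n : ℝ) + 1) * (1 + ‖lam (-((n : ℤ) + 1))‖)))
    (h : ∀ n, K₂ n = ∫ θ in (0 : ℝ)..(2 * π), phase θ * K₁ n θ) (x : LL) :
    iota hs' (toHConst hε he s K₂ hC₂ hK₂ x) = phaseIntegral (toW hε hs he K₁ hC₁ hK₁ x) := by
  have key : (iota hs').comp (toHConst hε he s K₂ hC₂ hK₂) =
      phaseIntegral.comp (toW hε hs he K₁ hC₁ hK₁) := by
    refine seq_ext_single (by simp) fun n => ?_
    simp only [ContinuousLinearMap.comp_apply]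
    have h1 := map_integralC (ContinuousLinearMap.smulRight (1 : ℂ →L[ℂ] ℂ)
      (lp.single (E := fun _ : ℤ => ℂ) 1 (e n) ((wW ε (e n) / wL ε s n : ℝ) : ℂ)))
      phase measurable_phase norm_phase_le (K₁ n)
    rw [iota_toHConst_single, phaseIntegral, integralC_apply, h]
    rw [integralC_apply] at h1
    simp only [toW_single]
    simp only [ContinuousLinearMap.smulRight_apply, one_apply_eq_self, ← lp.single_smul,
      smul_eq_mul] at h1
    rw [mul_one, mul_comm, h1]
    refine intervalIntegral.integral_congr fun θ _ => ?_
    simp only [mul_one]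
    rw [mul_comm (K₁ n θ), ← lp.single_smul, smul_eq_mul]
  exact congrArg (fun T => T x) key

end Multipliers

/-! ### Difference quotients and increments -/

section Integrals

/-- The character `e^{imθ}`. -/
def powC (m : ℤ) : ℝ →ᵇ ℂ :=
  BoundedContinuousFunction.ofNormedAddCommGroup (fun θ => circleMap 0 1 θ ^ m)
    (by
      refine Continuous.zpow₀ (continuous_circleMap 0 1) m fun θ => Or.inl ?_
      exact circleMap_ne_center one_ne_zero) 1
    (fun θ => by rw [norm_zpow, norm_circleMap_one, one_zpow])

lemma powC_apply (m : ℤ) (θ : ℝ) : powC m θ = circleMap 0 1 θ ^ m := rfl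

lemma norm_powC_le (m : ℤ) : ‖powC m‖ ≤ 1 :=
  BoundedContinuousFunction.norm_ofNormedAddCommGroup_le _ zero_le_one _

/-- The difference quotient `(e^{-i(n+1)θ} - 1) / (e^{iθ} - 1)`. -/
def quotC (n : ℕ) : ℝ →ᵇ ℂ := -∑ l ∈ Finset.range (n + 1), powC (-((l : ℤ) + 1))

/-- The second difference quotient, of `quotC n` between the angles `θ` and `0`. -/
def quotC₂ (n : ℕ) : ℝ →ᵇ ℂ := -∑ l ∈ Finset.range (n + 1), quotC l

/-- The complex conjugate of `quotC n`. -/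
def quotCConj (n : ℕ) : ℝ →ᵇ ℂ := -∑ l ∈ Finset.range (n + 1), powC ((l : ℤ) + 1)

/-- The difference quotient of `quotCConj n` between the angles `θ` and `0`. -/
def quotCConj₂ (n : ℕ) : ℝ →ᵇ ℂ :=
  -∑ l ∈ Finset.range (n + 1), ∑ l' ∈ Finset.range (l + 1), powC (l' : ℤ)

lemma sum_range_le {f : ℕ → ℝ} (n : ℕ) (hf : ∀ l ≤ n, f l ≤ (n : ℝ) + 1) :
    ∑ l ∈ Finset.range (n + 1), f l ≤ ((n : ℝ) + 1) ^ 2 := by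
  refine (Finset.sum_le_card_nsmul _ _ ((n : ℝ) + 1) fun l hl => hf l ?_).trans (le_of_eq ?_)
  · exact Nat.lt_succ_iff.1 (Finset.mem_range.1 hl)
  · rw [Finset.card_range, nsmul_eq_mul]
    push_cast
    ring

lemma norm_sum_powC_le (g : ℕ → ℤ) (n : ℕ) :
    ‖∑ l ∈ Finset.range (n + 1), powC (g l)‖ ≤ (n : ℝ) + 1 := by
  refine (norm_sum_le_of_le _ fun l _ => norm_powC_le _).trans ?_
  simp

lemma norm_quotC_le (n : ℕ) : ‖quotC n‖ ≤ (n : ℝ) + 1 := by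
  rw [quotC, norm_neg]
  exact norm_sum_powC_le _ n

lemma norm_quotCConj_le (n : ℕ) : ‖quotCConj n‖ ≤ (n : ℝ) + 1 := by
  rw [quotCConj, norm_neg]
  exact norm_sum_powC_le _ n

lemma norm_quotC₂_le (n : ℕ) : ‖quotC₂ n‖ ≤ ((n : ℝ) + 1) ^ 2 := by
  rw [quotC₂, norm_neg]
  refine (norm_sum_le _ _).trans (sum_range_le n fun l hl => (norm_quotC_le l).trans ?_)
  gcongr

lemma norm_quotCConj₂_le (n : ℕ) : ‖quotCConj₂ n‖ ≤ ((n : ℝ) + 1) ^ 2 := by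
  rw [quotCConj₂, norm_neg]
  refine (norm_sum_le _ _).trans (sum_range_le n fun l hl => (norm_sum_powC_le _ l).trans ?_)
  gcongr

lemma circleMap_one_ne_zero (θ : ℝ) : circleMap 0 1 θ ≠ 0 := circleMap_ne_center one_ne_zero

lemma mul_quotC (n : ℕ) (θ : ℝ) :
    (circleMap 0 1 θ - 1) * quotC n θ = circleMap 0 1 θ ^ (-((n : ℤ) + 1)) - 1 := by
  have h0 := circleMap_one_ne_zero θ
  induction n with
  | zero =>
    simp only [quotC, zero_add, Finset.range_one, Finset.sum_singleton, Nat.cast_zero,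
      BoundedContinuousFunction.coe_neg, Pi.neg_apply, powC_apply, zpow_neg_one]
    field_simp
    ring
  | succ n ih =>
    have h1 : quotC (n + 1) θ = quotC n θ - circleMap 0 1 θ ^ (-(((n + 1 : ℕ) : ℤ) + 1)) := by
      rw [quotC, Finset.sum_range_succ, neg_add, ← quotC]
      rfl
    have h2 : circleMap 0 1 θ ^ (-((n : ℤ) + 1)) =
        circleMap 0 1 θ * circleMap 0 1 θ ^ (-(((n + 1 : ℕ) : ℤ) + 1)) := by
      rw [← zpow_one_add₀ h0]
      congr 1
    rw [h1, mul_sub, ih, h2]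
    ring

lemma quotC_sub (n : ℕ) (θ : ℝ) :
    quotC n θ - (-((n : ℂ) + 1)) = (circleMap 0 1 θ - 1) * quotC₂ n θ := by
  have h : ∑ l ∈ Finset.range (n + 1), (1 : ℂ) = (n : ℂ) + 1 := by simp
  rw [quotC₂, ← h]
  simp only [quotC, BoundedContinuousFunction.coe_neg, Pi.neg_apply,
    BoundedContinuousFunction.coe_sum, Finset.sum_apply, mul_neg, Finset.mul_sum]
  rw [← sub_eq_zero]
  have := Finset.sum_congr rfl fun l (_ : l ∈ Finset.range (n + 1)) => mul_quotC l θ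
  simp only [quotC, BoundedContinuousFunction.coe_neg, Pi.neg_apply,
    BoundedContinuousFunction.coe_sum, Finset.sum_apply, mul_neg, Finset.mul_sum,
    Finset.sum_sub_distrib] at this
  simp only [powC_apply] at this ⊢
  rw [this]
  ring

lemma quotCConj_sub (n : ℕ) (θ : ℝ) :
    quotCConj n θ - (-((n : ℂ) + 1)) = (circleMap 0 1 θ - 1) * quotCConj₂ n θ := by
  have h : ∑ l ∈ Finset.range (n + 1), (1 : ℂ) = (n : ℂ) + 1 := by simp
  rw [← h]
  simp only [quotCConj₂, quotCConj, BoundedContinuousFunction.coe_neg, Pi.neg_apply,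
    BoundedContinuousFunction.coe_sum, Finset.sum_apply, mul_neg, Finset.mul_sum, powC_apply]
  rw [sub_neg_eq_add, neg_add_eq_sub, ← Finset.sum_sub_distrib, ← Finset.sum_neg_distrib]
  refine Finset.sum_congr rfl fun l _ => ?_
  have h1 := mul_geom_sum (circleMap 0 1 θ) (l + 1)
  rw [Finset.mul_sum] at h1
  have h2 : circleMap 0 1 θ ^ ((l : ℤ) + 1) = circleMap 0 1 θ ^ (l + 1) := by
    exact_mod_cast rfl
  simp only [zpow_natCast, h1, h2]
  ring

lemma integral_phase_mul_quotC (n : ℕ) :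
    ∫ θ in (0 : ℝ)..(2 * π), phase θ * quotC n θ = lam (-((n : ℤ) + 1)) := by
  unfold lam phase
  congr 1
  funext θ
  rw [← mul_quotC]
  ring

lemma relabelNeg : Relabel fun n => -((n : ℤ) + 1) := ⟨fun _ _ h => by simpa using h, fun n => by
  omega⟩

lemma relabelNeg₂ : Relabel fun n => -((n : ℤ) + 2) := ⟨fun _ _ h => by simpa using h, fun n => by
  omega⟩

lemma relabelPos : Relabel fun n => (n : ℤ) + 1 := ⟨fun _ _ h => by simpa using h, fun n => by
  omega⟩

lemma relabelPos₂ : Relabel fun n => (n : ℤ) + 2 := ⟨fun _ _ h => by simpa using h, fun n => by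
  omega⟩

variable {ε : ℝ} (hε : ε ∈ Ioo (0 : ℝ) 1) {s : ℕ} (hs : 2 ≤ s)

lemma norm_natCast_le_lam (n : ℕ) :
    ‖-((n : ℂ) + 1)‖ ≤ 1 * (((n : ℝ) + 1) * (1 + ‖lam (-((n : ℤ) + 1))‖)) := by
  have h1 : ‖-((n : ℂ) + 1)‖ = (n : ℝ) + 1 := by
    rw [norm_neg]
    exact_mod_cast Complex.norm_natCast (n + 1)
  rw [h1]
  have h2 : (0 : ℝ) ≤ ((n : ℝ) + 1) * ‖lam (-((n : ℤ) + 1))‖ := by positivity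
  linarith

lemma norm_natCast_add_one (n : ℕ) : ‖-((n : ℂ) + 1)‖ = (n : ℝ) + 1 := by
  rw [norm_neg]
  exact_mod_cast Complex.norm_natCast (n + 1)

/-- The difference quotients `(f(ωσ) - f(ω)) / (ω(σ - 1))` as a triple. -/
def diffQuot : LL →L[ℂ] Triple :=
  (toH hε relabelNeg₂ s quotC zero_le_one (fun n => by simpa using norm_quotC_le n)).prod
    ((toW hε hs relabelNeg₂ quotC₂ zero_le_one (fun n => by simpa using norm_quotC₂_le n)).prod
      (toHConst hε relabelNeg₂ s (fun n => -((n : ℂ) + 1)) zero_le_one norm_natCast_le_lam))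

/-- The complex conjugates on the unit circle of the difference quotients, as a triple. -/
def diffQuotConj : LL →L[ℂ] Triple :=
  (toH hε relabelPos₂ s quotCConj zero_le_one (fun n => by simpa using norm_quotCConj_le n)).prod
    ((toW hε hs relabelPos₂ quotCConj₂ zero_le_one
      (fun n => by simpa using norm_quotCConj₂_le n)).prod
      (toHConst hε relabelPos₂ s (fun n => -((n : ℂ) + 1)) zero_le_one norm_natCast_le_lam))

/-- The increments `ωσ f'(ωσ) - ω f'(ω)` as a triple. Its third component contains the singular
integral of the derivative of `f`. -/
def increment : LL →L[ℂ] Triple :=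
  (toH hε relabelNeg s (fun n => -((n : ℂ) + 1) • (powC (-((n : ℤ) + 1)) - powC 0))
    (C := 2) zero_le_two (fun n => by
      rw [norm_smul, norm_natCast_add_one, mul_comm]
      gcongr
      refine (norm_sub_le _ _).trans ?_
      linarith [norm_powC_le (-((n : ℤ) + 1)), norm_powC_le 0])).prod
    ((toW hε hs relabelNeg (fun n => -((n : ℂ) + 1) • quotC n) zero_le_one (fun n => by
      rw [norm_smul, norm_natCast_add_one, one_mul, sq]
      gcongr
      exact norm_quotC_le n)).prod
      (toHConst hε relabelNeg s (fun n => -((n : ℂ) + 1) * lam (-((n : ℤ) + 1))) zero_le_one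
        (fun n => by
          rw [norm_mul, norm_natCast_add_one, one_mul]
          gcongr
          linarith)))

lemma diffQuot_consistent (hs' : 1 ≤ s) (x : LL) (θ : ℝ) :
    iota hs' ((diffQuot hε hs x).1 θ - (diffQuot hε hs x).2.2) =
      (circleMap 0 1 θ - 1) • (diffQuot hε hs x).2.1 θ :=
  iota_toH_sub hε hs relabelNeg₂ hs' quotC quotC₂ (fun n => -((n : ℂ) + 1)) _ _ _ _ _ _
    quotC_sub x θ

lemma diffQuotConj_consistent (hs' : 1 ≤ s) (x : LL) (θ : ℝ) :
    iota hs' ((diffQuotConj hε hs x).1 θ - (diffQuotConj hε hs x).2.2) =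
      (circleMap 0 1 θ - 1) • (diffQuotConj hε hs x).2.1 θ :=
  iota_toH_sub hε hs relabelPos₂ hs' quotCConj quotCConj₂ (fun n => -((n : ℂ) + 1)) _ _ _ _ _ _
    quotCConj_sub x θ

lemma increment_mem (hs' : 1 ≤ s) (x : LL) : increment hε hs x ∈ consistent hs' := by
  refine ⟨fun θ => ?_, ?_⟩
  · refine iota_toH hε hs relabelNeg hs' _ _ _ _ _ _ (fun n θ => ?_) x θ
    simp only [BoundedContinuousFunction.coe_smul, BoundedContinuousFunction.coe_sub,
      Pi.sub_apply, powC_apply, smul_eq_mul, zpow_zero, ← mul_quotC]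
    ring
  · refine iota_toHConst hε hs relabelNeg hs' _ _ _ _ _ _ (fun n => ?_) x
    rw [← integral_phase_mul_quotC, ← intervalIntegral.integral_const_mul]
    refine intervalIntegral.integral_congr fun θ _ => ?_
    simp only [BoundedContinuousFunction.coe_smul, smul_eq_mul]
    ring

/-- The Laurent monomial `z^m` in `HH`. -/
def monoH (ε : ℝ) (s : ℕ) (m : ℤ) : HH := lp.single 2 m (wH ε s m : ℂ)

/-- The Laurent monomial `z^m` in `WW`. -/
def monoW (ε : ℝ) (m : ℤ) : WW := lp.single 1 m (wW ε m : ℂ)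

lemma iota_monoH (hs' : 1 ≤ s) (m : ℤ) : iota hs' (monoH ε s m) = monoW ε m := by
  rw [monoH, monoW, iota, mul21_single, invWeight_apply, ← Complex.ofReal_mul]
  congr 2
  unfold wH wW
  have : (1 + (m.natAbs : ℝ)) ^ s ≠ 0 := by positivity
  field_simp

lemma evW_monoW {ω : ℂ} (hω : ‖ω‖ = 1) (m : ℤ) : evW hε hω (monoW ε m) = ω ^ m := by
  have h1 : (wW ε m : ℂ) ≠ 0 := by exact_mod_cast (wW_pos hε m).ne'
  rw [monoW, evW_single]
  field_simp

lemma evH_monoH (hs' : 1 ≤ s) {ω : ℂ} (hω : ‖ω‖ = 1) (m : ℤ) :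
    evH hε hs' hω (monoH ε s m) = ω ^ m := by
  rw [evH_apply, iota_monoH, evW_monoW]

/-- The increment `ωσ - ω` of the identity, as a triple. -/
def incrementId (ε : ℝ) (s : ℕ) : Triple :=
  (pointwise ((ContinuousLinearMap.lsmul ℂ ℂ).flip) (constC HH (monoH ε s 1)) (powC 1 - powC 0),
    constC WW (monoW ε 1), (∫ θ in (0 : ℝ)..(2 * π), phase θ) • monoH ε s 1)

lemma incrementId_mem (hs' : 1 ≤ s) : incrementId ε s ∈ consistent hs' := by
  refine ⟨fun θ => ?_, ?_⟩
  · change iota hs' ((circleMap 0 1 θ ^ (1 : ℤ) - circleMap 0 1 θ ^ (0 : ℤ)) • monoH ε s 1) =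
      (circleMap 0 1 θ - 1) • monoW ε 1
    rw [map_smul, iota_monoH, zpow_one, zpow_zero]
  · change iota hs' ((∫ θ in (0 : ℝ)..(2 * π), phase θ) • monoH ε s 1) =
      ∫ θ in (0 : ℝ)..(2 * π), phase θ • monoW ε 1
    rw [map_smul, iota_monoH, intervalIntegral.integral_smul_const]

end Integrals

/-! ### The singular integral of a conformal map with itself -/

section Kernel

lemma contDiffOn_invSqrt_apply {P E : Type*} [NormedAddCommGroup P] [NormedSpace ℂ P]
    [NormedAddCommGroup E] [NormedSpace ℂ E] [CompleteSpace E] {T T' : P → (E →L[ℂ] E)} {N : P → E}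
    (hT : ContDiff ℂ 1 T) (hT' : ContDiff ℂ 1 T') (hN : ContDiff ℂ 1 N) {U : Set P}
    (h : ∀ p ∈ U, ‖T p‖ < 1) (h' : ∀ p ∈ U, ‖T' p‖ < 1) :
    ContDiffOn ℂ 1 (fun p => invSqrt (T p) (invSqrt (T' p) (N p))) U := by
  have h1 : ContDiffOn ℂ 1 (fun p => invSqrt (T p)) U :=
    contDiffOn_invSqrt.comp hT.contDiffOn fun p hp => by simpa using h p hp
  have h2 : ContDiffOn ℂ 1 (fun p => invSqrt (T' p)) U :=
    contDiffOn_invSqrt.comp hT'.contDiffOn fun p hp => by simpa using h' p hp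
  exact h1.clm_apply (h2.clm_apply hN.contDiffOn)

/-- The modulus in the kernel as a product of two analytic functions of `q` and of its conjugate. -/
lemma cpow_neg_half_mul_conj {q : ℂ} (hq : ‖q‖ < 1) :
    (1 + q) ^ (-1 / 2 : ℂ) * (1 + (starRingEnd ℂ) q) ^ (-1 / 2 : ℂ) = (‖1 + q‖ : ℂ)⁻¹ := by
  have h1 : 1 + q ∈ Complex.slitPlane := Complex.mem_slitPlane_of_norm_lt_one hq
  have h2 : (1 + (starRingEnd ℂ) q) ^ (-1 / 2 : ℂ) =
      (starRingEnd ℂ) ((1 + q) ^ (-1 / 2 : ℂ)) := by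
    have h3 := Complex.cpow_conj (1 + q) (-1 / 2) (Complex.mem_slitPlane_iff_arg.1 h1).1
    have h4 : (starRingEnd ℂ) (-1 / 2 : ℂ) = -1 / 2 := by
      rw [map_div₀, map_neg, map_one, map_ofNat]
    rw [h4, map_add, map_one] at h3
    rw [h3, Complex.conj_conj]
  have h5 : (-1 / 2 : ℂ) = ((-1 / 2 : ℝ) : ℂ) := by push_cast; rfl
  have h6 : 0 < ‖1 + q‖ := norm_pos_iff.2 (Complex.slitPlane_ne_zero h1)
  rw [h2, Complex.mul_conj, Complex.normSq_eq_norm_sq, h5, Complex.norm_cpow_real,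
    ← Complex.ofReal_inv]
  congr 1
  rw [← Real.rpow_natCast, ← Real.rpow_mul h6.le, ← Real.rpow_neg_one]
  norm_num

variable {ε : ℝ} (hε : ε ∈ Ioo (0 : ℝ) 1) {s : ℕ} (hs : 2 ≤ s)

/-- The sequence `x` encodes the series `f(z) = ∑ a_n z^{-(n+1)}` with real coefficients, and `g(z)`
is `z f'(z)`, on the unit circle. -/
structure Encodes (ε : ℝ) (s : ℕ) (x : LL) (f g : ℂ → ℂ) : Prop where
  real : ∀ n, (starRingEnd ℂ) (x n / (wL ε s n : ℂ)) = x n / (wL ε s n : ℂ)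
  f : ∀ ω : ℂ, ‖ω‖ = 1 →
    HasSum (fun n : ℕ => x n / (wL ε s n : ℂ) * ω ^ (-((n : ℤ) + 1))) (f ω)
  g : ∀ ω : ℂ, ‖ω‖ = 1 →
    HasSum (fun n : ℕ => -((n : ℂ) + 1) * (x n / (wL ε s n : ℂ)) * ω ^ (-((n : ℤ) + 1))) (g ω)

lemma norm_mul_circleMap {ω : ℂ} (hω : ‖ω‖ = 1) (θ : ℝ) : ‖ω * circleMap 0 1 θ‖ = 1 := by
  rw [norm_mul, hω, norm_circleMap_one, one_mul]

lemma conj_powC (m : ℤ) (θ : ℝ) : (starRingEnd ℂ) (powC m θ) = powC (-m) θ := by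
  rw [powC_apply, powC_apply, map_zpow₀, ← inv_zpow', Complex.inv_eq_conj]
  exact norm_circleMap_one θ

lemma conj_zpow_of_norm_eq_one {ω : ℂ} (hω : ‖ω‖ = 1) (m : ℤ) :
    (starRingEnd ℂ) (ω ^ m) = ω ^ (-m) := by
  rw [map_zpow₀, ← inv_zpow', Complex.inv_eq_conj hω]

lemma ne_zero_of_norm_eq_one {ω : ℂ} (hω : ‖ω‖ = 1) : ω ≠ 0 :=
  norm_ne_zero_iff.1 (by rw [hω]; exact one_ne_zero)

lemma conj_quotC (n : ℕ) (θ : ℝ) : (starRingEnd ℂ) (quotC n θ) = quotCConj n θ := by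
  simp only [quotC, quotCConj, BoundedContinuousFunction.coe_neg, Pi.neg_apply,
    BoundedContinuousFunction.coe_sum, Finset.sum_apply, map_neg, map_sum, conj_powC, neg_neg]

variable {x : LL} {f g : ℂ → ℂ}

lemma diffQuot_eval (hs' : 1 ≤ s) (hx : Encodes ε s x f g) {ω : ℂ} (hω : ‖ω‖ = 1) (θ : ℝ) :
    ω * (circleMap 0 1 θ - 1) * evH hε hs' hω ((diffQuot hε hs x).1 θ) =
      f (ω * circleMap 0 1 θ) - f ω := by
  have h0 := ne_zero_of_norm_eq_one hω
  have h1 := (hasSum_evH_toH hε relabelNeg₂ hs' quotC zero_le_one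
    (fun n => by simpa using norm_quotC_le n) x θ hω).mul_left (ω * (circleMap 0 1 θ - 1))
  refine h1.unique (((hx.f _ (norm_mul_circleMap hω θ)).sub (hx.f ω hω)).congr_fun fun n => ?_)
  have h2 : ω ^ (-((n : ℤ) + 1)) = ω * ω ^ (-((n : ℤ) + 2)) := by
    rw [← zpow_one_add₀ h0]
    congr 1
  rw [mul_zpow, h2]
  linear_combination (ω * ω ^ (-((n : ℤ) + 2)) * (x n / (wL ε s n : ℂ))) * mul_quotC n θ

lemma diffQuotConj_eval (hs' : 1 ≤ s) (hx : Encodes ε s x f g) {ω : ℂ} (hω : ‖ω‖ = 1) (θ : ℝ) :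
    evH hε hs' hω ((diffQuotConj hε hs x).1 θ) =
      (starRingEnd ℂ) (evH hε hs' hω ((diffQuot hε hs x).1 θ)) := by
  have h1 := hasSum_evH_toH hε relabelPos₂ hs' quotCConj zero_le_one
    (fun n => by simpa using norm_quotCConj_le n) x θ hω
  have h2 := (hasSum_evH_toH hε relabelNeg₂ hs' quotC zero_le_one
    (fun n => by simpa using norm_quotC_le n) x θ hω).mapL (Complex.conjCLE : ℂ →L[ℝ] ℂ)
  refine h1.unique (h2.congr_fun fun n => ?_)
  change _ = (starRingEnd ℂ) _
  rw [map_mul, map_mul, hx.real, conj_quotC, conj_zpow_of_norm_eq_one hω, neg_neg]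

lemma increment_eval (hx : Encodes ε s x f g) {ω : ℂ} (hω : ‖ω‖ = 1) (θ : ℝ) :
    (circleMap 0 1 θ - 1) * tripleEval hε hω θ (increment hε hs x) =
      g (ω * circleMap 0 1 θ) - g ω := by
  have h1 := (hasSum_evW_toW hε hs relabelNeg (fun n => -((n : ℂ) + 1) • quotC n) zero_le_one
    (fun n => by
      rw [norm_smul, norm_natCast_add_one, one_mul, sq]
      gcongr
      exact norm_quotC_le n) x θ hω).mul_left (circleMap 0 1 θ - 1)
  refine h1.unique (((hx.g _ (norm_mul_circleMap hω θ)).sub (hx.g ω hω)).congr_fun fun n => ?_)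
  rw [mul_zpow]
  simp only [BoundedContinuousFunction.coe_smul, smul_eq_mul]
  linear_combination (ω ^ (-((n : ℤ) + 1)) * (-((n : ℂ) + 1)) * (x n / (wL ε s n : ℂ))) *
    mul_quotC n θ

lemma incrementId_eval {ω : ℂ} (hω : ‖ω‖ = 1) (θ : ℝ) :
    tripleEval hε hω θ (incrementId ε s) = ω := by
  change evW hε hω (monoW ε 1) = ω
  rw [evW_monoW, zpow_one]

lemma norm_evH_le (hs' : 1 ≤ s) {ω : ℂ} (hω : ‖ω‖ = 1) (a : HH) :
    ‖evH hε hs' hω a‖ ≤ ‖iota hs'‖ * ‖a‖ := by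
  have h1 : ‖evW hε hω‖ ≤ 1 := by
    refine (ContinuousLinearMap.opNorm_comp_le _ _).trans ?_
    exact mul_le_one₀ lp.norm_tsumCLM_le (norm_nonneg _) (lp.norm_mapCLM_le _ _ _ _)
  have h2 := (evW hε hω).le_of_opNorm_le h1 (iota hs' a)
  rw [one_mul] at h2
  exact h2.trans ((iota hs').le_opNorm a)

/-- The kernel `(ψ(ωσ) - ψ'(ω)) / |φ(ωσ) - φ'(ω)|` with `σ = e^{iθ}`. -/
def kernel (φ ψ φ' ψ' : ℂ → ℂ) (ω : ℂ) (θ : ℝ) : ℂ :=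
  (ψ (ω * circleMap 0 1 θ) - ψ' ω) / (‖φ (ω * circleMap 0 1 θ) - φ' ω‖ : ℂ)

/-- The singular integral is an analytic function of the conformal map. The operators
`(1 + q)^{-1/2}` and `(1 + q̄)^{-1/2}`, with `q` the difference quotient of `f`, are applied to the
triple which represents `ωσ φ'(ωσ) - ω φ'(ω)`. -/
lemma exists_contDiffOn_diagonal (hs : 2 ≤ s) {b : ℝ} (hb : 0 < b) (hs' : 1 ≤ s) :
    ∃ δ > 0, ∃ S : LL → HH, ContDiffOn ℂ 1 S (Metric.ball 0 δ) ∧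
      ∀ x ∈ Metric.ball (0 : LL) δ, ∀ f g, Encodes ε s x f g → ∀ (ω : ℂ) (hω : ‖ω‖ = 1),
        (∀ θ, b * (ω * circleMap 0 1 θ) + f (ω * circleMap 0 1 θ) = b * ω + f ω →
          circleMap 0 1 θ = 1) ∧
        IntervalIntegrable (kernel (fun z => b * z + f z) (fun z => b * z + g z)
          (fun z => b * z + f z) (fun z => b * z + g z) ω) volume 0 (2 * π) ∧
        evH hε hs' hω (S x) = (2 * π : ℂ)⁻¹ * ∫ θ in (0 : ℝ)..(2 * π),
          kernel (fun z => b * z + f z) (fun z => b * z + g z)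
          (fun z => b * z + f z) (fun z => b * z + g z) ω θ := by
  have hb0 : (b : ℂ) ≠ 0 := by exact_mod_cast hb.ne'
  set T : LL →L[ℂ] (Triple →L[ℂ] Triple) :=
    (tripleMul hε hs').comp ((b : ℂ)⁻¹ • diffQuot hε hs) with hT
  set T' : LL →L[ℂ] (Triple →L[ℂ] Triple) :=
    (tripleMul hε hs').comp ((b : ℂ)⁻¹ • diffQuotConj hε hs) with hT'
  set N : LL → Triple := fun x => (b : ℂ) • incrementId ε s + increment hε hs x with hN
  have hev : ∀ᶠ x : LL in nhds 0, ‖T x‖ < 1 ∧ ‖T' x‖ < 1 ∧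
      ‖(b : ℂ)⁻¹‖ * (‖iota hs'‖ * ‖diffQuot hε hs x‖) < 1 := by
    refine Filter.Eventually.and ?_ (Filter.Eventually.and ?_ ?_)
    · exact (T.continuous.norm.tendsto' 0 0 (by simp)).eventually_lt_const one_pos
    · exact (T'.continuous.norm.tendsto' 0 0 (by simp)).eventually_lt_const one_pos
    · refine (Continuous.tendsto' ?_ 0 0 (by simp)).eventually_lt_const one_pos
      exact continuous_const.mul (continuous_const.mul (diffQuot hε hs).continuous.norm)
  obtain ⟨δ, hδ, hball⟩ := Metric.eventually_nhds_iff_ball.1 hev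
  refine ⟨δ, hδ, fun x => (2 * π * b : ℂ)⁻¹ • (invSqrt (T x) (invSqrt (T' x) (N x))).2.2, ?_, ?_⟩
  · have h1 := contDiffOn_invSqrt_apply (T := T) (T' := T') (N := N) T.contDiff T'.contDiff
      (contDiff_const.add (increment hε hs).contDiff) (U := Metric.ball 0 δ)
      (fun x hx => (hball x hx).1) (fun x hx => (hball x hx).2.1)
    exact ContDiffOn.const_smul _ (h1.snd.snd)
  · intro x hx f g hfg ω hω
    obtain ⟨h1, h2, h3⟩ := hball x hx
    set n := invSqrt (T x) (invSqrt (T' x) (N x)) with hn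
    have hω0 := ne_zero_of_norm_eq_one hω
    set q : ℝ → ℂ := fun θ => (b : ℂ)⁻¹ * evH hε hs' hω ((diffQuot hε hs x).1 θ) with hq
    have hq1 : ∀ θ, ‖q θ‖ < 1 := fun θ => by
      refine lt_of_le_of_lt ?_ h3
      rw [hq, norm_mul]
      gcongr
      refine (norm_evH_le hε hs' hω _).trans ?_
      gcongr
      exact ((diffQuot hε hs x).1.norm_coe_le_norm θ).trans (norm_fst_le _)
    -- the denominator is `|b ω (σ - 1) (1 + q)|` with `|q| < 1`
    have hqφ : ∀ θ, (b * (ω * circleMap 0 1 θ) + f (ω * circleMap 0 1 θ)) - (b * ω + f ω) =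
        b * ω * (circleMap 0 1 θ - 1) * (1 + q θ) := fun θ => by
      have := diffQuot_eval hε hs hs' hfg hω θ
      rw [hq]
      field_simp
      linear_combination -this
    have hq0 : ∀ θ, 1 + q θ ≠ 0 := fun θ =>
      Complex.slitPlane_ne_zero (Complex.mem_slitPlane_of_norm_lt_one (hq1 θ))
    -- the last component of `n` is the integral, as both operators preserve `consistent`
    have hmem : n ∈ consistent hs' := by
      refine invSqrt_mem h1 _ (isClosed_consistent hs') (fun m hm => ?_)
        (invSqrt_mem h2 _ (isClosed_consistent hs') (fun m hm => ?_) ?_)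
      · refine tripleMul_mem hε hs' (fun θ => ?_) hm
        have := diffQuot_consistent hε hs hs' x θ
        change iota hs' ((b : ℂ)⁻¹ • (diffQuot hε hs x).1 θ - (b : ℂ)⁻¹ • (diffQuot hε hs x).2.2) =
          (circleMap 0 1 θ - 1) • (b : ℂ)⁻¹ • (diffQuot hε hs x).2.1 θ
        rw [← smul_sub, map_smul, this, smul_comm]
      · refine tripleMul_mem hε hs' (fun θ => ?_) hm
        have := diffQuotConj_consistent hε hs hs' x θ
        change iota hs' ((b : ℂ)⁻¹ • (diffQuotConj hε hs x).1 θ -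
          (b : ℂ)⁻¹ • (diffQuotConj hε hs x).2.2) =
          (circleMap 0 1 θ - 1) • (b : ℂ)⁻¹ • (diffQuotConj hε hs x).2.1 θ
        rw [← smul_sub, map_smul, this, smul_comm]
      · exact add_mem (Submodule.smul_mem _ _ (incrementId_mem hs')) (increment_mem hε hs hs' x)
    have hval : ∀ θ, tripleEval hε hω θ n = (‖1 + q θ‖ : ℂ)⁻¹ * tripleEval hε hω θ (N x) :=
      fun θ => by
      rw [hn, map_invSqrt h1 (tripleEval hε hω θ) (hq1 θ) (fun m => ?_),
        map_invSqrt h2 (tripleEval hε hω θ) (c := (starRingEnd ℂ) (q θ)) ?_ (fun m => ?_),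
        ← mul_assoc, cpow_neg_half_mul_conj (hq1 θ)]
      · rw [Complex.norm_conj]
        exact hq1 θ
      · have := tripleEval_mul hε hs' hω θ ((b : ℂ)⁻¹ • diffQuotConj hε hs x) m
        refine this.trans ?_
        congr 1
        change evH hε hs' hω ((b : ℂ)⁻¹ • (diffQuotConj hε hs x).1 θ) = _
        rw [map_smul, diffQuotConj_eval hε hs hs' hfg hω, hq, map_mul, map_inv₀,
          Complex.conj_ofReal, smul_eq_mul]
      · have := tripleEval_mul hε hs' hω θ ((b : ℂ)⁻¹ • diffQuot hε hs x) m
        refine this.trans ?_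
        congr 1
        change evH hε hs' hω ((b : ℂ)⁻¹ • (diffQuot hε hs x).1 θ) = _
        rw [map_smul, smul_eq_mul]
    have hker : ∀ θ, kernel (fun z => b * z + f z) (fun z => b * z + g z)
        (fun z => b * z + f z) (fun z => b * z + g z) ω θ =
        (b : ℂ)⁻¹ * (phase θ * tripleEval hε hω θ n) := fun θ => by
      have h4 : (b * (ω * circleMap 0 1 θ) + g (ω * circleMap 0 1 θ)) - (b * ω + g ω) =
          (circleMap 0 1 θ - 1) * tripleEval hε hω θ (N x) := by
        have := increment_eval hε hs hfg hω θ
        rw [hN]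
        simp only [map_add, map_smul, incrementId_eval, smul_eq_mul, mul_add, this]
        ring
      unfold kernel
      simp only
      rw [h4, hqφ, hval, norm_mul, norm_mul, norm_mul, hω, Complex.norm_real,
        Real.norm_of_nonneg hb.le, phase]
      push_cast
      rw [mul_one, div_eq_mul_inv, mul_inv, mul_inv]
      ring
    have hcont : IntervalIntegrable (fun θ => phase θ * tripleEval hε hω θ n) volume 0 (2 * π) :=
      integrable_smul_bcf measurable_phase norm_phase_le
        ((evW hε hω).compLeftContinuousBounded ℝ n.2.1)
    refine ⟨fun θ hθ => ?_, ?_, ?_⟩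
    · have := hqφ θ
      rw [hθ, sub_self, eq_comm] at this
      have h5 := (mul_eq_zero.1 this).resolve_right (hq0 θ)
      exact sub_eq_zero.1 ((mul_eq_zero.1 h5).resolve_left (mul_ne_zero hb0 hω0))
    · rw [funext hker]
      exact hcont.const_mul _
    · rw [funext hker, intervalIntegral.integral_const_mul, map_smul, smul_eq_mul,
        evH_of_consistent hε hs' hω hmem, mul_inv, mul_assoc]
      rfl

end Kernel

/-! ### The singular integral of two distinct conformal maps -/

section OffDiagonal

lemma norm_denom_ge {b c : ℝ} {σ : ℂ} (hσ : ‖σ‖ = 1) (hb : 0 < b) (hc : 0 < c) :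
    |b - c| ≤ ‖(b : ℂ) * σ - c‖ := by
  have h := abs_norm_sub_norm_le ((b : ℂ) * σ) (c : ℂ)
  rwa [norm_mul, hσ, mul_one, Complex.norm_real, Complex.norm_real, Real.norm_of_nonneg hb.le,
    Real.norm_of_nonneg hc.le] at h

/-- The function `(b e^{imθ} - c)⁻¹` for distinct radii `b` and `c`. -/
def denomInv {b c : ℝ} (hb : 0 < b) (hc : 0 < c) (hbc : b ≠ c) (m : ℤ) : ℝ →ᵇ ℂ :=
  have h (θ : ℝ) : |b - c| ≤ ‖(b : ℂ) * powC m θ - c‖ := norm_denom_ge (by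
    rw [powC_apply, norm_zpow, norm_circleMap_one, one_zpow]) hb hc
  have h0 : 0 < |b - c| := abs_pos.2 (sub_ne_zero.2 hbc)
  BoundedContinuousFunction.ofNormedAddCommGroup (fun θ => ((b : ℂ) * powC m θ - c)⁻¹)
    ((((powC m).continuous.const_mul (b : ℂ)).sub continuous_const).inv₀ fun θ =>
      norm_pos_iff.1 (h0.trans_le (h θ))) (|b - c|⁻¹) fun θ => by
      rw [norm_inv]
      exact inv_anti₀ h0 (h θ)

lemma denomInv_apply {b c : ℝ} (hb : 0 < b) (hc : 0 < c) (hbc : b ≠ c) (m : ℤ) (θ : ℝ) :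
    denomInv hb hc hbc m θ = ((b : ℂ) * powC m θ - c)⁻¹ := rfl

variable {ε : ℝ} (hε : ε ∈ Ioo (0 : ℝ) 1) {s : ℕ}

lemma norm_bcf_mul_le {K L : ℝ →ᵇ ℂ} (hL : ‖L‖ ≤ 1) (n : ℕ) :
    ‖K * L‖ ≤ ‖K‖ * ((n : ℝ) + 1) := by
  refine (norm_mul_le _ _).trans ?_
  gcongr
  exact hL.trans (by simp)

/-- The difference quotients `(f(ωσ) - g(ω)) / (ω(bσ - c))`. -/
def diffQuotOff (s : ℕ) {b c : ℝ} (hb : 0 < b) (hc : 0 < c) (hbc : b ≠ c) :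
    LL × LL →L[ℂ] (ℝ →ᵇ HH) :=
  (toH hε relabelNeg₂ s (fun n => denomInv hb hc hbc 1 * powC (-((n : ℤ) + 1))) (norm_nonneg _)
    (fun n => norm_bcf_mul_le (norm_powC_le _) n)).comp (ContinuousLinearMap.fst ℂ _ _) -
  (toH hε relabelNeg₂ s (fun _ => denomInv hb hc hbc 1 * powC 0) (norm_nonneg _)
    (fun n => norm_bcf_mul_le (norm_powC_le _) n)).comp (ContinuousLinearMap.snd ℂ _ _)

/-- The complex conjugates on the unit circle of the difference quotients off the diagonal. -/
def diffQuotOffConj (s : ℕ) {b c : ℝ} (hb : 0 < b) (hc : 0 < c) (hbc : b ≠ c) :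
    LL × LL →L[ℂ] (ℝ →ᵇ HH) :=
  (toH hε relabelPos₂ s (fun n => denomInv hb hc hbc (-1) * powC ((n : ℤ) + 1)) (norm_nonneg _)
    (fun n => norm_bcf_mul_le (norm_powC_le _) n)).comp (ContinuousLinearMap.fst ℂ _ _) -
  (toH hε relabelPos₂ s (fun _ => denomInv hb hc hbc (-1) * powC 0) (norm_nonneg _)
    (fun n => norm_bcf_mul_le (norm_powC_le _) n)).comp (ContinuousLinearMap.snd ℂ _ _)

lemma norm_smul_powC_le (n : ℕ) (m : ℤ) :
    ‖-((n : ℂ) + 1) • powC m‖ ≤ 1 * ((n : ℝ) + 1) := by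
  rw [norm_smul, norm_natCast_add_one, one_mul]
  exact mul_le_of_le_one_right (by positivity) (norm_powC_le m)

/-- The increments `ωσ f'(ωσ) - ω g'(ω)`. -/
def incrementOff (s : ℕ) : LL × LL →L[ℂ] (ℝ →ᵇ HH) :=
  (toH hε relabelNeg s (fun n => -((n : ℂ) + 1) • powC (-((n : ℤ) + 1))) zero_le_one
    (fun n => norm_smul_powC_le n _)).comp (ContinuousLinearMap.fst ℂ _ _) -
  (toH hε relabelNeg s (fun n => -((n : ℂ) + 1) • powC 0) zero_le_one
    (fun n => norm_smul_powC_le n _)).comp (ContinuousLinearMap.snd ℂ _ _)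

/-- The increment `bωσ - cω`. -/
def incrementIdOff (ε : ℝ) (s : ℕ) (b c : ℝ) : ℝ →ᵇ HH :=
  pointwise ((ContinuousLinearMap.lsmul ℂ ℂ).flip) (constC HH (monoH ε s 1))
    ((b : ℂ) • powC 1 - (c : ℂ) • powC 0)

variable {x y : LL} {f g f' g' : ℂ → ℂ}

lemma diffQuotOff_eval (hs' : 1 ≤ s) {b c : ℝ} (hb : 0 < b) (hc : 0 < c) (hbc : b ≠ c)
    (hx : Encodes ε s x f g) (hy : Encodes ε s y f' g') {ω : ℂ} (hω : ‖ω‖ = 1) (θ : ℝ) :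
    ω * (b * circleMap 0 1 θ - c) * evH hε hs' hω (diffQuotOff hε s hb hc hbc (x, y) θ) =
      f (ω * circleMap 0 1 θ) - f' ω := by
  have h0 := ne_zero_of_norm_eq_one hω
  have h1 := (hasSum_evH_toH hε relabelNeg₂ hs'
    (fun n => denomInv hb hc hbc 1 * powC (-((n : ℤ) + 1))) (norm_nonneg _)
    (fun n => norm_bcf_mul_le (norm_powC_le _) n) x θ hω).sub
    (hasSum_evH_toH hε relabelNeg₂ hs' (fun n => denomInv hb hc hbc 1 * powC 0) (norm_nonneg _)
    (fun n => norm_bcf_mul_le (norm_powC_le _) n) y θ hω)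
  rw [← map_sub] at h1
  refine (h1.mul_left (ω * (b * circleMap 0 1 θ - c))).unique
    (((hx.f _ (norm_mul_circleMap hω θ)).sub (hy.f ω hω)).congr_fun fun n => ?_)
  have h2 : ω ^ (-((n : ℤ) + 1)) = ω * ω ^ (-((n : ℤ) + 2)) := by
    rw [← zpow_one_add₀ h0]
    congr 1
  have h3 : (b : ℂ) * circleMap 0 1 θ - c ≠ 0 := norm_pos_iff.1
    ((abs_pos.2 (sub_ne_zero.2 hbc)).trans_le (norm_denom_ge (norm_circleMap_one θ) hb hc))
  simp only [BoundedContinuousFunction.coe_mul, Pi.mul_apply, denomInv_apply, powC_apply,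
    zpow_one, zpow_zero]
  rw [mul_zpow, h2]
  field_simp

lemma conj_denomInv {b c : ℝ} (hb : 0 < b) (hc : 0 < c) (hbc : b ≠ c) (m : ℤ) (θ : ℝ) :
    (starRingEnd ℂ) (denomInv hb hc hbc m θ) = denomInv hb hc hbc (-m) θ := by
  rw [denomInv_apply, denomInv_apply, map_inv₀, map_sub, map_mul, Complex.conj_ofReal,
    Complex.conj_ofReal, conj_powC]

lemma diffQuotOffConj_eval (hs' : 1 ≤ s) {b c : ℝ} (hb : 0 < b) (hc : 0 < c) (hbc : b ≠ c)
    (hx : Encodes ε s x f g) (hy : Encodes ε s y f' g') {ω : ℂ} (hω : ‖ω‖ = 1) (θ : ℝ) :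
    evH hε hs' hω (diffQuotOffConj hε s hb hc hbc (x, y) θ) =
      (starRingEnd ℂ) (evH hε hs' hω (diffQuotOff hε s hb hc hbc (x, y) θ)) := by
  have h1 := (hasSum_evH_toH hε relabelPos₂ hs'
    (fun n => denomInv hb hc hbc (-1) * powC ((n : ℤ) + 1)) (norm_nonneg _)
    (fun n => norm_bcf_mul_le (norm_powC_le _) n) x θ hω).sub
    (hasSum_evH_toH hε relabelPos₂ hs' (fun n => denomInv hb hc hbc (-1) * powC 0) (norm_nonneg _)
    (fun n => norm_bcf_mul_le (norm_powC_le _) n) y θ hω)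
  have h2 := (hasSum_evH_toH hε relabelNeg₂ hs'
    (fun n => denomInv hb hc hbc 1 * powC (-((n : ℤ) + 1))) (norm_nonneg _)
    (fun n => norm_bcf_mul_le (norm_powC_le _) n) x θ hω).sub
    (hasSum_evH_toH hε relabelNeg₂ hs' (fun n => denomInv hb hc hbc 1 * powC 0) (norm_nonneg _)
    (fun n => norm_bcf_mul_le (norm_powC_le _) n) y θ hω)
  rw [← map_sub] at h1 h2
  refine h1.unique ((h2.mapL (Complex.conjCLE : ℂ →L[ℝ] ℂ)).congr_fun fun n => ?_)
  change _ = (starRingEnd ℂ) _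
  simp only [BoundedContinuousFunction.coe_mul, Pi.mul_apply]
  rw [map_sub, map_mul, map_mul, map_mul, map_mul, map_mul, map_mul, hx.real, hy.real,
    conj_denomInv, conj_powC, conj_powC, conj_zpow_of_norm_eq_one hω, neg_neg, neg_neg, neg_zero]

lemma incrementOff_eval (hs' : 1 ≤ s) (hx : Encodes ε s x f g) (hy : Encodes ε s y f' g')
    {ω : ℂ} (hω : ‖ω‖ = 1) (θ : ℝ) :
    evH hε hs' hω (incrementOff hε s (x, y) θ) = g (ω * circleMap 0 1 θ) - g' ω := by
  have h1 := (hasSum_evH_toH hε relabelNeg hs'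
    (fun n => -((n : ℂ) + 1) • powC (-((n : ℤ) + 1))) zero_le_one
    (fun n => norm_smul_powC_le n _) x θ hω).sub
    (hasSum_evH_toH hε relabelNeg hs' (fun n => -((n : ℂ) + 1) • powC 0) zero_le_one
    (fun n => norm_smul_powC_le n _) y θ hω)
  rw [← map_sub] at h1
  refine h1.unique (((hx.g _ (norm_mul_circleMap hω θ)).sub (hy.g ω hω)).congr_fun fun n => ?_)
  simp only [BoundedContinuousFunction.coe_smul, smul_eq_mul, powC_apply, zpow_zero]
  rw [mul_zpow]
  ring

lemma incrementIdOff_eval (hs' : 1 ≤ s) (b c : ℝ) {ω : ℂ} (hω : ‖ω‖ = 1) (θ : ℝ) :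
    evH hε hs' hω (incrementIdOff ε s b c θ) = b * (ω * circleMap 0 1 θ) - c * ω := by
  change evH hε hs' hω (((b : ℂ) * circleMap 0 1 θ ^ (1 : ℤ) -
    (c : ℂ) * circleMap 0 1 θ ^ (0 : ℤ)) • monoH ε s 1) = _
  rw [map_smul, evH_monoH]
  simp only [zpow_one, zpow_zero, smul_eq_mul]
  ring

/-- Off the diagonal, where the kernel is smooth, the integral is an analytic function of the
two conformal maps. -/
lemma exists_contDiffOn_offDiagonal {b c : ℝ} (hb : 0 < b) (hc : 0 < c) (hbc : b ≠ c)
    (hs' : 1 ≤ s) :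
    ∃ δ > 0, ∃ S : LL × LL → HH, ContDiffOn ℂ 1 S (Metric.ball 0 δ) ∧
      ∀ x y, (x, y) ∈ Metric.ball (0 : LL × LL) δ → ∀ f g f' g', Encodes ε s x f g →
        Encodes ε s y f' g' → ∀ (ω : ℂ) (hω : ‖ω‖ = 1),
        (∀ θ, b * (ω * circleMap 0 1 θ) + f (ω * circleMap 0 1 θ) ≠ c * ω + f' ω) ∧
        IntervalIntegrable (kernel (fun z => b * z + f z) (fun z => b * z + g z)
          (fun z => c * z + f' z) (fun z => c * z + g' z) ω) volume 0 (2 * π) ∧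
        evH hε hs' hω (S (x, y)) = (2 * π : ℂ)⁻¹ * ∫ θ in (0 : ℝ)..(2 * π),
          kernel (fun z => b * z + f z) (fun z => b * z + g z)
          (fun z => c * z + f' z) (fun z => c * z + g' z) ω θ := by
  have h0 : 0 < |b - c| := abs_pos.2 (sub_ne_zero.2 hbc)
  set T : LL × LL →L[ℂ] ((ℝ →ᵇ HH) →L[ℂ] (ℝ →ᵇ HH)) :=
    (pointwise (mulH hε hs')).comp (diffQuotOff hε s hb hc hbc) with hT
  set T' : LL × LL →L[ℂ] ((ℝ →ᵇ HH) →L[ℂ] (ℝ →ᵇ HH)) :=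
    (pointwise (mulH hε hs')).comp (diffQuotOffConj hε s hb hc hbc) with hT'
  set N : LL × LL → (ℝ →ᵇ HH) := fun p => incrementIdOff ε s b c + incrementOff hε s p with hN
  set κ : ℝ → ℂ := fun θ => (‖(b : ℂ) * circleMap 0 1 θ - c‖ : ℂ)⁻¹ with hκ
  have hκm : Measurable κ := by
    have := (continuous_circleMap 0 1).measurable
    rw [hκ]
    fun_prop
  have hκb : ∀ θ, ‖κ θ‖ ≤ |b - c|⁻¹ := fun θ => by
    rw [hκ, norm_inv, Complex.norm_real, norm_norm]
    exact inv_anti₀ h0 (norm_denom_ge (norm_circleMap_one θ) hb hc)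
  have hev : ∀ᶠ p : LL × LL in nhds 0, ‖T p‖ < 1 ∧ ‖T' p‖ < 1 ∧
      ‖iota hs'‖ * ‖diffQuotOff hε s hb hc hbc p‖ < 1 := by
    refine Filter.Eventually.and ?_ (Filter.Eventually.and ?_ ?_)
    · exact (T.continuous.norm.tendsto' 0 0 (by simp)).eventually_lt_const one_pos
    · exact (T'.continuous.norm.tendsto' 0 0 (by simp)).eventually_lt_const one_pos
    · refine (Continuous.tendsto' ?_ 0 0 (by simp)).eventually_lt_const one_pos
      exact continuous_const.mul (diffQuotOff hε s hb hc hbc).continuous.norm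
  obtain ⟨δ, hδ, hball⟩ := Metric.eventually_nhds_iff_ball.1 hev
  refine ⟨δ, hδ, fun p => (2 * π : ℂ)⁻¹ • integralC κ hκm hκb
    (invSqrt (T p) (invSqrt (T' p) (N p))), ?_, ?_⟩
  · have h1 := contDiffOn_invSqrt_apply (T := T) (T' := T') (N := N) T.contDiff T'.contDiff
      (contDiff_const.add (incrementOff hε s).contDiff) (U := Metric.ball 0 δ)
      (fun x hx => (hball x hx).1) (fun x hx => (hball x hx).2.1)
    have h2 : ContDiff ℂ 1 (integralC (F := HH) κ hκm hκb) := ContinuousLinearMap.contDiff _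
    exact ContDiffOn.const_smul _ (h2.comp_contDiffOn h1)
  · intro x y hxy f g f' g' hfg hfg' ω hω
    obtain ⟨h1, h2, h3⟩ := hball _ hxy
    set n := invSqrt (T (x, y)) (invSqrt (T' (x, y)) (N (x, y))) with hn
    have hω0 := ne_zero_of_norm_eq_one hω
    set q : ℝ → ℂ := fun θ => evH hε hs' hω (diffQuotOff hε s hb hc hbc (x, y) θ) with hq
    set φ : ℝ → (ℝ →ᵇ HH) →L[ℂ] ℂ := fun θ =>
      (evH hε hs' hω).comp (BoundedContinuousFunction.evalCLM ℂ θ) with hφ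
    have hq1 : ∀ θ, ‖q θ‖ < 1 := fun θ => by
      refine lt_of_le_of_lt ?_ h3
      refine (norm_evH_le hε hs' hω _).trans ?_
      gcongr
      exact (diffQuotOff hε s hb hc hbc (x, y)).norm_coe_le_norm θ
    -- the denominator is `|ω (b σ - c) (1 + q)|` with `|q| < 1` and `b σ - c` bounded from below
    have hqφ : ∀ θ, (b * (ω * circleMap 0 1 θ) + f (ω * circleMap 0 1 θ)) - (c * ω + f' ω) =
        ω * (b * circleMap 0 1 θ - c) * (1 + q θ) := fun θ => by
      have := diffQuotOff_eval hε hs' hb hc hbc hfg hfg' hω θ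
      rw [mul_add, hq]
      simp only
      rw [this]
      ring
    have hq0 : ∀ θ, 1 + q θ ≠ 0 := fun θ =>
      Complex.slitPlane_ne_zero (Complex.mem_slitPlane_of_norm_lt_one (hq1 θ))
    have hd : ∀ θ, (b : ℂ) * circleMap 0 1 θ - c ≠ 0 := fun θ => norm_pos_iff.1
      (h0.trans_le (norm_denom_ge (norm_circleMap_one θ) hb hc))
    have hval : ∀ θ, φ θ n = (‖1 + q θ‖ : ℂ)⁻¹ * φ θ (N (x, y)) := fun θ => by
      rw [hn, map_invSqrt h1 (φ θ) (hq1 θ) (fun m => ?_),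
        map_invSqrt h2 (φ θ) (c := (starRingEnd ℂ) (q θ)) ?_ (fun m => ?_),
        ← mul_assoc, cpow_neg_half_mul_conj (hq1 θ)]
      · rw [Complex.norm_conj]
        exact hq1 θ
      · refine (evH_mulH hε hs' hω _ _).trans ?_
        exact congrArg (· * evH hε hs' hω (m θ))
          (diffQuotOffConj_eval hε hs' hb hc hbc hfg hfg' hω θ)
      · exact evH_mulH hε hs' hω _ _
    have hker : ∀ θ, kernel (fun z => b * z + f z) (fun z => b * z + g z)
        (fun z => c * z + f' z) (fun z => c * z + g' z) ω θ = κ θ * φ θ n := fun θ => by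
      have h4 : (b * (ω * circleMap 0 1 θ) + g (ω * circleMap 0 1 θ)) - (c * ω + g' ω) =
          φ θ (N (x, y)) := by
        have h5 := incrementOff_eval hε hs' hfg hfg' hω θ
        have h6 := incrementIdOff_eval hε hs' b c hω θ
        change _ = evH hε hs' hω (incrementIdOff ε s b c θ + incrementOff hε s (x, y) θ)
        rw [map_add, h5, h6]
        ring
      unfold kernel
      simp only
      rw [h4, hqφ, hval, norm_mul, norm_mul, hω]
      push_cast
      rw [one_mul, div_eq_mul_inv, mul_inv]
      ring
    refine ⟨fun θ hθ => ?_, ?_, ?_⟩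
    · have := hqφ θ
      rw [hθ, sub_self, eq_comm] at this
      exact mul_ne_zero (mul_ne_zero hω0 (hd θ)) (hq0 θ) this
    · rw [funext hker]
      exact integrable_smul_bcf hκm hκb ((evH hε hs' hω).compLeftContinuousBounded ℝ n)
    · rw [funext hker, map_smul, smul_eq_mul, map_integralC (evH hε hs' hω)]
      rfl

end OffDiagonal

/-! ### Laurent series on circles -/

section Laurent

variable {ι : Type*}

lemma integral_zpow_circleMap (m : ℤ) :
    ∫ θ in (0 : ℝ)..(2 * π), circleMap 0 1 θ ^ m = if m = 0 then (2 * π : ℂ) else 0 := by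
  split_ifs with h
  · simp [h]
  · have h1 : ∀ θ : ℝ, circleMap 0 1 θ ^ m = Complex.exp ((m * Complex.I) * θ) := fun θ => by
      rw [circleMap_zero, Complex.ofReal_one, one_mul, ← Complex.exp_int_mul]
      congr 1
      ring
    simp only [h1]
    have hm : (m : ℂ) * Complex.I ≠ 0 := mul_ne_zero (by exact_mod_cast h) Complex.I_ne_zero
    rw [integral_exp_mul_complex hm]
    have h2 : Complex.exp ((m : ℂ) * Complex.I * ((2 * π : ℝ) : ℂ)) = 1 := by
      rw [Complex.exp_eq_one_iff]
      exact ⟨m, by push_cast; ring⟩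
    rw [h2]
    simp

/-- Termwise integration of a Laurent series over the unit circle, against a bounded function. -/
lemma hasSum_integral_laurent [Countable ι] {c : ι → ℂ} {v : ℝ → ℂ} {F : ι → ℝ → ℂ} {B : ι → ℝ}
    (hF : ∀ i, IntervalIntegrable (F i) volume 0 (2 * π))
    (hB : ∀ i θ, ‖F i θ‖ ≤ B i) (hs : Summable B) (hc : ∀ i, ∫ θ in (0 : ℝ)..(2 * π), F i θ = c i)
    (hv : ∀ θ, HasSum (fun i => F i θ) (v θ)) : HasSum c (∫ θ in (0 : ℝ)..(2 * π), v θ) := by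
  have h := intervalIntegral.hasSum_integral_of_dominated_convergence (μ := volume)
    (a := 0) (b := 2 * π) (F := F) (f := v) (fun i _ => B i)
    (fun i => by
      have := (hF i).1.aestronglyMeasurable
      rwa [uIoc_of_le Real.two_pi_pos.le])
    (fun i => Filter.Eventually.of_forall fun θ _ => hB i θ)
    (Filter.Eventually.of_forall fun θ _ => hs) (by simp)
    (Filter.Eventually.of_forall fun θ _ => hv θ)
  refine h.congr_fun fun i => ?_
  exact (hc i).symm

lemma continuous_zpow_circleMap (m : ℤ) : Continuous fun θ : ℝ => circleMap 0 1 θ ^ m :=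
  Continuous.zpow₀ (continuous_circleMap 0 1) m fun _ =>
    Or.inl (circleMap_ne_center one_ne_zero)

lemma norm_zpow_circleMap (m : ℤ) (θ : ℝ) : ‖circleMap 0 1 θ ^ m‖ = 1 := by
  rw [norm_zpow, norm_circleMap_one, one_zpow]

/-- **Parseval's identity** on the unit circle. -/
lemma L2T_eq_of_hasSum [Countable ι] {e : ι → ℤ} (he : Function.Injective e) {c : ι → ℂ}
    (hc : Summable fun i => ‖c i‖) {v : ℂ → ℂ}
    (hv : ∀ ω : ℂ, ‖ω‖ = 1 → HasSum (fun i => c i * ω ^ e i) (v ω)) :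
    Summable (fun i => ‖c i‖ ^ 2) ∧
      L2T v = ENNReal.ofReal (Real.sqrt (2 * π * ∑' i, ‖c i‖ ^ 2)) := by
  classical
  have hv' : ∀ θ : ℝ, HasSum (fun i => c i * circleMap 0 1 θ ^ e i) (v (circleMap 0 1 θ)) :=
    fun θ => hv _ (norm_circleMap_one θ)
  have hcont : Continuous fun θ : ℝ => v (circleMap 0 1 θ) := by
    have h1 : (fun θ : ℝ => v (circleMap 0 1 θ)) =
        fun θ => ∑' i, c i * circleMap 0 1 θ ^ e i := funext fun θ => (hv' θ).tsum_eq.symm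
    rw [h1]
    refine continuous_tsum (fun i => continuous_const.mul (continuous_zpow_circleMap _)) hc
      fun i θ => ?_
    rw [norm_mul, norm_zpow_circleMap, mul_one]
  have hbd : ∀ θ : ℝ, ‖v (circleMap 0 1 θ)‖ ≤ ∑' i, ‖c i‖ := fun θ => by
    refine (hv' θ).norm_le_of_bounded hc.hasSum fun i => ?_
    rw [norm_mul, norm_zpow_circleMap, mul_one]
  -- the Fourier coefficients
  have hcoef : ∀ j, ∫ θ in (0 : ℝ)..(2 * π), v (circleMap 0 1 θ) * circleMap 0 1 θ ^ (-e j) =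
      2 * π * c j := fun j => by
    have h1 : HasSum (fun i => c i * if e i + -e j = 0 then (2 * π : ℂ) else 0)
        (∫ θ in (0 : ℝ)..(2 * π), v (circleMap 0 1 θ) * circleMap 0 1 θ ^ (-e j)) := by
      refine hasSum_integral_laurent (F := fun i θ => c i * circleMap 0 1 θ ^ (e i + -e j))
        (fun i => (continuous_const.mul (continuous_zpow_circleMap _)).intervalIntegrable _ _)
        (fun i θ => ?_) hc (fun i => ?_) fun θ => ?_
      · rw [norm_mul, norm_zpow_circleMap, mul_one]
      · rw [intervalIntegral.integral_const_mul, integral_zpow_circleMap]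
      · refine ((hv' θ).mul_right _).congr_fun fun i => ?_
        rw [zpow_add₀ (circleMap_ne_center one_ne_zero), mul_assoc]
    refine h1.unique ?_
    convert hasSum_ite_eq j (2 * π * c j) using 2 with i
    by_cases hij : i = j
    · subst hij
      simp [mul_comm]
    · have : ¬ e i + -e j = 0 := fun h => hij (he (by omega))
      simp [hij, this]
  have h2 : HasSum (fun i => (2 * π * ‖c i‖ ^ 2 : ℂ))
      (∫ θ in (0 : ℝ)..(2 * π), v (circleMap 0 1 θ) * (starRingEnd ℂ) (v (circleMap 0 1 θ))) := by
    refine hasSum_integral_laurent (B := fun i => (∑' i, ‖c i‖) * ‖c i‖)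
      (F := fun i θ => v (circleMap 0 1 θ) *
        ((starRingEnd ℂ) (c i) * circleMap 0 1 θ ^ (-e i))) (fun i => ?_)
      (fun i θ => ?_) (hc.mul_left _) (fun i => ?_) fun θ => ?_
    · exact (hcont.mul (continuous_const.mul (continuous_zpow_circleMap _))).intervalIntegrable _ _
    · rw [norm_mul, norm_mul, norm_zpow_circleMap, mul_one, Complex.norm_conj]
      gcongr
      exact hbd θ
    · have : ∀ θ : ℝ, v (circleMap 0 1 θ) * ((starRingEnd ℂ) (c i) * circleMap 0 1 θ ^ (-e i)) =
          (starRingEnd ℂ) (c i) * (v (circleMap 0 1 θ) * circleMap 0 1 θ ^ (-e i)) := fun θ => by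
        ring
      simp only [this]
      rw [intervalIntegral.integral_const_mul, hcoef, ← Complex.mul_conj']
      ring
    · have h3 := ((hv' θ).mapL (Complex.conjCLE : ℂ →L[ℝ] ℂ)).mul_left (v (circleMap 0 1 θ))
      refine h3.congr_fun fun i => ?_
      change _ = _ * (starRingEnd ℂ) _
      rw [map_mul, map_zpow₀, ← inv_zpow', Complex.inv_eq_conj (norm_circleMap_one θ)]
  have h3 : ∀ θ : ℝ, v (circleMap 0 1 θ) * (starRingEnd ℂ) (v (circleMap 0 1 θ)) =
      ((‖v (circleMap 0 1 θ)‖ ^ 2 : ℝ) : ℂ) := fun θ => by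
    rw [Complex.mul_conj']
    push_cast
    rfl
  simp only [h3] at h2
  rw [intervalIntegral.integral_ofReal] at h2
  have h4 : HasSum (fun i => 2 * π * ‖c i‖ ^ 2)
      (∫ θ in (0 : ℝ)..(2 * π), ‖v (circleMap 0 1 θ)‖ ^ 2) := by
    rw [← Complex.hasSum_ofReal]
    refine h2.congr_fun fun i => ?_
    push_cast
    rfl
  have h5 : Summable fun i => ‖c i‖ ^ 2 := by
    have := h4.summable.mul_left (2 * π)⁻¹
    refine this.congr fun i => ?_
    field_simp
  refine ⟨h5, ?_⟩
  have h6 : MemLp (fun θ : ℝ => v (circleMap 0 1 θ)) 2 (volume.restrict (Ioc 0 (2 * π))) :=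
    MemLp.of_bound hcont.aestronglyMeasurable _ (Filter.Eventually.of_forall hbd)
  rw [← tsum_mul_left, h4.tsum_eq, L2T,
    h6.eLpNorm_eq_integral_rpow_norm (by norm_num) (by norm_num),
    intervalIntegral.integral_of_le Real.two_pi_pos.le, Real.sqrt_eq_rpow]
  norm_num

end Laurent

/-! ### Derivatives of Laurent series -/

section LaurentDeriv

variable {ι : Type*} {c : ι → ℂ} {e : ι → ℤ} {I : Set ℝ} {h : ℂ → ℂ}

/-- A Laurent series which converges on an open union of circles is differentiable there, term by
term: on an annulus, its terms are bounded by the sum of their norms on the two boundary circles. -/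
lemma hasSum_deriv_laurent (hI : IsOpen I) (hI0 : I ⊆ Ioi 0)
    (hh : ∀ z : ℂ, ‖z‖ ∈ I → HasSum (fun i => c i * z ^ e i) (h z)) {z : ℂ} (hz : ‖z‖ ∈ I) :
    DifferentiableAt ℂ h z ∧ HasSum (fun i => c i * e i * z ^ (e i - 1)) (deriv h z) := by
  obtain ⟨r, R, ⟨hr, hR⟩, hrR⟩ : ∃ r R, ‖z‖ ∈ Ioo r R ∧ Icc r R ⊆ I := by
    obtain ⟨δ, hδ, hb⟩ := Metric.isOpen_iff.1 hI _ hz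
    refine ⟨‖z‖ - δ / 2, ‖z‖ + δ / 2, ⟨by linarith, by linarith⟩, fun x hx => hb ?_⟩
    rw [Metric.mem_ball, Real.dist_eq, abs_lt]
    constructor <;> linarith [hx.1, hx.2]
  have hrle : r ≤ R := (hr.trans hR).le
  have hr0 : 0 < r := hI0 (hrR (left_mem_Icc.2 hrle))
  have hR0 : 0 < R := hr0.trans_le hrle
  have hU : IsOpen {w : ℂ | r < ‖w‖ ∧ ‖w‖ < R} :=
    (isOpen_lt continuous_const continuous_norm).inter (isOpen_lt continuous_norm continuous_const)
  have hs : ∀ t : ℝ, t ∈ I → Summable fun i => ‖c i‖ * t ^ e i := fun t ht => by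
    have ht0 : 0 < t := hI0 ht
    have h1 := (hh (t : ℂ) (by rwa [Complex.norm_real, Real.norm_of_nonneg ht0.le])).summable.norm
    refine h1.congr fun i => ?_
    rw [norm_mul, norm_zpow, Complex.norm_real, Real.norm_of_nonneg ht0.le]
  have hu := (hs r (hrR (left_mem_Icc.2 hrle))).add (hs R (hrR (right_mem_Icc.2 hrle)))
  have hbd : ∀ (i : ι) (w : ℂ), w ∈ {w : ℂ | r < ‖w‖ ∧ ‖w‖ < R} →
      ‖c i * w ^ e i‖ ≤ ‖c i‖ * r ^ e i + ‖c i‖ * R ^ e i := fun i w hw => by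
    rw [norm_mul, norm_zpow, ← mul_add]
    refine mul_le_mul_of_nonneg_left ?_ (norm_nonneg _)
    have hw0 : 0 < ‖w‖ := hr0.trans hw.1
    rcases le_total 0 (e i) with he | he
    · have := zpow_le_zpow_left₀ he hw0.le hw.2.le
      have := zpow_pos hr0 (e i)
      linarith
    · have h1 := zpow_le_zpow_left₀ (neg_nonneg.2 he) hr0.le hw.1.le
      rw [zpow_neg, zpow_neg] at h1
      have := (inv_le_inv₀ (zpow_pos hr0 _) (zpow_pos hw0 _)).1 h1
      have := zpow_pos hR0 (e i)
      linarith
  have hne : ∀ w ∈ {w : ℂ | r < ‖w‖ ∧ ‖w‖ < R}, w ≠ 0 := fun w hw =>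
    norm_pos_iff.1 (hr0.trans hw.1)
  have hd : ∀ i, DifferentiableOn ℂ (fun w => c i * w ^ e i) {w : ℂ | r < ‖w‖ ∧ ‖w‖ < R} :=
    fun i w hw => ((differentiableAt_zpow.2 (Or.inl (hne w hw))).const_mul _).differentiableWithinAt
  have hzU : z ∈ {w : ℂ | r < ‖w‖ ∧ ‖w‖ < R} := ⟨hr, hR⟩
  have heq : (fun w => ∑' i, c i * w ^ e i) =ᶠ[nhds z] h := by
    filter_upwards [hU.mem_nhds hzU] with w hw
    exact (hh w (hrR ⟨hw.1.le, hw.2.le⟩)).tsum_eq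
  constructor
  · have h1 := Complex.differentiableOn_tsum_of_summable_norm hu hd hU hbd
    exact (h1.differentiableAt (hU.mem_nhds hzU)).congr_of_eventuallyEq heq.symm
  · have h1 := Complex.hasSum_deriv_of_summable_norm hu hd hU hbd hzU
    rw [heq.deriv_eq] at h1
    refine h1.congr_fun fun i => ?_
    rw [deriv_const_mul_field, deriv_zpow, mul_assoc]

/-- Termwise differentiation of a Laurent series. -/
lemma hasSum_iteratedDeriv_laurent (hI : IsOpen I) (hI0 : I ⊆ Ioi 0)
    (hh : ∀ z : ℂ, ‖z‖ ∈ I → HasSum (fun i => c i * z ^ e i) (h z)) (m : ℕ) {z : ℂ}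
    (hz : ‖z‖ ∈ I) :
    HasSum (fun i => c i * (∏ l ∈ Finset.range m, ((e i : ℂ) - l)) * z ^ (e i - m))
      (iteratedDeriv m h z) := by
  induction m generalizing z with
  | zero => simpa using hh z hz
  | succ m ih =>
    rw [iteratedDeriv_succ]
    have h1 := (hasSum_deriv_laurent (c := fun i => c i * ∏ l ∈ Finset.range m, ((e i : ℂ) - l))
      (e := fun i => e i - m) hI hI0 (fun w hw => ih hw) hz).2
    refine h1.congr_fun fun i => ?_
    rw [Finset.prod_range_succ]
    push_cast
    rw [sub_sub, ← mul_assoc]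

end LaurentDeriv

/-! ### Integrals over the circle in rotated coordinates -/

lemma exists_circleMap_eq {ω : ℂ} (hω : ‖ω‖ = 1) : ∃ φ : ℝ, circleMap 0 1 φ = ω := by
  have : ω ∈ Metric.sphere (0 : ℂ) |1| := by simpa using hω
  rw [← image_circleMap_Ioc] at this
  obtain ⟨θ, _, hθ⟩ := this
  exact ⟨θ, hθ⟩

lemma circleMap_add (φ θ : ℝ) : circleMap 0 1 (φ + θ) = circleMap 0 1 φ * circleMap 0 1 θ := by
  simp only [circleMap_zero, Complex.ofReal_one, one_mul, Complex.ofReal_add, add_mul,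
    Complex.exp_add]

/-- The substitution `τ = ω e^{iθ}`. -/
lemma circleIntegral_div_eq_rotate (F : ℂ → ℂ) {ω : ℂ} (hω : ‖ω‖ = 1) :
    ∮ τ in C(0, 1), F τ / τ =
      Complex.I * ∫ θ in (0 : ℝ)..(2 * π), F (ω * circleMap 0 1 θ) := by
  obtain ⟨φ, rfl⟩ := exists_circleMap_eq hω
  have hp : Function.Periodic (fun θ : ℝ => F (circleMap 0 1 θ)) (2 * π) := fun θ => by
    simp only [periodic_circleMap 0 1 θ]
  simp only [← circleMap_add]
  rw [intervalIntegral.integral_comp_add_left (fun θ => F (circleMap 0 1 θ)) φ, add_zero,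
    hp.intervalIntegral_add_eq φ 0, zero_add, ← intervalIntegral.integral_const_mul]
  unfold circleIntegral
  refine intervalIntegral.integral_congr fun θ _ => ?_
  have : circleMap 0 1 θ ≠ 0 := circleMap_ne_center one_ne_zero
  simp only [deriv_circleMap, smul_eq_mul]
  field_simp

lemma circleIntegrable_div_of_rotate {F : ℂ → ℂ} {ω : ℂ} (hω : ‖ω‖ = 1)
    (h : IntervalIntegrable (fun θ => F (ω * circleMap 0 1 θ)) volume 0 (2 * π)) :
    CircleIntegrable (fun τ => F τ / τ) 0 1 := by
  obtain ⟨φ, rfl⟩ := exists_circleMap_eq hω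
  have hp : Function.Periodic (fun θ : ℝ => F (circleMap 0 1 (φ + θ))) (2 * π) := fun θ => by
    simp only [← add_assoc, periodic_circleMap 0 1 (φ + θ)]
  simp only [← circleMap_add] at h
  have h1 := (hp.intervalIntegrable₀ Real.two_pi_pos.ne' h (-φ) (2 * π - φ)).comp_add_left (-φ)
  have h2 : IntervalIntegrable (fun θ : ℝ => F (circleMap 0 1 θ)) volume 0 (2 * π) := by
    have e1 : -φ - -φ = 0 := by ring
    have e2 : 2 * π - φ - -φ = 2 * π := by ring
    rw [e1, e2] at h1
    simpa using h1
  unfold CircleIntegrable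
  simp only [div_eq_mul_inv]
  exact h2.mul_continuousOn (Continuous.continuousOn
    ((continuous_circleMap 0 1).inv₀ fun θ => circleMap_ne_center one_ne_zero))

/-! ### The singular integral as a Fourier multiplier -/

lemma norm_zpow_sub_one_le {σ : ℂ} (hσ : ‖σ‖ = 1) (m : ℤ) : ‖σ ^ m - 1‖ ≤ |(m : ℝ)| * ‖σ - 1‖ := by
  have key : ∀ n : ℕ, ‖σ ^ n - 1‖ ≤ n * ‖σ - 1‖ := fun n => by
    rw [← geom_sum_mul, norm_mul]
    refine mul_le_mul_of_nonneg_right ((norm_sum_le _ _).trans ?_) (norm_nonneg _)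
    simp [hσ]
  rcases Int.eq_nat_or_neg m with ⟨n, rfl | rfl⟩
  · simpa using key n
  · have h0 : σ ≠ 0 := norm_pos_iff.1 (by rw [hσ]; exact one_pos)
    have h1 : σ ^ (-(n : ℤ)) - 1 = -(σ ^ (-(n : ℤ)) * (σ ^ n - 1)) := by
      rw [mul_sub, mul_one, ← zpow_natCast σ n, ← zpow_add₀ h0]
      simp
    rw [h1, norm_neg, norm_mul, norm_zpow, hσ, one_zpow, one_mul]
    simpa using key n

lemma norm_lamKernel_le (m : ℤ) (θ : ℝ) :
    ‖(circleMap 0 1 θ ^ m - 1) / (‖circleMap 0 1 θ - 1‖ : ℂ)‖ ≤ |(m : ℝ)| := by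
  rw [norm_div, Complex.norm_real, norm_norm]
  exact div_le_of_le_mul₀ (norm_nonneg _) (abs_nonneg _)
    (norm_zpow_sub_one_le (norm_circleMap_one θ) m)

lemma intervalIntegrable_lamKernel (m : ℤ) (a b : ℝ) :
    IntervalIntegrable (fun θ : ℝ => (circleMap 0 1 θ ^ m - 1) / (‖circleMap 0 1 θ - 1‖ : ℂ))
      volume a b := by
  have hm : Measurable fun θ : ℝ =>
      (circleMap 0 1 θ ^ m - 1) / (‖circleMap 0 1 θ - 1‖ : ℂ) := by
    have h1 := (continuous_circleMap 0 1).measurable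
    have h2 := (continuous_zpow_circleMap m).measurable
    fun_prop
  refine (intervalIntegrable_const (c := |(m : ℝ)|)).mono_fun hm.aestronglyMeasurable
    (Filter.Eventually.of_forall fun θ => ?_)
  rw [Real.norm_eq_abs, abs_abs]
  exact norm_lamKernel_le m θ

lemma norm_lam_le (m : ℤ) : ‖lam m‖ ≤ 2 * π * |(m : ℝ)| := by
  have h := intervalIntegral.norm_integral_le_of_norm_le_const (a := 0) (b := 2 * π)
    (f := fun θ : ℝ => (circleMap 0 1 θ ^ m - 1) / (‖circleMap 0 1 θ - 1‖ : ℂ)) (C := |(m : ℝ)|)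
    fun θ _ => norm_lamKernel_le m θ
  rw [sub_zero, abs_of_pos Real.two_pi_pos] at h
  unfold lam
  linarith

/-- The increments of the multiplier are bounded, as `e^{ikθ} - 1` cancels the singularity. -/
lemma norm_lam_sub_le (m : ℤ) (k : ℕ) : ‖lam m‖ ≤ ‖lam (m - k)‖ + 2 * π * k := by
  have h1 : ‖lam m - lam (m - k)‖ ≤ (k : ℝ) * |2 * π - 0| := by
    unfold lam
    rw [← intervalIntegral.integral_sub (intervalIntegrable_lamKernel _ _ _)
      (intervalIntegrable_lamKernel _ _ _)]
    refine intervalIntegral.norm_integral_le_of_norm_le_const fun θ _ => ?_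
    have h0 : circleMap 0 1 θ ≠ 0 := circleMap_ne_center one_ne_zero
    have h2 : (circleMap 0 1 θ ^ m - 1) / (‖circleMap 0 1 θ - 1‖ : ℂ) -
        (circleMap 0 1 θ ^ (m - k) - 1) / (‖circleMap 0 1 θ - 1‖ : ℂ) =
        circleMap 0 1 θ ^ (m - k) *
          ((circleMap 0 1 θ ^ (k : ℤ) - 1) / (‖circleMap 0 1 θ - 1‖ : ℂ)) := by
      rw [← sub_div, ← mul_div_assoc, mul_sub, ← zpow_add₀ h0]
      simp
    rw [h2, norm_mul, norm_zpow_circleMap, one_mul]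
    simpa using norm_lamKernel_le (k : ℤ) θ
  rw [sub_zero, abs_of_pos Real.two_pi_pos] at h1
  have h2 := norm_sub_norm_le (lam m) (lam (m - k))
  linarith

/-- On Laurent series, the singular integral is the Fourier multiplier `i lam`. -/
lemma hasSum_logIntegral {ι : Type*} [Countable ι] {c : ι → ℂ} {e : ι → ℤ} {v : ℂ → ℂ}
    (hc : Summable fun i => ‖c i‖ * |(e i : ℝ)|)
    (hv : ∀ ω : ℂ, ‖ω‖ = 1 → HasSum (fun i => c i * ω ^ e i) (v ω)) {ω : ℂ} (hω : ‖ω‖ = 1) :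
    HasSum (fun i => Complex.I * (c i * lam (e i)) * ω ^ e i) (logIntegral v ω) := by
  have h0 : ω ≠ 0 := norm_pos_iff.1 (by rw [hω]; exact one_pos)
  unfold logIntegral
  rw [circleIntegral_div_eq_rotate (fun τ => (v τ - v ω) / (‖τ - ω‖ : ℂ)) hω]
  have h1 : HasSum (fun i => c i * ω ^ e i * lam (e i)) (∫ θ in (0 : ℝ)..(2 * π),
      (v (ω * circleMap 0 1 θ) - v ω) / (‖ω * circleMap 0 1 θ - ω‖ : ℂ)) := by
    refine hasSum_integral_laurent (B := fun i => ‖c i‖ * |(e i : ℝ)|)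
      (F := fun i θ => c i * ω ^ e i *
        ((circleMap 0 1 θ ^ e i - 1) / (‖circleMap 0 1 θ - 1‖ : ℂ))) (fun i => ?_)
      (fun i θ => ?_) hc (fun i => ?_) fun θ => ?_
    · exact (intervalIntegrable_lamKernel _ _ _).const_mul _
    · rw [norm_mul, norm_mul, norm_zpow, hω, one_zpow, mul_one]
      exact mul_le_mul_of_nonneg_left (norm_lamKernel_le _ _) (norm_nonneg _)
    · rw [intervalIntegral.integral_const_mul, lam]
    · have h2 : ω * circleMap 0 1 θ - ω = ω * (circleMap 0 1 θ - 1) := by ring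
      rw [h2, norm_mul, hω, one_mul]
      have h3 : ‖ω * circleMap 0 1 θ‖ = 1 := by rw [norm_mul, hω, norm_circleMap_one, one_mul]
      refine (((hv _ h3).sub (hv ω hω)).div_const _).congr_fun fun i => ?_
      rw [mul_zpow]
      ring
  refine (h1.mul_left Complex.I).congr_fun fun i => ?_
  ring

/-! ### The coefficients of a function in `X` -/

section CoefX

variable {ε : ℝ} (hε : ε ∈ Ioo (0 : ℝ) 1) {s : ℕ}

lemma hasSum_spaceA {h : ℂ → ℂ} {a : ℕ → ℝ}
    (ha : ∀ z ∈ exterior ε, HasSum (fun n : ℕ => (a n : ℂ) * (z ^ (n + 1))⁻¹) (h z)) (z : ℂ)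
    (hz : ‖z‖ ∈ Ioi ε) : HasSum (fun n : ℕ => (a n : ℂ) * z ^ (-((n : ℤ) + 1))) (h z) := by
  refine (ha z hz).congr_fun fun n => ?_
  rw [zpow_neg]
  norm_cast

lemma injective_neg_succ : Function.Injective fun n : ℕ => -((n : ℤ) + 1) := fun a b h => by
  simpa using h

/-- The coefficients are determined by the function, by Parseval's identity on one circle. -/
lemma coeff_unique (hε : ε ∈ Ioo (0 : ℝ) 1) {h : ℂ → ℂ} {a b : ℕ → ℝ}
    (ha : ∀ z ∈ exterior ε, HasSum (fun n : ℕ => (a n : ℂ) * (z ^ (n + 1))⁻¹) (h z))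
    (hb : ∀ z ∈ exterior ε, HasSum (fun n : ℕ => (b n : ℂ) * (z ^ (n + 1))⁻¹) (h z)) : a = b := by
  have h1 : ∀ ω : ℂ, ‖ω‖ = 1 →
      HasSum (fun n : ℕ => ((a n : ℂ) - b n) * ω ^ (-((n : ℤ) + 1))) ((fun _ => (0 : ℂ)) ω) :=
    fun ω hω => by
      have hz : ‖ω‖ ∈ Ioi ε := by rw [hω]; exact hε.2
      simpa [sub_mul] using (hasSum_spaceA ha ω hz).sub (hasSum_spaceA hb ω hz)
  have hs : Summable fun n : ℕ => ‖(a n : ℂ) - b n‖ := by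
    simpa using (h1 1 (by simp)).summable.norm
  obtain ⟨h2, h3⟩ := L2T_eq_of_hasSum injective_neg_succ hs h1
  have h4 : L2T (fun _ => (0 : ℂ)) = 0 := by simp [L2T]
  rw [h4, eq_comm, ENNReal.ofReal_eq_zero] at h3
  have h5 : 2 * π * ∑' n, ‖(a n : ℂ) - b n‖ ^ 2 = 0 := by
    have := Real.sqrt_eq_zero'.1 (le_antisymm h3 (Real.sqrt_nonneg _))
    exact le_antisymm this (by positivity)
  have h6 : ∑' n, ‖(a n : ℂ) - b n‖ ^ 2 = 0 := by
    rcases mul_eq_zero.1 h5 with h | h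
    · exact absurd h Real.two_pi_pos.ne'
    · exact h
  have h7 := (hasSum_zero_iff_of_nonneg fun n => by positivity).1 (h6 ▸ h2.hasSum)
  funext n
  have h8 : ‖(a n : ℂ) - b n‖ ^ 2 = 0 := congr_fun h7 n
  have h9 : (a n : ℂ) = b n := sub_eq_zero.1 (norm_eq_zero.1 (pow_eq_zero_iff two_ne_zero |>.1 h8))
  exact_mod_cast h9

/-- The coefficients of a function in `X`. -/
def coefX {k : ℕ} (f : X ε k) : ℕ → ℝ := Classical.choose f.2.1.2.2

lemma hasSum_coefX {k : ℕ} (f : X ε k) : ∀ z ∈ exterior ε,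
    HasSum (fun n : ℕ => (coefX f n : ℂ) * (z ^ (n + 1))⁻¹) (f z) :=
  Classical.choose_spec f.2.1.2.2

lemma coefX_add (hε : ε ∈ Ioo (0 : ℝ) 1) {k : ℕ} (f g : X ε k) :
    coefX (f + g) = coefX f + coefX g := by
  refine coeff_unique hε (hasSum_coefX (f + g)) fun z hz => ?_
  have h := (hasSum_coefX f z hz).add (hasSum_coefX g z hz)
  refine h.congr_fun fun n => ?_
  simp [add_mul]

lemma coefX_smul (hε : ε ∈ Ioo (0 : ℝ) 1) {k : ℕ} (c : ℝ) (f : X ε k) :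
    coefX (c • f) = c • coefX f := by
  refine coeff_unique hε (hasSum_coefX (c • f)) fun z hz => ?_
  have h := (hasSum_coefX f z hz).mul_left (c : ℂ)
  refine h.congr_fun fun n => ?_
  simp [mul_assoc]

lemma norm_prod_neg_succ (n k : ℕ) :
    ((n : ℝ) + 1) ^ k ≤ ‖∏ l ∈ Finset.range k, (((-((n : ℤ) + 1) : ℤ) : ℂ) - l)‖ := by
  rw [norm_prod, ← Finset.card_range k, ← Finset.prod_const, Finset.card_range]
  refine Finset.prod_le_prod (fun _ _ => by positivity) fun l _ => ?_
  have h : (((-((n : ℤ) + 1) : ℤ) : ℂ) - l) = -(((n + 1 + l : ℕ) : ℂ)) := by push_cast; ring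
  rw [h, norm_neg, Complex.norm_natCast]
  push_cast
  have : (0 : ℝ) ≤ l := by positivity
  linarith

lemma two_pi_mul_sum_le_of_L2T_le {ι : Type*} [Countable ι] {e : ι → ℤ} (he : Function.Injective e)
    {c : ι → ℂ} (hc : Summable fun i => ‖c i‖) {v : ℂ → ℂ}
    (hv : ∀ ω : ℂ, ‖ω‖ = 1 → HasSum (fun i => c i * ω ^ e i) (v ω)) {A : ℝ}
    (hA : 0 ≤ A) (h : L2T v ≤ ENNReal.ofReal A) (F : Finset ι) :
    2 * π * ∑ i ∈ F, ‖c i‖ ^ 2 ≤ A ^ 2 := by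
  obtain ⟨h1, h2⟩ := L2T_eq_of_hasSum he hc hv
  rw [h2, ENNReal.ofReal_le_ofReal_iff hA, Real.sqrt_le_left hA] at h
  refine le_trans ?_ h
  have := h1.sum_le_tsum F fun i _ => by positivity
  have h3 := Real.two_pi_pos
  gcongr

/-- The coefficients of `∂_z^k f(ρ ·)` and of its singular integral are bounded in `ℓ²` by the
norm of `f`. -/
lemma sum_coefX_le (hε : ε ∈ Ioo (0 : ℝ) 1) {k : ℕ} (f : X ε k) {ρ : ℝ} (hρ : ε < ρ)
    (F : Finset ℕ) :
    2 * π * ∑ n ∈ F, ((((n : ℝ) + 1) ^ k * |coefX f n| * ρ⁻¹ ^ (n + 1 + k)) *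
      (1 + ‖lam (-((n : ℤ) + 1) - k)‖)) ^ 2 ≤ 4 * ‖f‖ ^ 2 := by
  have hρ0 : 0 < ρ := hε.1.trans hρ
  set p : ℕ → ℂ := fun n => ∏ l ∈ Finset.range k, (((-((n : ℤ) + 1) : ℤ) : ℂ) - l)
  set e : ℕ → ℤ := fun n => -((n : ℤ) + 1) - k
  have he : Function.Injective e := fun a b h => by simpa [e] using h
  have hI0 : Ioi ε ⊆ Ioi 0 := Ioi_subset_Ioi hε.1.le
  have hsum := fun (z : ℂ) (hz : ‖z‖ ∈ Ioi ε) =>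
    hasSum_iteratedDeriv_laurent isOpen_Ioi hI0 (hasSum_spaceA (hasSum_coefX f)) k hz
  set c : ℕ → ℂ := fun n => (coefX f n : ℂ) * p n * (ρ : ℂ) ^ e n
  have hv : ∀ ω : ℂ, ‖ω‖ = 1 →
      HasSum (fun n => c n * ω ^ e n) (iteratedDeriv k f ((ρ : ℂ) * ω)) := fun ω hω => by
    refine (hsum ((ρ : ℂ) * ω) (ext_mem hρ hω)).congr_fun fun n => ?_
    rw [mul_zpow, mul_assoc]
  have hc : Summable fun n => ‖c n‖ := by
    simpa using (hv 1 (by simp)).summable.norm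
  have hc1 : Summable fun n => ‖c n‖ * |(e n : ℝ)| := by
    have hz : ‖(ρ : ℂ)‖ ∈ Ioi ε := by
      rwa [Complex.norm_real, Real.norm_of_nonneg hρ0.le]
    have h1 := (hasSum_deriv_laurent isOpen_Ioi hI0 hsum hz).2.mul_right (ρ : ℂ)
    refine h1.summable.norm.congr fun n => ?_
    have h2 : (ρ : ℂ) ^ (e n - 1) * ρ = (ρ : ℂ) ^ e n := by
      rw [zpow_sub_one₀ (by exact_mod_cast hρ0.ne'), mul_assoc,
        inv_mul_cancel₀ (by exact_mod_cast hρ0.ne'), mul_one]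
    change ‖(coefX f n : ℂ) * p n * (e n : ℂ) * (ρ : ℂ) ^ (e n - 1) * ρ‖ = _
    rw [mul_assoc _ _ (ρ : ℂ), h2, mul_right_comm, norm_mul, Complex.norm_intCast]
  have hfin : enormX ε k f = ENNReal.ofReal ‖f‖ := (ENNReal.ofReal_toReal f.2.2.ne).symm
  have hA1 : L2T (fun ω => iteratedDeriv k f ((ρ : ℂ) * ω)) ≤ ENNReal.ofReal ‖f‖ := by
    rw [← hfin]
    refine (le_iSup₂ (f := fun (ρ : ℝ) (_ : ρ ∈ Ioi ε) =>
      L2T (fun ω => iteratedDeriv k f ((ρ : ℂ) * ω))) ρ hρ).trans ?_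
    exact le_add_right le_add_self
  have hA2 : L2T (logIntegral fun ω => iteratedDeriv k f ((ρ : ℂ) * ω)) ≤
      ENNReal.ofReal ‖f‖ := by
    rw [← hfin]
    refine (le_iSup₂ (f := fun (ρ : ℝ) (_ : ρ ∈ Ioi ε) =>
      L2T (logIntegral fun ω => iteratedDeriv k f ((ρ : ℂ) * ω))) ρ hρ).trans ?_
    exact le_add_self
  have hB1 := two_pi_mul_sum_le_of_L2T_le he hc hv (norm_nonneg f) hA1 F
  have hc2 : Summable fun n => ‖Complex.I * (c n * lam (e n))‖ := by
    refine Summable.of_nonneg_of_le (fun _ => norm_nonneg _) (fun n => ?_) (hc1.mul_left (2 * π))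
    rw [norm_mul, Complex.norm_I, one_mul, norm_mul]
    have := mul_le_mul_of_nonneg_left (norm_lam_le (e n)) (norm_nonneg (c n))
    linarith
  have hB2 := two_pi_mul_sum_le_of_L2T_le he hc2 (fun ω hω => hasSum_logIntegral hc1 hv hω)
    (norm_nonneg f) hA2 F
  -- `(|c| (1 + |λ|))² ≤ 2 |c|² + 2 |c λ|²` combines the two Parseval bounds
  have hterm : ∀ n : ℕ, ((((n : ℝ) + 1) ^ k * |coefX f n| * ρ⁻¹ ^ (n + 1 + k)) *
      (1 + ‖lam (e n)‖)) ^ 2 ≤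
        2 * ‖c n‖ ^ 2 + 2 * ‖Complex.I * (c n * lam (e n))‖ ^ 2 := fun n => by
    have h1 : ((n : ℝ) + 1) ^ k * |coefX f n| * ρ⁻¹ ^ (n + 1 + k) ≤ ‖c n‖ := by
      have h2 : ‖(ρ : ℂ) ^ e n‖ = ρ⁻¹ ^ (n + 1 + k) := by
        have h3 : e n = -((n + 1 + k : ℕ) : ℤ) := by simp only [e]; push_cast; ring
        rw [norm_zpow, Complex.norm_real, Real.norm_of_nonneg hρ0.le, h3, zpow_neg, zpow_natCast,
          inv_pow]
      rw [norm_mul, norm_mul, h2, Complex.norm_real, Real.norm_eq_abs, mul_comm |coefX f n|]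
      have := norm_prod_neg_succ n k
      gcongr
    rw [norm_mul Complex.I, Complex.norm_I, one_mul, norm_mul (c n)]
    have h4 := norm_nonneg (lam (e n))
    calc ((((n : ℝ) + 1) ^ k * |coefX f n| * ρ⁻¹ ^ (n + 1 + k)) * (1 + ‖lam (e n)‖)) ^ 2
        ≤ (‖c n‖ * (1 + ‖lam (e n)‖)) ^ 2 := by gcongr
      _ ≤ _ := by nlinarith [sq_nonneg (‖c n‖ - ‖c n‖ * ‖lam (e n)‖)]
  have h5 := Finset.sum_le_sum fun n (_ : n ∈ F) => hterm n
  rw [Finset.sum_add_distrib, ← Finset.mul_sum, ← Finset.mul_sum] at h5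
  have h6 := mul_le_mul_of_nonneg_left h5 Real.two_pi_pos.le
  refine h6.trans ?_
  linarith

/-- The bound at the radius `ε`, as a limit of the bounds at the radii `ρ > ε`. The weight `wL`
involves the multiplier at `-(n + 1)` and the `X` norm the one at `-(n + 1) - k`; their
difference is bounded. -/
lemma sum_wL_coefX_le (hε : ε ∈ Ioo (0 : ℝ) 1) (s : ℕ) (f : X ε (s + 1)) (F : Finset ℕ) :
    ∑ n ∈ F, ‖((wL ε s n * coefX f n : ℝ) : ℂ)‖ ^ 2 ≤
      ((1 + 2 * π * (s + 1 : ℕ)) * ‖f‖) ^ 2 := by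
  have hlim : ∑ n ∈ F, ((((n : ℝ) + 1) ^ (s + 1) * |coefX f n| * ε⁻¹ ^ (n + 1 + (s + 1))) *
      (1 + ‖lam (-((n : ℤ) + 1) - (s + 1 : ℕ))‖)) ^ 2 ≤ ‖f‖ ^ 2 := by
    have hcont : ContinuousAt (fun ρ : ℝ => ∑ n ∈ F,
        ((((n : ℝ) + 1) ^ (s + 1) * |coefX f n| * ρ⁻¹ ^ (n + 1 + (s + 1))) *
        (1 + ‖lam (-((n : ℤ) + 1) - (s + 1 : ℕ))‖)) ^ 2) ε := by
      have h1 : ContinuousAt (fun ρ : ℝ => ρ⁻¹) ε := continuousAt_inv₀ hε.1.ne'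
      refine tendsto_finsetSum _ fun n _ => ?_
      exact (((h1.pow _).const_mul _).mul_const _).pow 2
    refine le_of_tendsto (hcont.continuousWithinAt (s := Ioi ε)) ?_
    filter_upwards [self_mem_nhdsWithin] with ρ hρ
    have h2 := sum_coefX_le hε f hρ F
    have h3 : (0 : ℝ) ≤ ∑ n ∈ F,
        ((((n : ℝ) + 1) ^ (s + 1) * |coefX f n| * ρ⁻¹ ^ (n + 1 + (s + 1))) *
        (1 + ‖lam (-((n : ℤ) + 1) - (s + 1 : ℕ))‖)) ^ 2 :=
      Finset.sum_nonneg fun n _ => by positivity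
    nlinarith [Real.pi_gt_three]
  rw [mul_pow]
  refine le_trans ?_ (mul_le_mul_of_nonneg_left hlim (sq_nonneg (1 + 2 * π * (s + 1 : ℕ))))
  rw [Finset.mul_sum]
  refine Finset.sum_le_sum fun n _ => ?_
  rw [← mul_pow, Complex.norm_real, Real.norm_eq_abs, abs_mul, abs_of_pos (wL_pos hε s n)]
  have h1 := norm_lam_sub_le (-((n : ℤ) + 1)) (s + 1)
  have h2 := norm_nonneg (lam (-((n : ℤ) + 1) - (s + 1 : ℕ)))
  have h3 : ε⁻¹ ^ (n + 1) ≤ ε⁻¹ ^ (n + 1 + (s + 1)) :=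
    pow_le_pow_right₀ (one_le_inv_of_mem hε) (Nat.le_add_right _ _)
  have h4 : (0 : ℝ) < ε⁻¹ := inv_pos.2 hε.1
  have h5 : 1 + ‖lam (-((n : ℤ) + 1))‖ ≤
      (1 + 2 * π * (s + 1 : ℕ)) * (1 + ‖lam (-((n : ℤ) + 1) - (s + 1 : ℕ))‖) := by
    have : (0 : ℝ) ≤ 2 * π * (s + 1 : ℕ) := by positivity
    nlinarith
  refine pow_le_pow_left₀ (by have := wL_pos hε s n; positivity) ?_ 2
  unfold wL
  calc ((n : ℝ) + 1) ^ (s + 1) * ε⁻¹ ^ (n + 1) * (1 + ‖lam (-((n : ℤ) + 1))‖) * |coefX f n|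
      ≤ ((n : ℝ) + 1) ^ (s + 1) * ε⁻¹ ^ (n + 1 + (s + 1)) *
        ((1 + 2 * π * (s + 1 : ℕ)) * (1 + ‖lam (-((n : ℤ) + 1) - (s + 1 : ℕ))‖)) *
        |coefX f n| := by gcongr
    _ = _ := by ring

/-- The embedding of `X` into the space `LL` of weighted coefficients. -/
def toLL (s : ℕ) : X ε (s + 1) →L[ℝ] LL :=
  LinearMap.mkContinuous
    { toFun := fun f => ⟨fun n => ((wL ε s n * coefX f n : ℝ) : ℂ),
        memℓp_gen' (C := ((1 + 2 * π * (s + 1 : ℕ)) * ‖f‖) ^ 2) fun F => by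
          simpa using sum_wL_coefX_le hε s f F⟩
      map_add' := fun f g => by
        ext n
        simp [coefX_add hε, mul_add]
        rfl
      map_smul' := fun c f => by
        ext n
        simp [coefX_smul hε, mul_left_comm] }
    (1 + 2 * π * (s + 1 : ℕ)) fun f => by
      refine lp.norm_le_of_forall_sum_le (by simp) (by positivity) fun F => ?_
      simpa using sum_wL_coefX_le hε s f F

lemma toLL_apply (f : X ε (s + 1)) (n : ℕ) :
    toLL hε s f n = ((wL ε s n * coefX f n : ℝ) : ℂ) := rfl

lemma toLL_div (f : X ε (s + 1)) (n : ℕ) :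
    toLL hε s f n / (wL ε s n : ℂ) = (coefX f n : ℂ) := by
  rw [toLL_apply, Complex.ofReal_mul, mul_div_cancel_left₀ _
    (Complex.ofReal_ne_zero.2 (wL_pos hε s n).ne')]

lemma encodes_toLL (f : X ε (s + 1)) :
    Encodes ε s (toLL hε s f) f fun z => z * deriv f z := by
  refine ⟨fun n => ?_, fun ω hω => ?_, fun ω hω => ?_⟩
  · rw [toLL_div, Complex.conj_ofReal]
  · simp only [toLL_div]
    exact hasSum_spaceA (hasSum_coefX f) ω (by rw [hω]; exact hε.2)
  · simp only [toLL_div]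
    have h1 := (hasSum_deriv_laurent isOpen_Ioi (Ioi_subset_Ioi hε.1.le)
      (hasSum_spaceA (hasSum_coefX f)) (z := ω) (by rw [hω]; exact hε.2)).2.mul_left ω
    refine h1.congr_fun fun n => ?_
    have h0 := ne_zero_of_norm_eq_one hω
    rw [zpow_sub_one₀ h0]
    push_cast
    field_simp

lemma differentiableAt_X (hε : ε ∈ Ioo (0 : ℝ) 1) {k : ℕ} (f : X ε k) {ω : ℂ} (hω : ‖ω‖ = 1) :
    DifferentiableAt ℂ f ω :=
  f.2.1.2.1.differentiableAt ((isOpen_exterior ε).mem_nhds (show ε < ‖ω‖ by rw [hω]; exact hε.2))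

end CoefX

/-! ### From coefficients to the space `Y` -/

section ToY

variable {ε : ℝ} (hε : ε ∈ Ioo (0 : ℝ) 1) {s : ℕ} (hs : 1 ≤ s)

/-- The Laurent coefficients of the function on the annulus which on the unit circle is the odd
part, with respect to `ω ↦ conj ω`, of the imaginary part of the function encoded by `c`. -/
def oddCoef (ε : ℝ) (s : ℕ) (c : HH) (m : ℤ) : ℂ :=
  -(Complex.I / 2) * ((((c m).re - (c (-m)).re) / wH ε s m : ℝ) : ℂ)

lemma wH_neg (m : ℤ) : wH ε s (-m) = wH ε s m := by
  unfold wH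
  rw [Int.natAbs_neg]

lemma oddCoef_neg (c : HH) (m : ℤ) : oddCoef ε s c (-m) = -oddCoef ε s c m := by
  unfold oddCoef
  rw [wH_neg, neg_neg]
  push_cast
  ring

lemma norm_oddCoef_mul_le (hε : ε ∈ Ioo (0 : ℝ) 1) (c : HH) (m : ℤ) :
    ‖oddCoef ε s c m‖ * wH ε s m ≤ (‖c m‖ + ‖c (-m)‖) / 2 := by
  have h0 := wH_pos hε s m
  unfold oddCoef
  rw [norm_mul, norm_neg, norm_div, Complex.norm_I, Complex.norm_real, Real.norm_eq_abs, abs_div,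
    abs_of_pos h0, mul_assoc, div_mul_cancel₀ _ h0.ne', Complex.norm_ofNat]
  have h1 := Complex.abs_re_le_norm (c m)
  have h2 := Complex.abs_re_le_norm (c (-m))
  have h3 := abs_sub (c m).re (c (-m)).re
  linarith

lemma zpow_le_of_mem (hε : ε ∈ Ioo (0 : ℝ) 1) {t : ℝ} (h1 : ε ≤ t) (h2 : t ≤ 1 / ε) (m : ℤ) :
    t ^ m ≤ ε⁻¹ ^ m.natAbs := by
  have ht : 0 < t := hε.1.trans_le h1
  rcases Int.natAbs_eq m with h | h
  · rw [h, zpow_natCast, Int.natAbs_natCast]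
    exact pow_le_pow_left₀ ht.le (by rwa [one_div] at h2) _
  · rw [h, zpow_neg, zpow_natCast, Int.natAbs_neg, Int.natAbs_natCast, ← inv_pow]
    exact pow_le_pow_left₀ (inv_nonneg.2 ht.le) (inv_anti₀ hε.1 h1) _

lemma summable_oddCoef (hε : ε ∈ Ioo (0 : ℝ) 1) (hs : 1 ≤ s) (c : HH) {z : ℂ}
    (hz : z ∈ annulus ε) : Summable fun m : ℤ => oddCoef ε s c m * z ^ m := by
  have h1 : Summable fun m : ℤ => ‖iota hs c m‖ := seq_one_summable (iota hs c)
  have h2 : Summable fun m : ℤ => ‖iota hs c (-m)‖ := h1.comp_injective neg_injective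
  refine Summable.of_norm_bounded ((h1.add h2).mul_left (1 / 2)) fun m => ?_
  have h3 : ∀ m, ‖iota hs c m‖ = ‖c m‖ * ((1 + (m.natAbs : ℝ)) ^ s)⁻¹ := fun m => by
    rw [iota, mul21_apply, invWeight_apply, norm_mul, Complex.norm_real,
      Real.norm_of_nonneg (by positivity), mul_comm]
  have h4 := norm_oddCoef_mul_le (s := s) hε c m
  have h5 := zpow_le_of_mem hε hz.1.le hz.2.le m
  rw [h3, h3, Int.natAbs_neg, norm_mul, norm_zpow, ← add_mul, ← mul_assoc, ← div_eq_mul_inv,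
    le_div_iff₀ (by positivity)]
  unfold wH at h4
  calc ‖oddCoef ε s c m‖ * ‖z‖ ^ m * (1 + (m.natAbs : ℝ)) ^ s
      ≤ ‖oddCoef ε s c m‖ * ε⁻¹ ^ m.natAbs * (1 + (m.natAbs : ℝ)) ^ s := by gcongr
    _ ≤ _ := by linarith

open Classical in
/-- The function on the annulus, extended by zero, with the Laurent coefficients `oddCoef`. -/
def oddFun (ε : ℝ) (s : ℕ) (c : HH) (z : ℂ) : ℂ :=
  if z ∈ annulus ε then ∑' m : ℤ, oddCoef ε s c m * z ^ m else 0

lemma hasSum_oddFun (hε : ε ∈ Ioo (0 : ℝ) 1) (hs : 1 ≤ s) (c : HH) {z : ℂ}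
    (hz : z ∈ annulus ε) : HasSum (fun m : ℤ => oddCoef ε s c m * z ^ m) (oddFun ε s c z) := by
  rw [oddFun, if_pos hz]
  exact (summable_oddCoef hε hs c hz).hasSum

lemma Ioo_subset_Ioi_zero (hε : ε ∈ Ioo (0 : ℝ) 1) : Ioo ε (1 / ε) ⊆ Ioi 0 := fun _ h =>
  hε.1.trans h.1

lemma mem_annulus_of_norm_one (hε : ε ∈ Ioo (0 : ℝ) 1) {ω : ℂ} (hω : ‖ω‖ = 1) : ω ∈ annulus ε := by
  simpa using ann_mem hε.1 ⟨hε.2, le_rfl⟩ hω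

lemma oddFun_mem_spaceAhat (hε : ε ∈ Ioo (0 : ℝ) 1) (hs : 1 ≤ s) (c : HH) :
    oddFun ε s c ∈ spaceAhat ε := by
  refine ⟨fun z hz => if_neg hz, fun z hz => ?_, fun n =>
    -(((c (n + 1)).re - (c (-(n + 1))).re) / wH ε s (n + 1) / 2), fun z hz => ?_⟩
  · exact (hasSum_deriv_laurent isOpen_Ioo (Ioo_subset_Ioi_zero hε)
      (fun w hw => hasSum_oddFun hε hs c hw) hz).1.differentiableWithinAt
  · have h1 := (hasSum_nat_add_iff' 1).2 (hasSum_oddFun hε hs c hz).nat_add_neg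
    have h2 : oddCoef ε s c 0 = 0 := by simp [oddCoef]
    simp only [Finset.sum_range_one, Nat.cast_zero, neg_zero, h2, zero_mul, add_zero,
      sub_zero] at h1
    refine h1.congr_fun fun n => ?_
    rw [oddCoef_neg, oddCoef, zpow_neg, Nat.cast_add, Nat.cast_one]
    norm_cast
    push_cast
    ring

lemma norm_prod_le (m : ℤ) {l s : ℕ} (hl : l ≤ s) :
    ‖∏ i ∈ Finset.range l, ((m : ℂ) - i)‖ ≤ (s + 1) ^ s * (1 + (m.natAbs : ℝ)) ^ s := by
  have h1 : ‖∏ i ∈ Finset.range l, ((m : ℂ) - i)‖ ≤ ((s + 1) * (1 + (m.natAbs : ℝ))) ^ l := by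
    rw [norm_prod]
    refine (Finset.prod_le_prod (fun _ _ => norm_nonneg _) fun i hi => ?_).trans
      (by rw [Finset.prod_const, Finset.card_range])
    have h2 : (i : ℝ) ≤ s := by exact_mod_cast (Finset.mem_range.1 hi).le.trans hl
    have h3 : ‖(m : ℂ)‖ = m.natAbs := by rw [Complex.norm_intCast, Nat.cast_natAbs, Int.cast_abs]
    refine (norm_sub_le _ _).trans ?_
    rw [h3, Complex.norm_natCast]
    have h4 : (0 : ℝ) ≤ m.natAbs := by positivity
    have h5 : (0 : ℝ) ≤ s := by positivity
    nlinarith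
  rw [← mul_pow]
  refine h1.trans (pow_le_pow_right₀ ?_ hl)
  have h4 : (0 : ℝ) ≤ m.natAbs := by positivity
  have h5 : (0 : ℝ) ≤ s := by positivity
  nlinarith

/-- A derivative of order `l ≤ s` costs a factor `(1 + |m|)^s`, which is part of the weight of `HH`,
and `ρ^{m-l} ≤ ε^{-|m|-s}` on `ε < ρ ≤ 1`. -/
lemma L2T_oddFun_le (hε : ε ∈ Ioo (0 : ℝ) 1) (hs : 1 ≤ s) (c : HH) {l : ℕ} (hl : l ≤ s) {ρ : ℝ}
    (hρ : ρ ∈ Ioc ε 1) : L2T (fun ω => iteratedDeriv l (oddFun ε s c) ((ρ : ℂ) * ω)) ≤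
      ENNReal.ofReal (3 * ((s + 1) ^ s * ε⁻¹ ^ s) * ‖c‖) := by
  have hρ0 : 0 < ρ := hε.1.trans hρ.1
  set d : ℤ → ℂ := fun m => oddCoef ε s c m * (∏ i ∈ Finset.range l, ((m : ℂ) - i)) *
    (ρ : ℂ) ^ (m - l)
  have hv : ∀ ω : ℂ, ‖ω‖ = 1 → HasSum (fun m => d m * ω ^ (m - (l : ℤ)))
      (iteratedDeriv l (oddFun ε s c) ((ρ : ℂ) * ω)) := fun ω hω => by
    refine (hasSum_iteratedDeriv_laurent isOpen_Ioo (Ioo_subset_Ioi_zero hε)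
      (fun w hw => hasSum_oddFun hε hs c hw) l (ann_mem hε.1 hρ hω)).congr_fun fun n => ?_
    rw [mul_zpow, ← mul_assoc]
  have hd : Summable fun m => ‖d m‖ := by simpa using (hv 1 (by simp)).summable.norm
  obtain ⟨h1, h2⟩ := L2T_eq_of_hasSum (fun a b h => by simpa using h) hd hv
  rw [h2]
  refine ENNReal.ofReal_le_ofReal (Real.sqrt_le_iff.2 ⟨?_, ?_⟩)
  · have := inv_pos.2 hε.1
    positivity
  set C : ℝ := (s + 1) ^ s * ε⁻¹ ^ s
  have hC : 0 ≤ C := by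
    have := inv_pos.2 hε.1
    positivity
  have h3 : ∀ m, ‖d m‖ ≤ C * ((‖c m‖ + ‖c (-m)‖) / 2) := fun m => by
    have h4 : ‖(ρ : ℂ) ^ (m - (l : ℤ))‖ ≤ ε⁻¹ ^ s * ε⁻¹ ^ m.natAbs := by
      rw [norm_zpow, Complex.norm_real, Real.norm_of_nonneg hρ0.le, ← pow_add]
      refine (zpow_le_of_mem hε hρ.1.le
        (hρ.2.trans (one_lt_one_div hε.1 hε.2).le) _).trans ?_
      exact pow_le_pow_right₀ (one_le_inv_of_mem hε) (by omega)
    have h5 := norm_prod_le m hl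
    have h6 := norm_oddCoef_mul_le (s := s) hε c m
    rw [norm_mul, norm_mul]
    calc ‖oddCoef ε s c m‖ * ‖∏ i ∈ Finset.range l, ((m : ℂ) - i)‖ * ‖(ρ : ℂ) ^ (m - (l : ℤ))‖
        ≤ ‖oddCoef ε s c m‖ * ((s + 1) ^ s * (1 + (m.natAbs : ℝ)) ^ s) *
          (ε⁻¹ ^ s * ε⁻¹ ^ m.natAbs) := by gcongr
      _ = C * (‖oddCoef ε s c m‖ * wH ε s m) := by
        simp only [wH, C]
        ring
      _ ≤ _ := by gcongr
  have h4 : HasSum (fun m : ℤ => ‖c m‖ ^ 2) (‖c‖ ^ 2) := by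
    simpa using lp.hasSum_norm (p := 2) (by simp) c
  have h5 : HasSum (fun m : ℤ => ‖c (-m)‖ ^ 2) (‖c‖ ^ 2) := (Equiv.neg ℤ).hasSum_iff.2 h4
  have h6 : ∑' m, ‖d m‖ ^ 2 ≤ C ^ 2 * ‖c‖ ^ 2 := by
    have h7 := ((h4.add h5).div_const 2).mul_left (C ^ 2)
    rw [add_self_div_two] at h7
    refine hasSum_le (fun m => ?_) h1.hasSum h7
    calc ‖d m‖ ^ 2 ≤ (C * ((‖c m‖ + ‖c (-m)‖) / 2)) ^ 2 := by
          have := h3 m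
          gcongr
      _ = C ^ 2 * ((‖c m‖ + ‖c (-m)‖) / 2) ^ 2 := by ring
      _ ≤ _ := by
        refine mul_le_mul_of_nonneg_left ?_ (sq_nonneg C)
        nlinarith [sq_nonneg (‖c m‖ - ‖c (-m)‖)]
  have h8 : 2 * π ≤ 9 := by linarith [Real.pi_le_four]
  calc 2 * π * ∑' m, ‖d m‖ ^ 2 ≤ 9 * (C ^ 2 * ‖c‖ ^ 2) := by gcongr
    _ = _ := by ring

lemma enormY_oddFun_le (hε : ε ∈ Ioo (0 : ℝ) 1) (hs : 1 ≤ s) (c : HH) :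
    enormY ε s (oddFun ε s c) ≤ ENNReal.ofReal (6 * ((s + 1) ^ s * ε⁻¹ ^ s) * ‖c‖) := by
  have h0 := inv_pos.2 hε.1
  have h1 : ∀ l ≤ s, supL2 (Ioc ε 1) (iteratedDeriv l (oddFun ε s c)) ≤
      ENNReal.ofReal (3 * ((s + 1) ^ s * ε⁻¹ ^ s) * ‖c‖) := fun l hl =>
    iSup₂_le fun ρ hρ => L2T_oddFun_le hε hs c hl hρ
  have h2 := h1 0 (Nat.zero_le _)
  rw [iteratedDeriv_zero] at h2
  refine (add_le_add h2 (h1 s le_rfl)).trans (le_of_eq ?_)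
  rw [← ENNReal.ofReal_add (by positivity) (by positivity)]
  congr 1
  ring

lemma oddFun_add (hε : ε ∈ Ioo (0 : ℝ) 1) (hs : 1 ≤ s) (c d : HH) :
    oddFun ε s (c + d) = oddFun ε s c + oddFun ε s d := by
  funext z
  by_cases hz : z ∈ annulus ε
  · refine (hasSum_oddFun hε hs (c + d) hz).unique ?_
    refine ((hasSum_oddFun hε hs c hz).add (hasSum_oddFun hε hs d hz)).congr_fun fun m => ?_
    simp only [oddCoef, lp.coeFn_add, Pi.add_apply, Complex.add_re]
    push_cast
    ring
  · simp [oddFun, hz]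

lemma oddFun_smul (hε : ε ∈ Ioo (0 : ℝ) 1) (hs : 1 ≤ s) (a : ℝ) (c : HH) :
    oddFun ε s (a • c) = a • oddFun ε s c := by
  funext z
  by_cases hz : z ∈ annulus ε
  · refine (hasSum_oddFun hε hs (a • c) hz).unique ?_
    refine ((hasSum_oddFun hε hs c hz).const_smul a).congr_fun fun m => ?_
    simp only [oddCoef, lp.coeFn_smul, Pi.smul_apply, Complex.real_smul, Complex.re_ofReal_mul]
    push_cast
    ring
  · simp [oddFun, hz]

/-- The continuous real linear map taking `c` to the function in `Y` with the Laurent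
coefficients `oddCoef`. -/
def toY : HH →L[ℝ] Y ε s :=
  LinearMap.mkContinuous
    { toFun := fun c => (⟨oddFun ε s c, oddFun_mem_spaceAhat hε hs c,
        (enormY_oddFun_le hε hs c).trans_lt ENNReal.ofReal_lt_top⟩ : subY ε s)
      map_add' := fun c d => Subtype.ext (oddFun_add hε hs c d)
      map_smul' := fun a c => Subtype.ext (oddFun_smul hε hs a c) }
    (6 * ((s + 1) ^ s * ε⁻¹ ^ s)) fun c => by
      have h0 := inv_pos.2 hε.1
      exact ENNReal.toReal_le_of_le_ofReal (by positivity) (enormY_oddFun_le hε hs c)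

lemma toY_apply (c : HH) (z : ℂ) : toY hε hs c z = oddFun ε s c z := rfl

/-- On the unit circle, `toY` is the odd part under conjugation of the imaginary part of the
series. -/
lemma toY_apply_of_norm_one (c : HH) {ω : ℂ} (hω : ‖ω‖ = 1)
    (hω' : ‖(starRingEnd ℂ) ω‖ = 1) :
    toY hε hs c ω = ((((evH hε hs hω c).im - (evH hε hs hω' c).im) / 2 : ℝ) : ℂ) := by
  have h0 : ω ≠ 0 := ne_zero_of_norm_eq_one hω
  set A : ℂ := (evH hε hs hω c + (starRingEnd ℂ) (evH hε hs hω' c)) / 2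
  have hA : HasSum (fun m : ℤ => (((c m).re / wH ε s m : ℝ) : ℂ) * ω ^ m) A := by
    have h1 := (hasSum_evH hε hs hω' c).mapL (Complex.conjCLE : ℂ →L[ℝ] ℂ)
    refine (((hasSum_evH hε hs hω c).add h1).div_const 2).congr_fun fun m => ?_
    change _ = (_ + (starRingEnd ℂ) _) / 2
    rw [map_mul, map_zpow₀, Complex.conj_conj, ← add_mul, map_div₀, Complex.conj_ofReal, ← add_div,
      Complex.add_conj]
    push_cast
    ring
  have hA' : HasSum (fun m : ℤ => (((c (-m)).re / wH ε s m : ℝ) : ℂ) * ω ^ m)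
      ((starRingEnd ℂ) A) := by
    have h1 := (Equiv.neg ℤ).hasSum_iff.2 (hA.mapL (Complex.conjCLE : ℂ →L[ℝ] ℂ))
    refine h1.congr_fun fun m => ?_
    change _ = (starRingEnd ℂ) (_ * _)
    rw [map_mul, conj_zpow_of_norm_eq_one hω, Complex.conj_ofReal, Equiv.neg_apply, neg_neg, wH_neg]
  have h2 := (hA.sub hA').mul_left (-(Complex.I / 2))
  have h3 : oddFun ε s c ω = -(Complex.I / 2) * (A - (starRingEnd ℂ) A) := by
    refine (hasSum_oddFun hε hs c (mem_annulus_of_norm_one hε hω)).unique ?_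
    refine h2.congr_fun fun m => ?_
    rw [oddCoef]
    push_cast
    ring
  have h4 : A.im = ((evH hε hs hω c).im - (evH hε hs hω' c).im) / 2 := by
    simp only [A]
    rw [Complex.div_ofNat_im, Complex.add_im, Complex.conj_im, sub_eq_add_neg]
  rw [toY_apply, h3, ← h4, Complex.sub_conj]
  push_cast
  linear_combination (-(A.im : ℂ)) * Complex.I_sq

end ToY

/-! ### The functional in terms of coefficients -/

section Assembly

variable {ε : ℝ} (hε : ε ∈ Ioo (0 : ℝ) 1) {s : ℕ} (hs : 2 ≤ s)

/-- The `i`-th coordinate of a pair of coefficient sequences. -/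
def coord (i : Fin 2) : LL × LL →L[ℂ] LL :=
  if i = 0 then ContinuousLinearMap.fst ℂ LL LL else ContinuousLinearMap.snd ℂ LL LL

lemma coord_mem_ball {i : Fin 2} {p : LL × LL} {δ : ℝ} (hp : p ∈ Metric.ball 0 δ) :
    coord i p ∈ Metric.ball 0 δ := by
  rw [mem_ball_zero_iff] at hp ⊢
  refine lt_of_le_of_lt ?_ hp
  fin_cases i
  · exact norm_fst_le p
  · exact norm_snd_le p

lemma coord_prod_mem_ball {i j : Fin 2} {p : LL × LL} {δ : ℝ} (hp : p ∈ Metric.ball 0 δ) :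
    (coord i p, coord j p) ∈ Metric.ball (0 : LL × LL) δ := by
  have h1 := coord_mem_ball (i := i) hp
  have h2 := coord_mem_ball (i := j) hp
  rw [mem_ball_zero_iff] at h1 h2 ⊢
  exact max_lt h1 h2

/-- The singular integrals `S(Φ_i, Φ_j)`, on and off the diagonal, are analytic functions of the
coefficients. The functions `g i` stand for `z f_i'`, and `Phi b g i` for `z Φ_i'`. -/
lemma exists_contDiffOn_singularIntegral (hs : 2 ≤ s) (hs' : 1 ≤ s) {b : ℝ} (hb : b ∈ Ioo (0 : ℝ) 1)
    (i j : Fin 2) :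
    ∃ δ > 0, ∃ T : LL × LL → HH, ContDiffOn ℂ 1 T (Metric.ball 0 δ) ∧
      ∀ p ∈ Metric.ball (0 : LL × LL) δ, ∀ f g : Fin 2 → ℂ → ℂ,
        (∀ i, Encodes ε s (coord i p) (f i) (g i)) → ∀ (ω : ℂ) (hω : ‖ω‖ = 1),
        (∀ θ, Phi b f i (ω * circleMap 0 1 θ) = Phi b f j ω → i = j ∧ circleMap 0 1 θ = 1) ∧
        IntervalIntegrable (kernel (Phi b f i) (Phi b g i) (Phi b f j) (Phi b g j) ω)
          volume 0 (2 * π) ∧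
        evH hε hs' hω (T p) = (2 * π : ℂ)⁻¹ * ∫ θ in (0 : ℝ)..(2 * π),
          kernel (Phi b f i) (Phi b g i) (Phi b f j) (Phi b g j) ω θ := by
  have e1 : ∀ (f : Fin 2 → ℂ → ℂ) (i : Fin 2),
      Phi b f i = fun z => ((b ^ (i : ℕ) : ℝ) : ℂ) * z + f i z := fun f i => by
    funext z
    rw [Phi, Complex.ofReal_pow]
  by_cases hij : i = j
  · subst hij
    obtain ⟨δ, hδ, T, hT, h⟩ := exists_contDiffOn_diagonal hε hs (pow_pos hb.1 (i : ℕ)) hs'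
    refine ⟨δ, hδ, fun p => T (coord i p),
      hT.comp (coord i).contDiff.contDiffOn fun p hp => coord_mem_ball hp, ?_⟩
    intro p hp f g hfg ω hω
    obtain ⟨h1, h2, h3⟩ := h _ (coord_mem_ball hp) _ _ (hfg i) ω hω
    simp only [e1]
    exact ⟨fun θ hθ => ⟨trivial, h1 θ hθ⟩, h2, h3⟩
  · have hne : b ^ (i : ℕ) ≠ b ^ (j : ℕ) := fun h =>
      hij (Fin.ext ((pow_right_strictAnti₀ hb.1 hb.2).injective h))
    obtain ⟨δ, hδ, T, hT, h⟩ := exists_contDiffOn_offDiagonal hε (pow_pos hb.1 (i : ℕ))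
      (pow_pos hb.1 (j : ℕ)) hne hs'
    refine ⟨δ, hδ, fun p => T (coord i p, coord j p),
      hT.comp ((coord i).contDiff.prodMk (coord j).contDiff).contDiffOn
        fun p hp => coord_prod_mem_ball hp, ?_⟩
    intro p hp f g hfg ω hω
    obtain ⟨h1, h2, h3⟩ := h _ _ (coord_prod_mem_ball (i := i) (j := j) hp) _ _ _ _ (hfg i) (hfg j)
      ω hω
    simp only [e1]
    exact ⟨fun θ hθ => absurd hθ (h1 θ), h2, h3⟩

/-! ### Behaviour under complex conjugation -/

lemma norm_conj_eq_one {ω : ℂ} (hω : ‖ω‖ = 1) : ‖(starRingEnd ℂ) ω‖ = 1 := by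
  rw [Complex.norm_conj, hω]

lemma Encodes.f_conj {x : LL} {f g : ℂ → ℂ} (h : Encodes ε s x f g) {ω : ℂ} (hω : ‖ω‖ = 1) :
    f ((starRingEnd ℂ) ω) = (starRingEnd ℂ) (f ω) := by
  refine (h.f _ (norm_conj_eq_one hω)).unique ?_
  refine ((h.f ω hω).mapL (Complex.conjCLE : ℂ →L[ℝ] ℂ)).congr_fun fun n => ?_
  change _ = (starRingEnd ℂ) (_ * _)
  rw [map_mul, h.real, map_zpow₀]

lemma Encodes.hasSum_conj_g {x : LL} {f g : ℂ → ℂ} (h : Encodes ε s x f g) {ω : ℂ}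
    (hω : ‖ω‖ = 1) :
    HasSum (fun n : ℕ => -((n : ℂ) + 1) * (x n / (wL ε s n : ℂ)) * ω ^ ((n : ℤ) + 1))
      ((starRingEnd ℂ) (g ω)) := by
  refine ((h.g ω hω).mapL (Complex.conjCLE : ℂ →L[ℝ] ℂ)).congr_fun fun n => ?_
  change _ = (starRingEnd ℂ) (_ * _ * _)
  rw [map_mul, map_mul, h.real, conj_zpow_of_norm_eq_one hω, neg_neg, map_neg, map_add, map_one,
    map_natCast]

lemma Encodes.g_conj {x : LL} {f g : ℂ → ℂ} (h : Encodes ε s x f g) {ω : ℂ} (hω : ‖ω‖ = 1) :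
    g ((starRingEnd ℂ) ω) = (starRingEnd ℂ) (g ω) := by
  refine (h.g _ (norm_conj_eq_one hω)).unique ?_
  refine (h.hasSum_conj_g hω).congr_fun fun n => ?_
  rw [← map_zpow₀, conj_zpow_of_norm_eq_one hω, neg_neg]

/-- The singular integral commutes with complex conjugation, by the substitution `θ ↦ 2π - θ`. -/
lemma integral_kernel_conj {φ ψ φ' ψ' : ℂ → ℂ}
    (hφ : ∀ ω : ℂ, ‖ω‖ = 1 → φ ((starRingEnd ℂ) ω) = (starRingEnd ℂ) (φ ω))
    (hψ : ∀ ω : ℂ, ‖ω‖ = 1 → ψ ((starRingEnd ℂ) ω) = (starRingEnd ℂ) (ψ ω))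
    (hφ' : ∀ ω : ℂ, ‖ω‖ = 1 → φ' ((starRingEnd ℂ) ω) = (starRingEnd ℂ) (φ' ω))
    (hψ' : ∀ ω : ℂ, ‖ω‖ = 1 → ψ' ((starRingEnd ℂ) ω) = (starRingEnd ℂ) (ψ' ω))
    {ω : ℂ} (hω : ‖ω‖ = 1) :
    ∫ θ in (0 : ℝ)..(2 * π), kernel φ ψ φ' ψ' ((starRingEnd ℂ) ω) θ =
      (starRingEnd ℂ) (∫ θ in (0 : ℝ)..(2 * π), kernel φ ψ φ' ψ' ω θ) := by
  have h1 := intervalIntegral.integral_comp_sub_left (a := 0) (b := 2 * π)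
    (fun θ => kernel φ ψ φ' ψ' ((starRingEnd ℂ) ω) θ) (2 * π)
  rw [sub_self, sub_zero] at h1
  have h2 : ∀ θ : ℝ, circleMap 0 1 (2 * π - θ) = (starRingEnd ℂ) (circleMap 0 1 θ) := fun θ => by
    rw [← Complex.inv_eq_conj (norm_circleMap_one θ)]
    refine eq_inv_of_mul_eq_one_left ?_
    rw [← circleMap_add, sub_add_cancel]
    simp [circleMap_zero]
  have h3 : ∀ θ : ℝ, kernel φ ψ φ' ψ' ((starRingEnd ℂ) ω) (2 * π - θ) =
      (starRingEnd ℂ) (kernel φ ψ φ' ψ' ω θ) := fun θ => by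
    have h4 := norm_mul_circleMap hω θ
    unfold kernel
    rw [h2, ← map_mul, hφ _ h4, hψ _ h4, hφ' _ hω, hψ' _ hω, ← map_sub, ← map_sub,
      Complex.norm_conj, map_div₀, Complex.conj_ofReal]
  rw [← h1]
  simp only [h3, intervalIntegral.integral_of_le Real.two_pi_pos.le]
  exact integral_conj

lemma Phi_conj {b : ℝ} {f : Fin 2 → ℂ → ℂ} {i : Fin 2}
    (hf : ∀ ω : ℂ, ‖ω‖ = 1 → f i ((starRingEnd ℂ) ω) = (starRingEnd ℂ) (f i ω)) {ω : ℂ}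
    (hω : ‖ω‖ = 1) : Phi b f i ((starRingEnd ℂ) ω) = (starRingEnd ℂ) (Phi b f i ω) := by
  rw [Phi, Phi, hf ω hω, map_add, map_mul, map_pow, Complex.conj_ofReal]

/-! ### The map into `HH` -/

/-- The function `Φ_i`. -/
def phiH (s : ℕ) (b : ℝ) (i : Fin 2) (p : LL × LL) : HH :=
  (b : ℂ) ^ (i : ℕ) • monoH ε s 1 +
    toHConst hε relabelNeg s (fun _ => 1) zero_le_one (fun n => by
      rw [norm_one, one_mul]
      nlinarith [norm_nonneg (lam (-((n : ℤ) + 1))), (Nat.cast_nonneg n : (0 : ℝ) ≤ n)])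
      (coord i p)

/-- The function which is `conj (ω Φ_i'(ω))` on the unit circle. -/
def psiH (s : ℕ) (b : ℝ) (i : Fin 2) (p : LL × LL) : HH :=
  (b : ℂ) ^ (i : ℕ) • monoH ε s (-1) +
    toHConst hε relabelPos s (fun n => -((n : ℂ) + 1)) zero_le_one norm_natCast_le_lam (coord i p)

lemma contDiff_phiH (b : ℝ) (i : Fin 2) : ContDiff ℂ 1 (phiH hε s b i) :=
  contDiff_const.add ((ContinuousLinearMap.contDiff _).comp (coord i).contDiff)

lemma contDiff_psiH (b : ℝ) (i : Fin 2) : ContDiff ℂ 1 (psiH hε s b i) :=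
  contDiff_const.add ((ContinuousLinearMap.contDiff _).comp (coord i).contDiff)

lemma evH_phiH (hs' : 1 ≤ s) (b : ℝ) {i : Fin 2} {p : LL × LL} {f g : Fin 2 → ℂ → ℂ}
    (h : Encodes ε s (coord i p) (f i) (g i)) {ω : ℂ} (hω : ‖ω‖ = 1) :
    evH hε hs' hω (phiH hε s b i p) = Phi b f i ω := by
  rw [phiH, map_add, map_smul, evH_monoH, zpow_one, Phi, smul_eq_mul]
  congr 1
  refine (hasSum_evH_toHConst hε relabelNeg hs' _ _ _ _ hω).unique ?_
  simpa using h.f ω hω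

lemma evH_psiH (hs' : 1 ≤ s) (b : ℝ) {i : Fin 2} {p : LL × LL} {f g : Fin 2 → ℂ → ℂ}
    (h : Encodes ε s (coord i p) (f i) (g i)) {ω : ℂ} (hω : ‖ω‖ = 1) :
    evH hε hs' hω (psiH hε s b i p) = (starRingEnd ℂ) (Phi b g i ω) := by
  rw [psiH, map_add, map_smul, evH_monoH, Phi, smul_eq_mul, map_add, map_mul, map_pow,
    Complex.conj_ofReal, zpow_neg_one, Complex.inv_eq_conj hω]
  congr 1
  exact (hasSum_evH_toHConst hε relabelPos hs' _ _ _ _ hω).unique (h.hasSum_conj_g hω)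

/-- The function whose imaginary part on the unit circle is `G_j`, where `T i p` stands for the
singular integral `S(Φ_i, Φ_j)`. -/
def functional (hs' : 1 ≤ s) (b : ℝ) (j : Fin 2) (T : Fin 2 → LL × LL → HH)
    (q : ℂ × (LL × LL)) : HH :=
  mulH hε hs' (q.1 • phiH hε s b j q.2 - T 0 q.2 + T 1 q.2) (psiH hε s b j q.2)

lemma contDiffOn_functional (hs' : 1 ≤ s) (b : ℝ) (j : Fin 2) {T : Fin 2 → LL × LL → HH}
    {U : Set (LL × LL)} (hT : ∀ i, ContDiffOn ℂ 1 (T i) U) :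
    ContDiffOn ℂ 1 (functional hε hs' b j T) (univ ×ˢ U) := by
  have h1 : ∀ i, ContDiffOn ℂ 1 (fun q : ℂ × (LL × LL) => T i q.2) (univ ×ˢ U) := fun i =>
    (hT i).comp contDiff_snd.contDiffOn fun q hq => hq.2
  have h2 : ContDiff ℂ 1 fun q : ℂ × (LL × LL) => q.1 • phiH hε s b j q.2 :=
    contDiff_fst.smul ((contDiff_phiH hε b j).comp contDiff_snd)
  have h3 : ContDiff ℂ 1 fun q : ℂ × (LL × LL) => psiH hε s b j q.2 :=
    (contDiff_psiH hε b j).comp contDiff_snd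
  have h4 := (h2.contDiffOn.sub (h1 0)).add (h1 1)
  exact ((mulH hε hs').contDiff.comp_contDiffOn h4).clm_apply h3.contDiffOn

/-! ### The functional `G` on the unit circle -/

lemma deriv_Phi {b : ℝ} {f : Fin 2 → ℂ → ℂ} {i : Fin 2} {z : ℂ}
    (hf : DifferentiableAt ℂ (f i) z) :
    deriv (Phi b f i) z = (b : ℂ) ^ (i : ℕ) + deriv (f i) z := by
  have h1 : HasDerivAt (fun z : ℂ => (b : ℂ) ^ (i : ℕ) * z + f i z)
      ((b : ℂ) ^ (i : ℕ) * 1 + deriv (f i) z) z :=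
    ((hasDerivAt_id z).const_mul _).add hf.hasDerivAt
  rw [mul_one] at h1
  exact h1.deriv

/-- The operator `z ∂_z` takes `Φ_i` to the function with the same linear part and with `f_i`
replaced by `z f_i'`. -/
lemma mul_deriv_Phi {b : ℝ} {f : Fin 2 → ℂ → ℂ} {i : Fin 2} {z : ℂ}
    (hf : DifferentiableAt ℂ (f i) z) :
    z * deriv (Phi b f i) z = Phi b (fun i z => z * deriv (f i) z) i z := by
  rw [deriv_Phi hf, Phi]
  ring

lemma rotate_SIntegrand {b : ℝ} {f : Fin 2 → ℂ → ℂ}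
    (hf : ∀ i, ∀ z : ℂ, ‖z‖ = 1 → DifferentiableAt ℂ (f i) z) (i j : Fin 2) {ω : ℂ} (hω : ‖ω‖ = 1) :
    (fun θ : ℝ => (fun τ => (τ * deriv (Phi b f i) τ - ω * deriv (Phi b f j) ω) /
      (‖Phi b f i τ - Phi b f j ω‖ : ℂ)) (ω * circleMap 0 1 θ)) =
    kernel (Phi b f i) (Phi b (fun i z => z * deriv (f i) z) i) (Phi b f j)
      (Phi b (fun i z => z * deriv (f i) z) j) ω := by
  funext θ
  simp only [kernel]
  rw [mul_deriv_Phi (hf i _ (norm_mul_circleMap hω θ)), mul_deriv_Phi (hf j ω hω)]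

lemma S_Phi_eq {b : ℝ} {f : Fin 2 → ℂ → ℂ}
    (hf : ∀ i, ∀ z : ℂ, ‖z‖ = 1 → DifferentiableAt ℂ (f i) z) (i j : Fin 2) {ω : ℂ} (hω : ‖ω‖ = 1) :
    S (Phi b f i) (Phi b f j) ω = (2 * π : ℂ)⁻¹ * ∫ θ in (0 : ℝ)..(2 * π),
      kernel (Phi b f i) (Phi b (fun i z => z * deriv (f i) z) i) (Phi b f j)
        (Phi b (fun i z => z * deriv (f i) z) j) ω θ := by
  unfold S SIntegrand
  rw [circleIntegral_div_eq_rotate (fun τ => (τ * deriv (Phi b f i) τ - ω * deriv (Phi b f j) ω) /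
    (‖Phi b f i τ - Phi b f j ω‖ : ℂ)) hω, rotate_SIntegrand hf i j hω, mul_inv, mul_assoc,
    inv_mul_cancel_left₀ Complex.I_ne_zero]

lemma G_eq_im {b : ℝ} {f : Fin 2 → ℂ → ℂ} {j : Fin 2} {ω : ℂ} (hf : DifferentiableAt ℂ (f j) ω)
    (Ω : ℝ) :
    G b j Ω f ω = ((Ω * Phi b f j ω - S (Phi b f 0) (Phi b f j) ω + S (Phi b f 1) (Phi b f j) ω) *
      (starRingEnd ℂ) (Phi b (fun i z => z * deriv (f i) z) j ω)).im := by
  rw [G, ← mul_deriv_Phi hf, map_mul, mul_assoc, mul_comm ((starRingEnd ℂ) ω)]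

/-- The functional `G`, for pairs of functions with small coefficient sequences. -/
lemma exists_functional (hs : 2 ≤ s) {b : ℝ} (hb : b ∈ Ioo (0 : ℝ) 1) (j : Fin 2) :
    ∃ δ > 0, ∃ F : ℂ × (LL × LL) → HH, ContDiffOn ℂ 1 F (univ ×ˢ Metric.ball 0 δ) ∧
      ∀ p ∈ Metric.ball (0 : LL × LL) δ, ∀ f : Fin 2 → ℂ → ℂ,
        (∀ i, Encodes ε s (coord i p) (f i) fun z => z * deriv (f i) z) →
        (∀ i, ∀ z : ℂ, ‖z‖ = 1 → DifferentiableAt ℂ (f i) z) → ∀ (ω : ℂ), ‖ω‖ = 1 →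
        (∀ i, ∀ τ : ℂ, ‖τ‖ = 1 → Phi b f i τ = Phi b f j ω → i = j ∧ τ = ω) ∧
        (∀ i, CircleIntegrable (SIntegrand (Phi b f i) (Phi b f j) ω) 0 1) ∧
        ∀ Ω : ℝ, toY hε (one_le_two.trans hs) (F ((Ω : ℂ), p)) ω = (G b j Ω f ω : ℂ) := by
  have hs' : 1 ≤ s := one_le_two.trans hs
  choose δ hδ T hT h using fun i => exists_contDiffOn_singularIntegral hε hs hs' hb i j
  refine ⟨min (δ 0) (δ 1), lt_min (hδ 0) (hδ 1), functional hε hs' b j T,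
    contDiffOn_functional hε hs' b j fun i => (hT i).mono (Metric.ball_subset_ball ?_), ?_⟩
  · fin_cases i
    exacts [min_le_left _ _, min_le_right _ _]
  intro p hp f hfp hf ω hω
  have hmem : ∀ i, p ∈ Metric.ball (0 : LL × LL) (δ i) := fun i => by
    refine Metric.ball_subset_ball ?_ hp
    fin_cases i
    exacts [min_le_left _ _, min_le_right _ _]
  have h0 := fun i => h i p (hmem i) f _ hfp
  refine ⟨fun i τ hτ hi => ?_, fun i => ?_, fun Ω => ?_⟩
  · have hn : ω ≠ 0 := ne_zero_of_norm_eq_one hω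
    obtain ⟨θ, hθ⟩ := exists_circleMap_eq (ω := ω⁻¹ * τ) (by rw [norm_mul, norm_inv, hω, hτ]; simp)
    have h1 : ω * circleMap 0 1 θ = τ := by rw [hθ, mul_inv_cancel_left₀ hn]
    obtain ⟨h2, h3⟩ := (h0 i ω hω).1 θ (by rw [h1, hi])
    refine ⟨h2, ?_⟩
    rw [← h1, h3, mul_one]
  · have h1 := (h0 i ω hω).2.1
    rw [← rotate_SIntegrand hf i j hω] at h1
    exact circleIntegrable_div_of_rotate hω h1
  · have hev : ∀ (ω : ℂ) (hω : ‖ω‖ = 1), evH hε hs' hω (functional hε hs' b j T ((Ω : ℂ), p)) =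
        (Ω * Phi b f j ω - S (Phi b f 0) (Phi b f j) ω + S (Phi b f 1) (Phi b f j) ω) *
          (starRingEnd ℂ) (Phi b (fun i z => z * deriv (f i) z) j ω) := fun ω hω => by
      rw [functional, evH_mulH, map_add, map_sub, map_smul, (h0 0 ω hω).2.2, (h0 1 ω hω).2.2,
        evH_phiH hε hs' b (p := p) (g := fun i z => z * deriv (f i) z) (hfp j) hω, S_Phi_eq hf 0 j hω, S_Phi_eq hf 1 j hω, smul_eq_mul]
      congr 1
      exact evH_psiH hε hs' b (g := fun i z => z * deriv (f i) z) (hfp j) hω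
    have hc := norm_conj_eq_one hω
    have hΦ : ∀ i, ∀ ω : ℂ, ‖ω‖ = 1 →
        Phi b f i ((starRingEnd ℂ) ω) = (starRingEnd ℂ) (Phi b f i ω) := fun i ω hω =>
      Phi_conj (fun ω hω => (hfp i).f_conj hω) hω
    have hΨ : ∀ i, ∀ ω : ℂ, ‖ω‖ = 1 →
        Phi b (fun i z => z * deriv (f i) z) i ((starRingEnd ℂ) ω) =
          (starRingEnd ℂ) (Phi b (fun i z => z * deriv (f i) z) i ω) := fun i ω hω =>
      Phi_conj (f := fun i z => z * deriv (f i) z) (fun ω hω => (hfp i).g_conj hω) hω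
    have hS : ∀ i, S (Phi b f i) (Phi b f j) ((starRingEnd ℂ) ω) =
        (starRingEnd ℂ) (S (Phi b f i) (Phi b f j) ω) := fun i => by
      rw [S_Phi_eq hf i j hω, S_Phi_eq hf i j hc,
        integral_kernel_conj (hΦ i) (hΨ i) (hΦ j) (hΨ j) hω, map_mul, map_inv₀, map_mul,
        Complex.conj_ofReal, Complex.conj_ofNat]
    -- the coefficients are real, so the imaginary part is already odd under conjugation
    have hcj : evH hε hs' hc (functional hε hs' b j T ((Ω : ℂ), p)) =
        (starRingEnd ℂ) (evH hε hs' hω (functional hε hs' b j T ((Ω : ℂ), p))) := by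
      rw [hev _ hc, hev _ hω, hΦ j ω hω, hΨ j ω hω, hS, hS]
      simp only [map_mul, map_add, map_sub, Complex.conj_ofReal]
    rw [toY_apply_of_norm_one hε hs' _ hω hc, hcj, Complex.conj_im, sub_neg_eq_add,
      add_self_div_two, hev ω hω, G_eq_im (hf j ω hω)]

/-- The map `(Ω, f₁, f₂) ↦ (Ω, x₁, x₂)` to the coefficient sequences. -/
def toCoeffs (s : ℕ) : ℝ × X ε (s + 1) × X ε (s + 1) →L[ℝ] ℂ × (LL × LL) :=
  Complex.ofRealCLM.prodMap ((toLL hε s).prodMap (toLL hε s))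

end Assembly

end VStates

end

theorem mainTheorem3 (ε : ℝ) (hε : ε ∈ Set.Ioo (0 : ℝ) 1) (b : ℝ) (hb : b ∈ Set.Ioo (0 : ℝ) 1)
    (j : Fin 2) (k : ℕ) (hk : 3 ≤ k) :
    ∃ r ∈ Set.Ioo (0 : ℝ) 1,
      -- the integrals defining `G_j` make sense on `ℝ × V_r × V_r`
      (∀ f₁ ∈ Metric.closedBall (0 : VStates.X ε k) r, ∀ f₂ ∈ Metric.closedBall (0 : VStates.X ε k) r,
        ∀ i : Fin 2, ∀ ω : ℂ, ‖ω‖ = 1 →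
          (∀ τ : ℂ, ‖τ‖ = 1 → VStates.Phi b ![f₁, f₂] i τ = VStates.Phi b ![f₁, f₂] j ω →
            i = j ∧ τ = ω) ∧
          CircleIntegrable
            (VStates.SIntegrand (VStates.Phi b ![f₁, f₂] i) (VStates.Phi b ![f₁, f₂] j) ω) 0 1) ∧
      -- `G_j` takes its values in `Y^{k-1}` and is of class `C¹`
      ∃ 𝒢 : ℝ × VStates.X ε k × VStates.X ε k → VStates.Y ε (k - 1),
        (∀ Ω : ℝ, ∀ f₁ ∈ Metric.closedBall (0 : VStates.X ε k) r,
          ∀ f₂ ∈ Metric.closedBall (0 : VStates.X ε k) r, ∀ ω : ℂ, ‖ω‖ = 1 →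
            𝒢 (Ω, f₁, f₂) ω = (VStates.G b j Ω ![f₁, f₂] ω : ℂ)) ∧
        ContDiffOn ℝ 1 𝒢
          (Set.univ ×ˢ Metric.closedBall (0 : VStates.X ε k) r ×ˢ
            Metric.closedBall (0 : VStates.X ε k) r) := by
  obtain ⟨s, rfl⟩ : ∃ s, k = s + 1 := ⟨k - 1, by omega⟩
  have hs : 2 ≤ s := by omega
  obtain ⟨δ, hδ, F, hF, h⟩ := VStates.exists_functional hε hs hb j
  obtain ⟨r, hr0, hr1, hr⟩ : ∃ r : ℝ, 0 < r ∧ r < 1 ∧ ‖VStates.toLL hε s‖ * r < δ := by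
    have hpos : 0 < δ / (‖VStates.toLL hε s‖ + 1) := by positivity
    refine ⟨min (δ / (‖VStates.toLL hε s‖ + 1)) 1 / 2, by positivity, ?_, ?_⟩
    · have := min_le_right (δ / (‖VStates.toLL hε s‖ + 1)) 1
      linarith
    · have h1 := min_le_left (δ / (‖VStates.toLL hε s‖ + 1)) 1
      have h2 : 0 < min (δ / (‖VStates.toLL hε s‖ + 1)) 1 := by positivity
      have h3 := norm_nonneg (VStates.toLL hε s)
      have h4 : (‖VStates.toLL hε s‖ + 1) * min (δ / (‖VStates.toLL hε s‖ + 1)) 1 ≤ δ := by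
        rw [le_div_iff₀ (by positivity)] at h1
        linarith
      nlinarith
  have hball : ∀ f ∈ Metric.closedBall (0 : VStates.X ε (s + 1)) r,
      VStates.toLL hε s f ∈ Metric.ball 0 δ := fun f hf => by
    rw [mem_closedBall_zero_iff] at hf
    rw [mem_ball_zero_iff]
    exact ((VStates.toLL hε s).le_opNorm_of_le hf).trans_lt hr
  have hmem : ∀ f₁ ∈ Metric.closedBall (0 : VStates.X ε (s + 1)) r,
      ∀ f₂ ∈ Metric.closedBall (0 : VStates.X ε (s + 1)) r,
      (VStates.toLL hε s f₁, VStates.toLL hε s f₂) ∈ Metric.ball (0 : VStates.LL × VStates.LL) δ :=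
    fun f₁ hf₁ f₂ hf₂ => by
      have h1 := hball f₁ hf₁
      have h2 := hball f₂ hf₂
      rw [mem_ball_zero_iff] at h1 h2 ⊢
      exact max_lt h1 h2
  -- both functions are encoded by coefficient sequences in the ball on which `F` is analytic
  have hcore := fun f₁ hf₁ f₂ hf₂ => h _ (hmem f₁ hf₁ f₂ hf₂) ![f₁, f₂]
    (Fin.forall_fin_two.2 ⟨VStates.encodes_toLL hε f₁, VStates.encodes_toLL hε f₂⟩)
    (Fin.forall_fin_two.2 ⟨fun z hz => VStates.differentiableAt_X hε f₁ hz,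
      fun z hz => VStates.differentiableAt_X hε f₂ hz⟩)
  refine ⟨r, ⟨hr0, hr1⟩, fun f₁ hf₁ f₂ hf₂ i ω hω =>
    ⟨(hcore f₁ hf₁ f₂ hf₂ ω hω).1 i, (hcore f₁ hf₁ f₂ hf₂ ω hω).2.1 i⟩,
    fun q => VStates.toY hε (one_le_two.trans hs) (F (VStates.toCoeffs hε s q)),
    fun Ω f₁ hf₁ f₂ hf₂ ω hω => (hcore f₁ hf₁ f₂ hf₂ ω hω).2.2 Ω, ?_⟩
  -- `F` is complex differentiable in the coefficients, which are real linear in `f₁` and `f₂`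
  have h1 : ContDiffOn ℝ 1 F (univ ×ˢ Metric.ball 0 δ) := hF.restrict_scalars ℝ
  have h2 := h1.comp (VStates.toCoeffs hε s).contDiff.contDiffOn
    (s := Set.univ ×ˢ Metric.closedBall (0 : VStates.X ε (s + 1)) r ×ˢ
      Metric.closedBall (0 : VStates.X ε (s + 1)) r)
    fun q hq => ⟨trivial, hmem _ hq.2.1 _ hq.2.2⟩
  exact (VStates.toY hε (one_le_two.trans hs)).contDiff.comp_contDiffOn h2
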